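/- Let $M$ be a smooth ($C^\infty$) Hausdorff second countable manifold of dimension $2n$ and $Z\subset M$ a closed embedded hypersurface. A $b$-vector field is a smooth vector field on $M$ that is tangent to $Z$ along $Z$; the $b$-vector fields are the sections of a vector bundle ${}^bTM$. Let $\omega$ be a $b$-symplectic form on $(M,Z)$, i.e. a closed smooth section of $\Lambda^2({}^bT^*M)$ that is nondegenerate in every fibre. A defining function of $Z$ is a smooth $h:M\to\mathbb R$ with $h^{-1}(0)=Z$ and $dh\neq 0$ on $Z$. A $b$-function is a function $c\log|h|+g$ with values in $\mathbb R\cup\{\infty\}$, where $c\in\mathbb R$, $h$ is a defining function of $Z$ (not required if $c=0$) and $g$ is smooth. Its differential $c\,\frac{dh}{h}+dg$ is a section of ${}^bT^*M$, and its Hamiltonian vector field $X_f$ is the $b$-vector field with $\iota_{X_f}\omega=-df$; put $\{f,g\}=dg(X_f)$. A non-commutative $b$-integrable system of rank $r$ is a tuple $F=(f_1,\dots,f_s)$ with $r\le s$ and $r+s=2n$, where $f_1,\dots,f_r$ are $b$-functions and $f_{r+1},\dots,f_s$ are smooth, such that: (1) $df_1,\dots,df_s$ are linearly independent as $b$-covectors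 on a dense open subset of $M$ and on a dense open subset of $Z$; (2) $\{f_i,f_j\}=0$ for $i\le r$, $j\le s$; (3) $X_{f_1},\dots,X_{f_r}$ are linearly independent as ordinary tangent vectors at some point of $Z$. A point is regular if $df_1,\dots,df_s$ are linearly independent as $b$-covectors there and $X_{f_1},\dots,X_{f_r}$ are linearly independent as tangent vectors there. On the set of regular points, $X_{f_1},\dots,X_{f_r}$ span a distribution; the integral manifold (leaf) $\varepsilon_q$ through a regular point $q$ is the set of points joined to $q$ by piecewise $C^1$ curves of regular points that are tangent to this distribution. **Proposition.** Let $F$ be a non-commutative $b$-integrable system of rank $r$ on $(M,Z,\omega)$ and let $m\in Z$ be a regular point whose integral manifold $\varepsilon_m$ is compact. Then there is a non-commutative $b$-integrable system $F'=(f'_1,\dots,f'_s)$ of rank $r$ on $(M,Z,\omega)$ with the following properties. (a) $F'$ has the form $(\log|t|,f'_2,\dots,f'_s)$ with $t$ a defining function of $Z$ and $f'_2,\dots,f'_s$ smooth. It is equivalent to $F$: there is a linear isomorphism $A$ of $\mathbb R^s$ with $F'=A\circ F$ wherever $F$ is finite, and $A$ is a Poisson map between the (finite) target spaces of $F$ and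 $F'$, i.e. $\{f'_k,f'_l\}=\sum_{i,j}A_{ki}A_{lj}\{f_i,f_j\}$ wherever $F$ is finite. If $F$ itself is already of the form $(\log|t|,f_2,\dots,f_s)$ with $t$ a defining function of $Z$ and $f_2,\dots,f_s$ smooth, then $F'=F$. (b) There are an open neighbourhood $U$ of $\varepsilon_m$ consisting of regular points of $F$, an open ball $B^s\subset\mathbb R^s$ and a diffeomorphism $\phi:U\to\mathbb T^r\times B^s$, where the $B^s$-component of $\phi(m)$ is the centre of $B^s$, such that $\phi$ takes the foliation by the integral manifolds of $F$ to the trivial foliation $\{\mathbb T^r\times\{b\}\}_{b\in B^s}$ (for each $q\in U$ the whole integral manifold $\varepsilon_q$ is contained in $U$ and equals $\phi^{-1}(\mathbb T^r\times\{b\})$ with $b$ the $B^s$-component of $\phi(q)$; in particular $\varepsilon_m$ is an $r$-torus), and $$F'=(\log|\pi_1|,\pi_2,\dots,\pi_s)\circ\phi\quad\text{on }U,$$ where $\pi_1,\dots,\pi_s$ are the coordinates on $B^s\subset\mathbb R^s$ and $\log|0|=\infty$. -/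

import Mathlib

open scoped Manifold ContDiff Topology

namespace BSymp

noncomputable section

/-- The model space `ℝᵈ`, with its Euclidean norm. -/
abbrev E (d : ℕ) : Type := EuclideanSpace ℝ (Fin d)

section LieBracket

open VectorField

/-! Two facts about Lie brackets, which show that `b`-vector fields are closed under them. -/

lemma two_le_infty_aux : (2 : WithTop ℕ∞) ≤ ∞ := WithTop.coe_le_coe.2 (le_top : (2 : ℕ∞) ≤ ⊤)

lemma fderiv_lieBracket_aux {V₀ : Type*} [NormedAddCommGroup V₀] [NormedSpace ℝ V₀]
    [CompleteSpace V₀]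
    {h : V₀ → ℝ} {V W : V₀ → V₀} {x : V₀} (hh : ContDiffAt ℝ ∞ h x) (h0 : h x = 0)
    (hd : fderiv ℝ h x ≠ 0) (hV : ContDiffAt ℝ 1 V x) (hW : ContDiffAt ℝ 1 W x)
    (hVt : ∀ᶠ y in 𝓝 x, h y = 0 → fderiv ℝ h y (V y) = 0)
    (hWt : ∀ᶠ y in 𝓝 x, h y = 0 → fderiv ℝ h y (W y) = 0) :
    fderiv ℝ h x (lieBracket ℝ V W x) = 0 := by
  have h2 : ContDiffAt ℝ 1 (fderiv ℝ h) x := hh.fderiv_right (m := 1) (by norm_cast)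
  have key : ∀ {V W : V₀ → V₀}, ContDiffAt ℝ 1 W x →
      (∀ᶠ y in 𝓝 x, h y = 0 → fderiv ℝ h y (W y) = 0) → fderiv ℝ h x (V x) = 0 →
      fderiv ℝ (fderiv ℝ h) x (V x) (W x) + fderiv ℝ h x (fderiv ℝ W x (V x)) = 0 := by
    intro V W hW hWt hVx
    have hu : ContDiffAt ℝ 1 (fun y => fderiv ℝ h y (W y)) x := h2.clm_apply hW
    have hux : fderiv ℝ h x (W x) = 0 := hWt.self_of_nhds h0
    have hext : IsLocalExtrOn (fun y => fderiv ℝ h y (W y)) {y | h y = h x} x := by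
      left
      have := (hWt.filter_mono (nhdsWithin_le_nhds (s := {y | h y = h x})))
      filter_upwards [this, self_mem_nhdsWithin] with y hy hy'
      have : h y = 0 := by rw [← h0]; exact hy'
      simp [hux, hy this]
    obtain ⟨a, b, hab, hz⟩ := hext.exists_multipliers_of_hasStrictFDerivAt_1d
      (hh.hasStrictFDerivAt (by simp)) (hu.hasStrictFDerivAt (by simp))
    have hb : b ≠ 0 := by
      rintro rfl
      have ha : a ≠ 0 := by rintro rfl; exact hab rfl
      have : a • fderiv ℝ h x = 0 := by simpa using hz
      rcases smul_eq_zero.1 this with h' | h'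
      exacts [ha h', hd h']
    have h3 := congrArg (fun L => L (V x)) hz
    have h4 : fderiv ℝ (fun y => fderiv ℝ h y (W y)) x (V x) = 0 := by
      simpa [hVx, hb] using h3
    rw [fderiv_clm_apply (h2.differentiableAt (by simp)) (hW.differentiableAt (by simp))] at h4
    simp at h4
    linarith
  have k1 := key (V := V) hW hWt (hVt.self_of_nhds h0)
  have k2 := key (V := W) hV hVt (hWt.self_of_nhds h0)
  have hs : IsSymmSndFDerivAt ℝ h x := hh.isSymmSndFDerivAt (by simpa using two_le_infty_aux)
  rw [lieBracket, map_sub]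
  have := hs (V x) (W x)
  linarith

variable {d : ℕ} {M : Type*} [TopologicalSpace M] [ChartedSpace (E d) M]
  [IsManifold (𝓡 d) ∞ M]

lemma mfderiv_mlieBracket_aux {h : M → ℝ} {p : M} {V W : Π q : M, TangentSpace (𝓡 d) q}
   (hh : ContMDiffAt (𝓡 d) 𝓘(ℝ, ℝ) ∞ h p) (h0 : h p = 0)
   (hhd : ∀ᶠ q in 𝓝 p, MDifferentiableAt (𝓡 d) 𝓘(ℝ, ℝ) h q)
   (hd : mfderiv (𝓡 d) 𝓘(ℝ, ℝ) h p ≠ 0)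
   (hV : ContMDiff (𝓡 d) (𝓡 d).tangent ∞ (fun q => (⟨q, V q⟩ : TangentBundle (𝓡 d) M)))
   (hW : ContMDiff (𝓡 d) (𝓡 d).tangent ∞ (fun q => (⟨q, W q⟩ : TangentBundle (𝓡 d) M)))
   (hVt : ∀ᶠ y in 𝓝 p, h y = 0 → mfderiv (𝓡 d) 𝓘(ℝ, ℝ) h y (V y) = 0)
   (hWt : ∀ᶠ y in 𝓝 p, h y = 0 → mfderiv (𝓡 d) 𝓘(ℝ, ℝ) h y (W y) = 0) :
   mfderiv (𝓡 d) 𝓘(ℝ, ℝ) h p (mlieBracket (𝓡 d) V W p) = 0 := by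
  have : IsManifold (𝓡 d) 2 M := IsManifold.of_le (n := ∞) two_le_infty_aux
  have : IsManifold (𝓡 d) 1 M := IsManifold.of_le (n := ∞) (by exact_mod_cast le_top)
  let φ := extChartAt (𝓡 d) p
  let x : E d := φ p
  have hxt : x ∈ φ.target := mem_extChartAt_target p
  have htn : φ.target ∈ 𝓝 x := extChartAt_target_mem_nhds p
  have hpx : φ.symm x = p := extChartAt_to_inv p
  have hφc : ContMDiffAt 𝓘(ℝ, E d) (𝓡 d) ∞ φ.symm x :=
    (contMDiffOn_extChartAt_symm p).contMDiffAt htn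
  have hinv : ∀ y ∈ φ.target,
      (mfderiv 𝓘(ℝ, E d) (𝓡 d) φ.symm y).IsInvertible := by
    intro y hy
    have := isInvertible_mfderivWithin_extChartAt_symm (I := 𝓡 d) hy
    rwa [(𝓡 d).range_eq_univ, mfderivWithin_univ] at this
  have hinv2 : (mfderiv (𝓡 d) 𝓘(ℝ, E d) φ p).IsInvertible :=
    isInvertible_mfderiv_extChartAt (mem_extChartAt_source p)
  let h' : E d → ℝ := h ∘ φ.symm
  have hsm : ContDiffAt ℝ ∞ h' x := by
    rw [← contMDiffAt_iff_contDiffAt]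
    exact ContMDiffAt.comp x (by rw [hpx]; exact hh) hφc
  have hpull : ∀ {Y : Π q : M, TangentSpace (𝓡 d) q},
      ContMDiff (𝓡 d) (𝓡 d).tangent ∞ (fun q => (⟨q, Y q⟩ : TangentBundle (𝓡 d) M)) →
      ContDiffAt ℝ 1 (fun y => mpullback 𝓘(ℝ, E d) (𝓡 d) φ.symm Y y) x := by
    intro Y hY
    have h1 := ContMDiffAt.mpullback_vectorField_preimage (m := 1) (n := ∞)
      (I := 𝓘(ℝ, E d)) (I' := 𝓡 d) (f := φ.symm) (x₀ := x) (V := Y)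
      (hY.contMDiffAt.of_le (by exact_mod_cast le_top)) hφc (hinv x hxt) (by
        rw [one_add_one_eq_two]; exact two_le_infty_aux)
    refine contMDiffAt_iff_contDiffAt.1 ?_
    exact (contMDiff_snd_tangentBundle_modelSpace _ _).contMDiffAt.comp x h1
  have hder : ∀ {Y : Π q : M, TangentSpace (𝓡 d) q},
      (∀ᶠ y in 𝓝 p, h y = 0 → mfderiv (𝓡 d) 𝓘(ℝ, ℝ) h y (Y y) = 0) →
      ∀ᶠ y in 𝓝 x, h' y = 0 → fderiv ℝ h' y
        (mpullback 𝓘(ℝ, E d) (𝓡 d) φ.symm Y y) = 0 := by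
    intro Y hY
    have hcont : Filter.Tendsto φ.symm (𝓝 x) (𝓝 p) := by
      have := hφc.continuousAt
      rwa [ContinuousAt, hpx] at this
    filter_upwards [hcont.eventually hY, hcont.eventually hhd, htn] with y h1 h2 h3 h4
    have h5 : MDifferentiableAt 𝓘(ℝ, E d) (𝓡 d) φ.symm y :=
      ((contMDiffOn_extChartAt_symm (n := ∞) p).contMDiffAt
        ((isOpen_extChartAt_target p).mem_nhds h3)).mdifferentiableAt (by simp)
    have h6 : fderiv ℝ h' y = (mfderiv (𝓡 d) 𝓘(ℝ, ℝ) h (φ.symm y)).comp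
        (mfderiv 𝓘(ℝ, E d) (𝓡 d) φ.symm y) := by
      rw [← mfderiv_eq_fderiv]
      exact mfderiv_comp y h2 h5
    rw [h6]
    exact (congrArg (mfderiv (𝓡 d) 𝓘(ℝ, ℝ) h (φ.symm y))
      (ContinuousLinearMap.IsInvertible.self_apply_inverse (hinv y h3) (Y (φ.symm y)))).trans
      (h1 h4)
  have hmain : mfderiv (𝓡 d) 𝓘(ℝ, ℝ) h p = (fderiv ℝ h' x).comp
      (mfderiv (𝓡 d) 𝓘(ℝ, E d) φ p) := by
    have h1 : h =ᶠ[𝓝 p] h' ∘ φ := by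
      filter_upwards [extChartAt_source_mem_nhds (I := 𝓡 d) p] with q hq
      exact congrArg h (φ.left_inv hq).symm
    rw [h1.mfderiv_eq, ← mfderiv_eq_fderiv]
    exact mfderiv_comp p (hsm.differentiableAt (by simp)).mdifferentiableAt
      (mdifferentiableAt_extChartAt (mem_chart_source _ p))
  have hd' : fderiv ℝ h' x ≠ 0 := by
    intro h0
    apply hd
    rw [hmain, h0]
    exact ContinuousLinearMap.zero_comp _
  have := fderiv_lieBracket_aux hsm (by change h (φ.symm x) = 0; rw [hpx, h0]) hd' (hpull hV) (hpull hW)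
    (hder hVt) (hder hWt)
  rw [hmain, ← mlieBracketWithin_univ, mlieBracketWithin_apply]
  refine (congrArg (fderiv ℝ h' x)
    (ContinuousLinearMap.IsInvertible.self_apply_inverse hinv2 _)).trans ?_
  refine Eq.trans (congrArg (fderiv ℝ h' x) ?_) this
  simp only [(𝓡 d).range_eq_univ, Set.preimage_univ, Set.univ_inter, mpullbackWithin_univ]
  exact congrFun (lieBracketWithin_univ (𝕜 := ℝ) (E := E d)) x

end LieBracket

section Geometry

variable {M : Type*} [TopologicalSpace M] (d : ℕ) [ChartedSpace (E d) M]

/-- `h` is a defining function of `Z` on the open set `U`: it is smooth on `U`, its zero set in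
`U` is `Z ∩ U`, and its differential does not vanish at the points of `Z ∩ U`. -/
structure IsDefiningFunctionOn (Z U : Set M) (h : M → ℝ) : Prop where
  isOpen : IsOpen U
  smooth : ContMDiffOn (𝓡 d) 𝓘(ℝ, ℝ) ∞ h U
  zero_iff : ∀ q ∈ U, h q = 0 ↔ q ∈ Z
  mfderiv_ne : ∀ q ∈ U ∩ Z, mfderiv (𝓡 d) 𝓘(ℝ, ℝ) h q ≠ 0

/-- A (global) defining function of `Z`. -/
def IsDefiningFunction (Z : Set M) (h : M → ℝ) : Prop :=
  IsDefiningFunctionOn d Z Set.univ h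

/-- A closed embedded hypersurface: a closed set with a local defining function near each of its
points. -/
structure IsHypersurface (Z : Set M) : Prop where
  isClosed : IsClosed Z
  exists_defining : ∀ p ∈ Z, ∃ (U : Set M) (h : M → ℝ), p ∈ U ∧ IsDefiningFunctionOn d Z U h

variable {d}

/-- A vector `v` at a point `p` of the hypersurface `Z` is tangent to `Z`: it is annihilated by
the differential at `p` of the local defining functions of `Z`. -/
def IsTangentTo (Z : Set M) (p : M) (v : TangentSpace (𝓡 d) p) : Prop :=
  ∀ (U : Set M) (h : M → ℝ), p ∈ U → IsDefiningFunctionOn d Z U h →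
    mfderiv (𝓡 d) 𝓘(ℝ, ℝ) h p v = 0

/-- `log |x|` with values in `ℝ ∪ {∞}`; it is `∞` at `x = 0`. -/
def logAbs (x : ℝ) : OnePoint ℝ :=
  if x = 0 then OnePoint.infty else ((Real.log |x| : ℝ) : OnePoint ℝ)

variable (d) in
/-- A function with values in `ℝ ∪ {∞}` which is everywhere finite and smooth. -/
def IsSmoothFun (f : M → OnePoint ℝ) : Prop :=
  ∃ g : M → ℝ, ContMDiff (𝓡 d) 𝓘(ℝ, ℝ) ∞ g ∧ ∀ p, f p = (g p : OnePoint ℝ)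

variable (d) in
/-- A `b`-function `c log |h| + g`, with values in `ℝ ∪ {∞}`: here `c` is a real number, `g` is
smooth and `h` is a defining function of `Z`. For `c = 0` it is just a smooth function; for
`c ≠ 0` its value on `Z` is `∞`. -/
def IsBFunction (Z : Set M) (f : M → OnePoint ℝ) : Prop :=
  IsSmoothFun d f ∨
    ∃ (c : ℝ) (h g : M → ℝ), c ≠ 0 ∧ IsDefiningFunction d Z h ∧
      ContMDiff (𝓡 d) 𝓘(ℝ, ℝ) ∞ g ∧
      (∀ p ∈ Z, f p = OnePoint.infty) ∧
      ∀ p ∉ Z, f p = ((c * Real.log |h p| + g p : ℝ) : OnePoint ℝ)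

/-- The real function underlying a function with values in `ℝ ∪ {∞}` (with value `0` at the
points where the latter is infinite; only its values off `Z` are ever used). -/
def finitePart (f : M → OnePoint ℝ) (p : M) : ℝ := (f p).elim 0 id

variable [IsManifold (𝓡 d) ∞ M]

variable (d) in
/-- The space of `b`-vector fields: the smooth vector fields on `M` which are tangent to `Z` at
every point of `Z`. -/
def BVectorField (Z : Set M) :
    Submodule ℝ Cₛ^∞⟮𝓡 d; E d, (TangentSpace (𝓡 d) : M → Type _)⟯ where
  carrier := {X | ∀ p ∈ Z, IsTangentTo Z p (X p)}
  add_mem' := by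
    intro X Y hX hY p hp U h hpU hh
    have := hX p hp U h hpU hh
    have := hY p hp U h hpU hh
    simp_all
  zero_mem' := by
    intro p hp U h hpU hh
    simp
  smul_mem' := by
    intro c X hX p hp U h hpU hh
    have := hX p hp U h hpU hh
    simp_all

variable {Z : Set M}

/-- The Lie bracket of two `b`-vector fields, which is again a `b`-vector field. -/
def bBracket (X Y : BVectorField d Z) : BVectorField d Z :=
  ⟨⟨fun p => VectorField.mlieBracket (𝓡 d) (fun q => X.1 q) (fun q => Y.1 q) p, by
      have : IsManifold (𝓡 d) (minSmoothness ℝ 2) M := by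
        rw [minSmoothness_of_isRCLikeNormedField]
        exact IsManifold.of_le (n := ∞) two_le_infty_aux
      have : IsManifold (𝓡 d) (((⊤ : ℕ∞) : WithTop ℕ∞) + 1) M := by
        change IsManifold (𝓡 d) ∞ M
        infer_instance
      intro p
      exact ContMDiffAt.mlieBracket_vectorField (m := ⊤) (n := ⊤) (X.1.contMDiff p)
        (Y.1.contMDiff p) (by rw [minSmoothness_of_isRCLikeNormedField]; exact le_rfl)⟩, by
    intro p hp U h hpU hh
    have hU : U ∈ 𝓝 p := hh.isOpen.mem_nhds hpU
    have aux : ∀ W : BVectorField d Z, ∀ᶠ y in 𝓝 p, h y = 0 →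
        mfderiv (𝓡 d) 𝓘(ℝ, ℝ) h y (W.1 y) = 0 := by
      intro W
      filter_upwards [hU] with y hy hy0
      exact W.2 y ((hh.zero_iff y hy).1 hy0) U h hy hh
    refine mfderiv_mlieBracket_aux (hh.smooth.contMDiffAt hU) ((hh.zero_iff p hpU).2 hp) ?_
      (hh.mfderiv_ne p ⟨hpU, hp⟩) X.1.contMDiff Y.1.contMDiff (aux X) (aux Y)
    filter_upwards [hU] with y hy
    exact (hh.smooth.contMDiffAt (hh.isOpen.mem_nhds hy)).mdifferentiableAt (by simp)⟩

/-- The derivative of a real function along a `b`-vector field. -/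
def lieDeriv (X : BVectorField d Z) (u : M → ℝ) (p : M) : ℝ :=
  mfderiv (𝓡 d) 𝓘(ℝ, ℝ) u p (X.1 p)

variable (d Z) in
/-- The space `I_p · ᵇ𝔛(M)` spanned by the `b`-vector fields of the form `u • X`, where `u` is a
smooth function vanishing at `p` and `X` is a `b`-vector field. -/
def vanishingAt (p : M) : Submodule ℝ (BVectorField d Z) :=
  Submodule.span ℝ {Y | ∃ (u : C^∞⟮𝓡 d, M; ℝ⟯) (X : BVectorField d Z),
    u p = 0 ∧ ∀ q, Y.1 q = u q • X.1 q}

variable (d Z) in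
/-- The fibre `ᵇT_p M` at `p` of the `b`-tangent bundle, i.e. of the vector bundle whose sections
are the `b`-vector fields: the `b`-vector fields modulo `I_p · ᵇ𝔛(M)`. -/
abbrev BTangent (p : M) : Type _ := BVectorField d Z ⧸ vanishingAt d Z p

/-- The value at `p` of a `b`-vector field, as a section of the `b`-tangent bundle. -/
def bValue (p : M) : BVectorField d Z →ₗ[ℝ] BTangent d Z p := (vanishingAt d Z p).mkQ

variable (d Z) in
/-- The `b`-cotangent space `ᵇT*_p M`. -/
abbrev BCotangent (p : M) : Type _ := Module.Dual ℝ (BTangent d Z p)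

variable (d Z) in
/-- A `b`-symplectic form on `(M, Z)`: a smooth alternating bilinear form on the `b`-tangent
bundle which is closed and nondegenerate in each fibre. Closedness is expressed by the invariant
formula for the exterior derivative. -/
structure BSymplecticForm where
  /-- the bilinear form on the fibre at `p` -/
  form : ∀ p : M, BTangent d Z p →ₗ[ℝ] BTangent d Z p →ₗ[ℝ] ℝ
  alternating : ∀ p v, form p v v = 0
  smooth : ∀ X Y : BVectorField d Z,
    ContMDiff (𝓡 d) 𝓘(ℝ, ℝ) ∞ (fun p => form p (bValue p X) (bValue p Y))
  closed : ∀ (X Y W : BVectorField d Z) (p : M),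
    lieDeriv X (fun q => form q (bValue q Y) (bValue q W)) p
      - lieDeriv Y (fun q => form q (bValue q X) (bValue q W)) p
      + lieDeriv W (fun q => form q (bValue q X) (bValue q Y)) p
      - form p (bValue p (bBracket X Y)) (bValue p W)
      + form p (bValue p (bBracket X W)) (bValue p Y)
      - form p (bValue p (bBracket Y W)) (bValue p X) = 0
  nondegenerate : ∀ p v, (∀ w, form p v w = 0) → v = 0

/-- The `b`-covector `η` is the differential `df` at `p` of the `b`-function `f`: for every
`b`-vector field `X`, the function `df(X)`, defined off `Z`, extends to `p` by the value
`η (X)`. -/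
def IsBDifferentialAt (f : M → OnePoint ℝ) (p : M) (η : BCotangent d Z p) : Prop :=
  ∀ X : BVectorField d Z,
    Filter.Tendsto (fun q => lieDeriv X (finitePart f) q) (𝓝[Zᶜ] p) (𝓝 (η (bValue p X)))

open Classical in
variable (d Z) in
/-- The differential at `p` of a `b`-function, as a `b`-covector. -/
def bDifferential (f : M → OnePoint ℝ) (p : M) : BCotangent d Z p :=
  if h : ∃ η : BCotangent d Z p, IsBDifferentialAt f p η then h.choose else 0

/-- `X` is the Hamiltonian vector field of `f`: `ι_X Ω = -df` as `b`-one-forms. -/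
def IsHamiltonianVectorField (Ω : BSymplecticForm d Z) (f : M → OnePoint ℝ)
    (X : BVectorField d Z) : Prop :=
  ∀ p, IsBDifferentialAt f p (-(Ω.form p (bValue p X)))

open Classical in
/-- The Hamiltonian vector field of a `b`-function. -/
def hamiltonianVF (Ω : BSymplecticForm d Z) (f : M → OnePoint ℝ) : BVectorField d Z :=
  if h : ∃ X, IsHamiltonianVectorField Ω f X then h.choose else 0

/-- The Poisson bracket `{f, g} = Π(df, dg) = dg(X_f)` of two `b`-functions. -/
def poissonBracket (Ω : BSymplecticForm d Z) (f g : M → OnePoint ℝ) (p : M) : ℝ :=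
  bDifferential d Z g p (bValue p (hamiltonianVF Ω f))

variable {s : ℕ}

variable (d Z) in
/-- The set `U_F` where the differentials of `f_1, …, f_s` are linearly independent as
`b`-covectors. -/
def independentSet (F : Fin s → M → OnePoint ℝ) : Set M :=
  {p | LinearIndependent ℝ (fun i => bDifferential d Z (F i) p)}

/-- The set `M_{F,r}` where the Hamiltonian vector fields of `f_1, …, f_r` are linearly independent
as (ordinary) tangent vectors. -/
def hamiltonianIndependentSet (Ω : BSymplecticForm d Z) (r : ℕ) (F : Fin s → M → OnePoint ℝ) :
    Set M :=
  {p | LinearIndependent ℝ (fun i : {i : Fin s // i.val < r} =>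
    ((hamiltonianVF Ω (F i)).1 p : TangentSpace (𝓡 d) p))}

/-- The set `U_F ∩ M_{F,r}` of regular points. -/
def regularSet (Ω : BSymplecticForm d Z) (r : ℕ) (F : Fin s → M → OnePoint ℝ) : Set M :=
  independentSet d Z F ∩ hamiltonianIndependentSet Ω r F

/-- `F = (f_1, …, f_s)` is a non-commutative `b`-integrable system of rank `r` on the
`b`-symplectic manifold `(M, Z, Ω)`. -/
structure IsIntegrableSystem (Ω : BSymplecticForm d Z) (r : ℕ) (F : Fin s → M → OnePoint ℝ) :
    Prop where
  rank_le : r ≤ s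
  bFunction : ∀ i, i.val < r → IsBFunction d Z (F i)
  smoothFun : ∀ i, r ≤ i.val → IsSmoothFun d (F i)
  independent : ∃ O : Set M, IsOpen O ∧ Dense O ∧ O ⊆ independentSet d Z F
  independent_on : ∃ O : Set M, IsOpen O ∧ Z ⊆ closure (O ∩ Z) ∧ O ∩ Z ⊆ independentSet d Z F
  involution : ∀ i j, i.val < r → ∀ p, poissonBracket Ω (F i) (F j) p = 0
  dim_eq : r + s = d
  hamiltonian_independent : ∃ p ∈ Z, p ∈ hamiltonianIndependentSet Ω r F

/-- The distribution spanned by the Hamiltonian vector fields of `f_1, …, f_r`. -/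
def distribution (Ω : BSymplecticForm d Z) (r : ℕ) (F : Fin s → M → OnePoint ℝ) (p : M) :
    Submodule ℝ (TangentSpace (𝓡 d) p) :=
  Submodule.span ℝ (Set.range (fun i : {i : Fin s // i.val < r} =>
    ((hamiltonianVF Ω (F i)).1 p : TangentSpace (𝓡 d) p)))

/-- `p` and `q` are joined by a `C¹` curve of regular points which is everywhere tangent to the
distribution spanned by the Hamiltonian vector fields of `f_1, …, f_r`. -/
def JoinedByTangentCurve (Ω : BSymplecticForm d Z) (r : ℕ) (F : Fin s → M → OnePoint ℝ)
    (p q : M) : Prop :=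
  ∃ γ : ℝ → M, ContMDiffOn 𝓘(ℝ, ℝ) (𝓡 d) 1 γ (Set.Icc 0 1) ∧ γ 0 = p ∧ γ 1 = q ∧
    ∀ τ ∈ Set.Icc (0 : ℝ) 1, γ τ ∈ regularSet Ω r F ∧
      mfderivWithin 𝓘(ℝ, ℝ) (𝓡 d) γ (Set.Icc 0 1) τ (1 : ℝ) ∈ distribution Ω r F (γ τ)

/-- The leaf (integral manifold) through `m` of the foliation of the regular set by the
distribution spanned by the Hamiltonian vector fields of `f_1, …, f_r`: the set of points which
are reached from `m` by piecewise `C¹` curves of regular points tangent to the distribution. -/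
def leaf (Ω : BSymplecticForm d Z) (r : ℕ) (F : Fin s → M → OnePoint ℝ) (m : M) : Set M :=
  {q | Relation.ReflTransGen (JoinedByTangentCurve Ω r F) m q}

variable (d Z) in
/-- `F` is of the form `(log |t|, f_2, …, f_s)` with `t` a defining function of `Z` and
`f_2, …, f_s` smooth. -/
def IsLogNormalForm (F : Fin s → M → OnePoint ℝ) : Prop :=
  ∃ t : M → ℝ, IsDefiningFunction d Z t ∧
    ∀ i, (i.val = 0 → ∀ p, F i p = logAbs (t p)) ∧ (i.val ≠ 0 → IsSmoothFun d (F i))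

/-- The linear isomorphism `A` of `ℝˢ` is an equivalence from `F` to `F'`: it takes `F` to `F'`,
i.e. `F' = A ∘ F` wherever `F` is finite, and it is Poisson for the Poisson structures induced on
the finite parts of the target spaces by the brackets `{f_i, f_j}` and `{f'_k, f'_l}`. -/
structure IsLinearEquivalence (Ω : BSymplecticForm d Z) (F F' : Fin s → M → OnePoint ℝ)
    (A : (Fin s → ℝ) ≃ₗ[ℝ] (Fin s → ℝ)) : Prop where
  map_eq : ∀ (p : M) (x : Fin s → ℝ), (∀ i, F i p = (x i : OnePoint ℝ)) →
    ∀ k, F' k p = (A x k : OnePoint ℝ)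
  poisson : ∀ p : M, (∀ i, F i p ≠ OnePoint.infty) → ∀ k l,
    poissonBracket Ω (F' k) (F' l) p =
      ∑ i, ∑ j, A (Pi.single i 1) k * A (Pi.single j 1) l * poissonBracket Ω (F i) (F j) p

end Geometry

/-- The torus `𝕋ʳ`. -/
abbrev Torus (r : ℕ) : Type := Fin r → Circle

/-- The model with corners of the manifold `𝕋ʳ × ℝˢ`. -/
abbrev torusModel (r s : ℕ) := (ModelWithCorners.pi (fun _ : Fin r => 𝓡 1)).prod (𝓡 s)

/-- The standard integrals `(log |π_1|, π_2, …, π_s)` at a point of `ℝˢ`. -/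
def standardIntegrals {s : ℕ} (x : E s) (i : Fin s) : OnePoint ℝ :=
  if i.val = 0 then logAbs (x i) else (x i : OnePoint ℝ)

end

end BSymp

open BSymp

/-! The proof has two independent halves.

Normal form. If all `F i` were smooth, then at `m` their ordinary differentials together with that
of a local defining function of `Z` would be `s + 1` independent covectors annihilating `r`
independent Hamiltonian vectors, which is impossible in dimension `r + s`. So some `F j` with `j <
r` is singular, and its smooth part can be absorbed into the defining function: `F j = c log|t|`.
Logarithms of two defining functions differ by a smooth function, hence every `F i` is `e i * log|t|
+ g i` with `g i` smooth. Dividing `F j` by `c`, subtracting multiples of it from the others and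
moving it to the front is a linear change (`IsElementaryChange`). It touches only the first `r`
functions and replaces their Hamiltonian fields by another basis of the same span, so regular points
and leaves stay the same. The change is Poisson because the first `r` functions are in involution
with all of them.

Tube. In normal form the ordinary functions `t, f_2, ..., f_s` form a smooth map `f` which is
constant along the Hamiltonian fields and a submersion on the regular set; at `Z` one uses `dt = t d
log|t|` and `dt ≠ 0`. The Hamiltonian fields commute: off `Z` this follows from `dΩ = 0`, and it
extends to `Z` by continuity. What remains is a statement without symplectic geometry,
`HasFlowBoxes.exists_trivialization`, on commuting independent fields `X_1, ..., X_r` tangent to the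
fibres of a submersion onto `ℝˢ`, with `r + s = d`.

For that statement, `exists_isFlowBox` gives charts `(u, f)` in which `X_i = ∂/∂u_i`. Transitions
between them are translations along the leaves, so short translations glue to a local action of
`ℝʳ`. A compact leaf is isolated in its level set, hence has a neighbourhood which curves in level
sets cannot leave (`exists_tube`), and there the local action extends to an action of `ℝʳ` whose
orbits are the leaves. Along a local section of `f` the period lattice of the compact orbit extends
to a smooth family of lattices (`exists_isPeriodFrame`); dividing by them yields `𝕋ʳ × ball`. No
angle variables conjugate to the integrals are needed, so the periods need not be Hamiltonian. -/

namespace BSymp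

/-! ### Integrals with parameters and the Poincaré lemma with parameters. -/

section Analysis

universe u

variable {X G : Type u} [NormedAddCommGroup X] [NormedSpace ℝ X] [FiniteDimensional ℝ X]
  [NormedAddCommGroup G] [NormedSpace ℝ G]

/-- Differentiation under the integral sign: the partial derivative is bounded on the compact set
`[0,1] × closedBall x 1`, which supplies a constant dominating function. -/
lemma hasFDerivAt_integral_of_contDiff {F : ℝ × X → G} (hF : ContDiff ℝ 1 F) (x : X) :
    HasFDerivAt (fun y => ∫ τ in (0 : ℝ)..1, F (τ, y))
      (∫ τ in (0 : ℝ)..1, (fderiv ℝ F (τ, x)).comp (ContinuousLinearMap.inr ℝ ℝ X)) x := by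
  have hc : Continuous fun p : ℝ × X =>
      (fderiv ℝ F p).comp (ContinuousLinearMap.inr ℝ ℝ X) :=
    (hF.continuous_fderiv (by simp)).clm_comp continuous_const
  have : ProperSpace X := FiniteDimensional.proper ℝ X
  obtain ⟨K, hK⟩ := ((isCompact_Icc (a := (0 : ℝ)) (b := 1)).prod
    (isCompact_closedBall x 1)).exists_bound_of_continuousOn hc.continuousOn
  refine intervalIntegral.hasFDerivAt_integral_of_dominated_of_fderiv_le
    (F := fun y τ => F (τ, y)) (bound := fun _ => K)
    (F' := fun y τ => (fderiv ℝ F (τ, y)).comp (ContinuousLinearMap.inr ℝ ℝ X))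
    (Metric.ball_mem_nhds x one_pos) ?_ ?_ ?_ ?_ ?_ ?_
  · refine Filter.Eventually.of_forall fun y => ?_
    exact (hF.continuous.comp (Continuous.prodMk_left y)).aestronglyMeasurable
  · exact (hF.continuous.comp (Continuous.prodMk_left x)).intervalIntegrable _ _
  · exact (hc.comp (Continuous.prodMk_left x)).aestronglyMeasurable
  · refine Filter.Eventually.of_forall fun τ hτ y hy => ?_
    rw [Set.uIoc_of_le zero_le_one] at hτ
    exact hK (τ, y) ⟨⟨hτ.1.le, hτ.2⟩, Metric.ball_subset_closedBall hy⟩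
  · exact intervalIntegrable_const
  · refine Filter.Eventually.of_forall fun τ _ y _ => ?_
    have h1 : HasFDerivAt F (fderiv ℝ F (τ, y)) (τ, y) :=
      (hF.differentiable (by simp) _).hasFDerivAt
    exact h1.comp y (hasFDerivAt_prodMk_right τ y)

omit [FiniteDimensional ℝ X] in
lemma contDiff_fderiv_comp_inr {F : ℝ × X → G} {m n : WithTop ℕ∞} (hF : ContDiff ℝ n F)
    (h : m + 1 ≤ n) :
    ContDiff ℝ m fun p : ℝ × X => (fderiv ℝ F p).comp (ContinuousLinearMap.inr ℝ ℝ X) :=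
  (hF.fderiv_right h).clm_comp contDiff_const

/-- Induction on `m`: the derivative of such an integral is again one, now with values in `X →L[ℝ]
G`. Hence `G` varies in the induction, and `X` and `G` share a universe. -/
lemma contDiff_integral (m : ℕ) : ∀ {G : Type u} [NormedAddCommGroup G] [NormedSpace ℝ G]
    {F : ℝ × X → G}, ContDiff ℝ m F → ContDiff ℝ m fun y => ∫ τ in (0 : ℝ)..1, F (τ, y) := by
  induction m with
  | zero =>
    intro G _ _ F hF
    rw [Nat.cast_zero, contDiff_zero] at hF ⊢
    exact intervalIntegral.continuous_parametric_intervalIntegral_of_continuous' 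
      (f := fun y τ => F (τ, y)) (by exact hF.comp continuous_swap) 0 1
  | succ m ih =>
    intro G _ _ F hF
    rw [Nat.cast_add, Nat.cast_one, contDiff_succ_iff_hasFDerivAt]
    refine ⟨_, ih (contDiff_fderiv_comp_inr hF le_rfl), fun x => ?_⟩
    exact hasFDerivAt_integral_of_contDiff (hF.of_le (by simp)) x

lemma contDiff_infty_integral {F : ℝ × X → G} (hF : ContDiff ℝ ∞ F) :
    ContDiff ℝ ∞ fun y => ∫ τ in (0 : ℝ)..1, F (τ, y) :=
  contDiff_infty.2 fun m => contDiff_integral m (hF.of_le (by exact_mod_cast le_top))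

/-- A function which is smooth near a point agrees near that point with a smooth function. -/
lemma exists_contDiff_eventuallyEq {f : X → G} {U : Set X} {x : X} (hU : IsOpen U) (hx : x ∈ U)
    (hf : ContDiffOn ℝ ∞ f U) : ∃ g : X → G, ContDiff ℝ ∞ g ∧ g =ᶠ[𝓝 x] f := by
  obtain ⟨ρ, hρ, hρU⟩ := Metric.isOpen_iff.1 hU x hx
  let χ : ContDiffBump x := ⟨ρ / 4, ρ / 2, by positivity, by linarith⟩
  refine ⟨fun y => χ y • f y, ?_, ?_⟩
  · rw [contDiff_iff_contDiffAt]
    intro y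
    by_cases hy : y ∈ U
    · exact (χ.contDiff.contDiffAt).smul (hf.contDiffAt (hU.mem_nhds hy))
    · have : (fun y => χ y • f y) =ᶠ[𝓝 y] fun _ => 0 := by
        have hy' : y ∈ (Metric.closedBall x (ρ / 2))ᶜ := fun h =>
          hy (hρU (Metric.closedBall_subset_ball (by linarith) h))
        filter_upwards [Metric.isClosed_closedBall.isOpen_compl.mem_nhds hy'] with z hz
        have : χ z = 0 := χ.zero_of_le_dist
            (le_of_lt (by simpa using hz : ρ / 2 < dist z x))
        simp [this]
      exact contDiffAt_const.congr_of_eventuallyEq this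
  · filter_upwards [χ.eventuallyEq_one] with y hy
    simp [hy]

/-- The Poincaré lemma with parameters, in a neighbourhood of a point. -/
lemma exists_partial_primitive {P : Type u} [NormedAddCommGroup P] [NormedSpace ℝ P]
    [FiniteDimensional ℝ P] [CompleteSpace G] {θ : X × P → X →L[ℝ] G} {U : Set (X × P)}
    {z : X × P} (hU : IsOpen U) (hz : z ∈ U) (hθ : ContDiffOn ℝ ∞ θ U)
    (hsymm : ∀ y ∈ U, ∀ ξ η : X, fderiv ℝ θ y (ξ, 0) η = fderiv ℝ θ y (η, 0) ξ) :
    ∃ u : X × P → G, ContDiff ℝ ∞ u ∧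
      ∀ᶠ y in 𝓝 z, ∀ ξ : X, fderiv ℝ u y (ξ, 0) = θ y ξ := by
  -- A globally smooth `θ'` makes the integral below smooth everywhere.
  obtain ⟨θ', hθ', hEq⟩ := exists_contDiff_eventuallyEq hU hz hθ
  have hsymm' : ∀ᶠ y in 𝓝 z, ∀ ξ η : X, fderiv ℝ θ' y (ξ, 0) η = fderiv ℝ θ' y (η, 0) ξ := by
    filter_upwards [hEq.eventuallyEq_nhds, hU.mem_nhds hz] with y hy hyU ξ η
    rw [hy.fderiv_eq]
    exact hsymm y hyU ξ η
  obtain ⟨ρ, hρ, hball⟩ := Metric.eventually_nhds_iff_ball.1 (hsymm'.and hEq)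
  let c : ℝ × (X × P) → X × P := fun p => (z.1 + p.1 • (p.2.1 - z.1), p.2.2)
  have hc : ContDiff ℝ ∞ c := by unfold c; fun_prop
  -- The radial primitive from `z.1` in the `X`-directions, with the parameter held fixed.
  let F : ℝ × (X × P) → G := fun p => θ' (c p) (p.2.1 - z.1)
  have hF : ContDiff ℝ ∞ F := (hθ'.comp hc).clm_apply (by fun_prop)
  refine ⟨_, contDiff_infty_integral hF, ?_⟩
  filter_upwards [Metric.ball_mem_nhds z hρ] with y hy ξ
  have hcy : ∀ τ ∈ Set.Icc (0 : ℝ) 1, c (τ, y) ∈ Metric.ball z ρ := by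
    intro τ hτ
    rw [Metric.mem_ball, Prod.dist_eq, max_lt_iff] at hy ⊢
    refine ⟨?_, hy.2⟩
    rw [dist_eq_norm] at hy ⊢
    calc ‖(c (τ, y)).1 - z.1‖ = ‖τ • (y.1 - z.1)‖ := by simp [c]
      _ ≤ ‖y.1 - z.1‖ := by
        rw [norm_smul, Real.norm_eq_abs, abs_of_nonneg hτ.1]
        exact mul_le_of_le_one_left (norm_nonneg _) hτ.2
      _ < ρ := hy.1
  have hθd : ∀ w, HasFDerivAt θ' (fderiv ℝ θ' w) w := fun w =>
    (hθ'.differentiable (by simp) w).hasFDerivAt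
  have hcont : Continuous fun τ : ℝ => (fderiv ℝ F (τ, y)).comp
      (ContinuousLinearMap.inr ℝ ℝ (X × P)) :=
    (contDiff_fderiv_comp_inr (m := ∞) hF (by simp)).continuous.comp
      (Continuous.prodMk_left y)
  rw [(hasFDerivAt_integral_of_contDiff (hF.of_le (by exact_mod_cast le_top)) y).fderiv,
    ContinuousLinearMap.intervalIntegral_apply (hcont.intervalIntegrable _ _)]
  -- Closedness turns the `ξ`-derivative of the integrand into the `τ`-derivative of `τ • θ' (c (τ,
  -- y)) ξ`, so its integral is `θ' y ξ`.
  have key : ∀ τ ∈ Set.uIcc (0 : ℝ) 1, HasDerivAt (fun τ => τ • θ' (c (τ, y)) ξ)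
      (((fderiv ℝ F (τ, y)).comp (ContinuousLinearMap.inr ℝ ℝ (X × P))) (ξ, 0)) τ := by
    intro τ hτ
    rw [Set.uIcc_of_le zero_le_one] at hτ
    have hsy := (hball _ (hcy τ hτ)).1
    have hcd : HasFDerivAt c (fderiv ℝ c (τ, y)) (τ, y) :=
      (hc.differentiable (by simp) _).hasFDerivAt
    have hinl : fderiv ℝ c (τ, y) (1, 0) = (y.1 - z.1, 0) := by
      have h1 : HasDerivAt (fun σ : ℝ => c (σ, y)) (fderiv ℝ c (τ, y) (1, 0)) τ :=
        hcd.comp_hasDerivAt τ ((hasDerivAt_id τ).prodMk (hasDerivAt_const τ y))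
      have h2 : HasDerivAt (fun σ : ℝ => c (σ, y)) (y.1 - z.1, 0) τ := by
        refine HasDerivAt.prodMk ?_ (hasDerivAt_const τ y.2)
        simpa using ((hasDerivAt_id τ).smul_const (y.1 - z.1)).const_add z.1
      exact h1.unique h2
    have hinr : fderiv ℝ c (τ, y) (0, (ξ, 0)) = (τ • ξ, 0) := by
      have h1 : HasDerivAt (fun σ : ℝ => c (τ, y + σ • ((ξ, 0) : X × P)))
          (fderiv ℝ c (τ, y) (0, (ξ, 0))) 0 := by
        have h3 : HasDerivAt (fun σ : ℝ => (τ, y + σ • ((ξ, 0) : X × P))) (0, (ξ, 0)) 0 := by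
          refine (hasDerivAt_const _ τ).prodMk ?_
          simpa using ((hasDerivAt_id (0 : ℝ)).smul_const ((ξ, 0) : X × P)).const_add y
        have hcd' : HasFDerivAt c (fderiv ℝ c (τ, y)) (τ, y + (0 : ℝ) • ((ξ, 0) : X × P)) := by
          simpa using hcd
        exact hcd'.comp_hasDerivAt 0 h3
      have h2 : HasDerivAt (fun σ : ℝ => c (τ, y + σ • ((ξ, 0) : X × P))) (τ • ξ, 0) 0 := by
        have : (fun σ : ℝ => c (τ, y + σ • ((ξ, 0) : X × P))) =
            fun σ => (z.1 + τ • (y.1 - z.1) + σ • (τ • ξ), y.2) := by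
          funext σ
          refine Prod.ext ?_ ?_
          · change z.1 + τ • (y.1 + σ • ξ - z.1) = z.1 + τ • (y.1 - z.1) + σ • τ • ξ
            module
          · change y.2 + σ • (0 : P) = y.2
            simp
        rw [this]
        refine HasDerivAt.prodMk ?_ (hasDerivAt_const _ y.2)
        simpa using ((hasDerivAt_id (0 : ℝ)).smul_const (τ • ξ)).const_add
          (z.1 + τ • (y.1 - z.1))
      exact h1.unique h2
    have hFd : fderiv ℝ F (τ, y) (0, (ξ, 0)) =
        τ • fderiv ℝ θ' (c (τ, y)) (ξ, 0) (y.1 - z.1) + θ' (c (τ, y)) ξ := by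
      have h1 : HasFDerivAt F _ (τ, y) := HasFDerivAt.clm_apply
        ((hθd (c (τ, y))).comp (τ, y) hcd)
        (((hasFDerivAt_snd (𝕜 := ℝ) (E := ℝ) (F := X × P) (p := (τ, y))).fst).sub_const z.1)
      have h2 : fderiv ℝ θ' (c (τ, y)) (τ • ξ, 0) = τ • fderiv ℝ θ' (c (τ, y)) (ξ, 0) := by
        rw [← map_smul, Prod.smul_mk, smul_zero]
      rw [h1.fderiv]
      change θ' (c (τ, y)) ξ + fderiv ℝ θ' (c (τ, y)) (fderiv ℝ c (τ, y) (0, (ξ, 0)))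
        (y.1 - z.1) = _
      rw [hinr, h2, add_comm]
      rfl
    have hd : HasDerivAt (fun σ : ℝ => θ' (c (σ, y)))
        (fderiv ℝ θ' (c (τ, y)) (y.1 - z.1, 0)) τ := by
      have h1 : HasDerivAt (fun σ : ℝ => c (σ, y)) (y.1 - z.1, 0) τ := by
        rw [← hinl]
        exact hcd.comp_hasDerivAt τ ((hasDerivAt_id τ).prodMk (hasDerivAt_const τ y))
      exact (hθd (c (τ, y))).comp_hasDerivAt τ h1
    have hd2 : HasDerivAt (fun σ : ℝ => θ' (c (σ, y)) ξ)
        (fderiv ℝ θ' (c (τ, y)) (y.1 - z.1, 0) ξ) τ := by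
      simpa using hd.clm_apply (hasDerivAt_const τ ξ)
    have hd3 := (hasDerivAt_id τ).smul hd2
    simp only [id_eq, one_smul] at hd3
    rw [ContinuousLinearMap.comp_apply, ContinuousLinearMap.inr_apply, hFd, hsy]
    exact hd3
  rw [intervalIntegral.integral_eq_sub_of_hasDerivAt key
    ((hcont.clm_apply continuous_const).intervalIntegrable _ _)]
  have : c (1, y) = y := by simp [c]
  simp only [this, one_smul, zero_smul, sub_zero]
  rw [(hball y hy).2]

end Analysis

/-! ### The inverse function theorem and Hadamard's lemma. -/

section Analysis

variable {X Y : Type} [NormedAddCommGroup X] [NormedSpace ℝ X] [FiniteDimensional ℝ X]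
  [NormedAddCommGroup Y] [NormedSpace ℝ Y] [FiniteDimensional ℝ Y]

/-- The inverse function theorem, giving a chart which is smooth in both directions. -/
lemma exists_chart_of_injective {g : X → Y} {U : Set X} {x : X} (hU : IsOpen U) (hx : x ∈ U)
    (hg : ContDiffOn ℝ ∞ g U) (hinj : Function.Injective (fderiv ℝ g x))
    (hdim : Module.finrank ℝ X = Module.finrank ℝ Y) :
    ∃ χ : OpenPartialHomeomorph X Y, x ∈ χ.source ∧ χ.source ⊆ U ∧ ⇑χ = g ∧
      ContDiffOn ℝ ∞ χ χ.source ∧ ContDiffOn ℝ ∞ χ.symm χ.target := by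
  have : CompleteSpace X := FiniteDimensional.complete ℝ X
  let e : X ≃L[ℝ] Y := (LinearEquiv.ofInjectiveOfFinrankEq
    (fderiv ℝ g x : X →ₗ[ℝ] Y) hinj hdim).toContinuousLinearEquiv
  have he : (e : X →L[ℝ] Y) = fderiv ℝ g x := by ext; rfl
  have hgx : ContDiffAt ℝ ∞ g x := hg.contDiffAt (hU.mem_nhds hx)
  have hd : HasFDerivAt g (e : X →L[ℝ] Y) x := by
    rw [he]
    exact (hgx.differentiableAt (by simp)).hasFDerivAt
  -- Restricting to points with invertible derivative makes the inverse smooth on the whole target,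
  -- not only at the image of `x`.
  let V : Set X := U ∩ fderiv ℝ g ⁻¹' Set.range ((↑) : (X ≃L[ℝ] Y) → X →L[ℝ] Y)
  have hV : IsOpen V := (hg.continuousOn_fderiv_of_isOpen hU (by simp)).isOpen_inter_preimage hU
    ContinuousLinearEquiv.isOpen
  have hxV : x ∈ V := ⟨hx, e, he⟩
  let χ₀ := hgx.toOpenPartialHomeomorph g hd (by simp)
  have hχs : (χ₀.restrOpen V hV).source = χ₀.source ∩ V := rfl
  refine ⟨χ₀.restrOpen V hV, ⟨hgx.mem_toOpenPartialHomeomorph_source hd _, hxV⟩, ?_, rfl, ?_, ?_⟩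
  · rw [hχs]
    exact fun y hy => hy.2.1
  · rw [hχs]
    exact hg.mono fun y hy => hy.2.1
  · intro y hy
    refine ContDiffAt.contDiffWithinAt ?_
    have hs := (χ₀.restrOpen V hV).map_target hy
    rw [hχs] at hs
    obtain ⟨-, hyU, e', he'⟩ := hs
    have hat : ContDiffAt ℝ ∞ g ((χ₀.restrOpen V hV).symm y) := hg.contDiffAt (hU.mem_nhds hyU)
    refine (χ₀.restrOpen V hV).contDiffAt_symm (f₀' := e') hy ?_ hat
    rw [he']
    exact (hat.differentiableAt (by simp)).hasFDerivAt

/-- Hadamard's lemma: a smooth function which vanishes on the zero set of `h` is divisible by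
`h` near a regular zero of `h`. -/
lemma exists_eq_mul_of_vanishing {h a : X → ℝ} {U : Set X} {x : X} (hU : IsOpen U) (hx : x ∈ U)
    (hh : ContDiffOn ℝ ∞ h U) (ha : ContDiffOn ℝ ∞ a U) (h0 : h x = 0)
    (hd : fderiv ℝ h x ≠ 0) (hv : ∀ y ∈ U, h y = 0 → a y = 0) :
    ∃ (u : X → ℝ) (V : Set X), IsOpen V ∧ x ∈ V ∧ ContDiffOn ℝ ∞ u V ∧
      ∀ y ∈ V, a y = u y * h y := by
  set l := fderiv ℝ h x with hl
  obtain ⟨v, hv1⟩ : ∃ v, l v = 1 := by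
    obtain ⟨w, hw⟩ : ∃ w, l w ≠ 0 := by
      by_contra! H
      exact hd (ContinuousLinearMap.ext H)
    exact ⟨(l w)⁻¹ • w, by simp [hw]⟩
  -- This `g` satisfies `l ∘ g = h` and has the identity as derivative at `x`; in the chart it
  -- defines, `h` becomes the linear form `l`.
  let g : X → X := fun y => y + (h y - l y) • v
  have hg : ContDiffOn ℝ ∞ g U :=
    contDiffOn_id.add ((hh.sub l.contDiff.contDiffOn).smul contDiffOn_const)
  have hgd : HasFDerivAt g (ContinuousLinearMap.id ℝ X) x := by
    have h1 : HasFDerivAt h l x := ((hh.contDiffAt (hU.mem_nhds hx)).differentiableAt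
      (by simp)).hasFDerivAt
    have h2 := (hasFDerivAt_id x).add ((h1.sub l.hasFDerivAt).smul_const v)
    simp only [sub_self, ContinuousLinearMap.zero_smulRight,
      add_zero] at h2
    exact h2
  obtain ⟨χ, hxs, hsU, hχg, hs1, hs2⟩ := exists_chart_of_injective hU hx hg
    (by rw [hgd.fderiv]; exact Function.injective_id) rfl
  have hlg : ∀ y, l (g y) = h y := by
    intro y
    simp [g, hv1]
  have hlχ : ∀ w ∈ χ.target, h (χ.symm w) = l w := by
    intro w hw
    rw [← hlg, ← hχg, χ.right_inv hw]
  obtain ⟨a', ha', haeq⟩ := exists_contDiff_eventuallyEq χ.open_target (χ.map_source hxs)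
    (ha.comp hs2 fun w hw => hsU (χ.map_target hw))
  -- The mean of the `v`-derivative of `a'` over the segment from `w - l w • v`, which lies on the
  -- hyperplane `l = 0`, to `w`.
  let u' : X → ℝ := fun w => ∫ τ in (0 : ℝ)..1, fderiv ℝ a' (w - (1 - τ) • l w • v) v
  have hu' : ContDiff ℝ ∞ u' := by
    refine contDiff_infty_integral
      (F := fun p : ℝ × X => fderiv ℝ a' (p.2 - (1 - p.1) • l p.2 • v) v) ?_
    refine ContDiff.clm_apply ((ha'.fderiv_right (m := ∞) (by simp)).comp ?_) contDiff_const
    fun_prop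
  have hkey : ∀ w, a' w - a' (w - l w • v) = u' w * l w := by
    intro w
    have hder : ∀ τ ∈ Set.uIcc (0 : ℝ) 1, HasDerivAt (fun τ => a' (w - (1 - τ) • l w • v))
        (fderiv ℝ a' (w - (1 - τ) • l w • v) (l w • v)) τ := by
      intro τ _
      have h1 : HasDerivAt (fun τ : ℝ => w - (1 - τ) • l w • v) (l w • v) τ := by
        have := (((hasDerivAt_id τ).const_sub 1).smul_const (l w • v)).const_sub w
        simpa using this
      exact ((ha'.differentiable (by simp) _).hasFDerivAt).comp_hasDerivAt τ h1
    have hc : Continuous fun τ : ℝ => fderiv ℝ a' (w - (1 - τ) • l w • v) (l w • v) :=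
      ((ha'.continuous_fderiv (by simp)).comp (by fun_prop)).clm_apply continuous_const
    have := intervalIntegral.integral_eq_sub_of_hasDerivAt hder (hc.intervalIntegrable _ _)
    simp only [sub_self, zero_smul, sub_zero, one_smul] at this
    rw [← this]
    simp only [map_smul, smul_eq_mul, u']
    rw [intervalIntegral.integral_const_mul, mul_comm]
  have hw0 : l (χ x) = 0 := by rw [hχg, hlg, h0]
  have hev : ∀ᶠ w in 𝓝 (χ x), a (χ.symm w) = u' w * h (χ.symm w) := by
    have hlim : Filter.Tendsto (fun w => w - l w • v) (𝓝 (χ x)) (𝓝 (χ x)) := by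
      have : Continuous fun w => w - l w • v := by fun_prop
      simpa [hw0] using this.tendsto (χ x)
    filter_upwards [haeq, hlim.eventually haeq, χ.open_target.mem_nhds (χ.map_source hxs),
      hlim.eventually (χ.open_target.mem_nhds (χ.map_source hxs))] with w h1 h2 h3 h4
    have h5 : a' (w - l w • v) = 0 := by
      rw [h2]
      exact hv _ (hsU (χ.map_target h4)) (by rw [hlχ _ h4]; simp [hv1])
    have := hkey w
    rw [h5, sub_zero, h1] at this
    rw [hlχ w h3, ← this]
    rfl
  have hev2 : ∀ᶠ y in 𝓝 x, a y = u' (χ y) * h y := by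
    filter_upwards [(χ.continuousAt hxs).eventually hev, χ.open_source.mem_nhds hxs] with y h1 h2
    rwa [χ.left_inv h2] at h1
  obtain ⟨V, hVs, hVo, hxV⟩ := mem_nhds_iff.1 (hev2.and (χ.open_source.mem_nhds hxs))
  exact ⟨fun y => u' (χ y), V, hVo, hxV,
    hu'.comp_contDiffOn (hs1.mono fun y hy => (hVs hy).2), fun y hy => (hVs hy).1⟩

end Analysis

/-! ### Straightening a commuting frame. -/

section Straightening

variable {r s : ℕ}

/-- The linear map which takes the standard basis of `ℝʳ` to `v`. -/
noncomputable def frameMap (v : Fin r → E r) : E r →L[ℝ] E r :=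
  ∑ i, (EuclideanSpace.proj i : E r →L[ℝ] ℝ).smulRight (v i)

lemma frameMap_apply (v : Fin r → E r) (x : E r) : frameMap v x = ∑ i, x i • v i := by
  simp [frameMap]

lemma frameMap_single (v : Fin r → E r) (i : Fin r) :
    frameMap v (EuclideanSpace.single i 1) = v i := by
  simp [frameMap_apply]

lemma contDiff_frameMap : ContDiff ℝ ∞ (frameMap : (Fin r → E r) → E r →L[ℝ] E r) := by
  have : (frameMap : (Fin r → E r) → E r →L[ℝ] E r) = fun v => ∑ i,
      ContinuousLinearMap.smulRightL ℝ (E r) (E r) (EuclideanSpace.proj i) (v i) := rfl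
  rw [this]
  refine ContDiff.sum fun i _ => ?_
  exact (ContinuousLinearMap.contDiff _).comp (contDiff_apply ℝ (E r) i)

/-- Simultaneous straightening of a commuting frame, depending on parameters. -/
lemma exists_straightening {a : Fin r → E r × E s → E r} {U : Set (E r × E s)} {z : E r × E s}
    (hU : IsOpen U) (hz : z ∈ U) (ha : ∀ i, ContDiffOn ℝ ∞ (a i) U)
    (hli : LinearIndependent ℝ fun i => a i z)
    (hcomm : ∀ y ∈ U, ∀ i j, fderiv ℝ (a j) y (a i y, 0) = fderiv ℝ (a i) y (a j y, 0)) :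
    ∃ β : OpenPartialHomeomorph (E r × E s) (E r × E s), z ∈ β.source ∧ β.source ⊆ U ∧
      ContDiffOn ℝ ∞ β β.source ∧ ContDiffOn ℝ ∞ β.symm β.target ∧
      (∀ y ∈ β.source, (β y).2 = y.2) ∧
      ∀ y ∈ β.source, ∀ i, fderiv ℝ β y (a i y, 0) = (EuclideanSpace.single i 1, 0) := by
  let A : E r × E s → E r →L[ℝ] E r := fun y => frameMap fun i => a i y
  have hA : ContDiffOn ℝ ∞ A U := contDiff_frameMap.comp_contDiffOn (contDiffOn_pi.2 ha)
  let V : Set (E r × E s) := U ∩ A ⁻¹' Set.range ((↑) : (E r ≃L[ℝ] E r) → E r →L[ℝ] E r)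
  have hV : IsOpen V := hA.continuousOn.isOpen_inter_preimage hU ContinuousLinearEquiv.isOpen
  have hzV : z ∈ V := by
    refine ⟨hz, ?_⟩
    have hinj : Function.Injective (A z : E r →ₗ[ℝ] E r) := by
      rw [injective_iff_map_eq_zero]
      intro x hx
      have hx' : ∑ i, x i • a i z = 0 := by rw [← frameMap_apply]; exact hx
      have := Fintype.linearIndependent_iff.1 hli _ hx'
      ext i
      exact this i
    exact ⟨(LinearEquiv.ofInjectiveEndo _ hinj).toContinuousLinearEquiv, by ext; rfl⟩
  -- The dual coframe of the `a i`. A primitive of it in the `E r`-directions gives the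
  -- straightening coordinates.
  let θ : E r × E s → E r →L[ℝ] E r := fun y => (A y).inverse
  have hθ : ContDiffOn ℝ ∞ θ V := by
    intro y hy
    obtain ⟨hyU, e, he⟩ := hy
    have h1 : ContDiffAt ℝ ∞ ContinuousLinearMap.inverse (A y) := by
      rw [← he]; exact contDiffAt_map_inverse e
    exact (h1.comp y (hA.contDiffAt (hU.mem_nhds hyU))).contDiffWithinAt
  have hθa : ∀ y ∈ V, ∀ i, θ y (a i y) = EuclideanSpace.single i 1 := by
    intro y hy i
    obtain ⟨hyU, e, he⟩ := hy
    have h1 : e (EuclideanSpace.single i 1) = a i y := by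
      rw [← frameMap_single (fun i => a i y) i]
      exact congrArg (fun L : E r →L[ℝ] E r => L (EuclideanSpace.single i 1)) he
    have h2 : θ y = (e.symm : E r →L[ℝ] E r) := by
      simp only [θ]
      rw [← he, ContinuousLinearMap.inverse_equiv]
    rw [h2, ← h1]
    simp
  -- Differentiating the constant `θ (a j)` gives `dθ(v)(a j) = -θ (d(a j) v)`. Hence `hcomm` is
  -- closedness of `θ` on pairs of frame vectors, and these span.
  have hsymm : ∀ y ∈ V, ∀ ξ η : E r, fderiv ℝ θ y (ξ, 0) η = fderiv ℝ θ y (η, 0) ξ := by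
    intro y hy
    have hθy := ((hθ.contDiffAt (hV.mem_nhds hy)).differentiableAt (by simp)).hasFDerivAt
    have hay : ∀ j, HasFDerivAt (a j) (fderiv ℝ (a j) y) y := fun j =>
      (((ha j).contDiffAt (hU.mem_nhds hy.1)).differentiableAt (by simp)).hasFDerivAt
    have h1 : ∀ j v, fderiv ℝ θ y v (a j y) = - θ y (fderiv ℝ (a j) y v) := by
      intro j v
      have h2 := hθy.clm_apply (hay j)
      have h3 : (fun x => θ x (a j x)) =ᶠ[𝓝 y] fun _ => EuclideanSpace.single j 1 := by
        filter_upwards [hV.mem_nhds hy] with x hx using hθa x hx j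
      have h4 := (h2.congr_of_eventuallyEq h3.symm).unique (hasFDerivAt_const _ y)
      have h5 := congrArg (fun L : (E r × E s) →L[ℝ] E r => L v) h4
      simp only [_root_.add_apply, ContinuousLinearMap.comp_apply,
        ContinuousLinearMap.flip_apply, _root_.zero_apply] at h5
      exact eq_neg_of_add_eq_zero_right h5
    obtain ⟨-, e, he⟩ := id hy
    have hexp : ∀ ξ : E r, ξ = ∑ i, (e.symm ξ) i • a i y := by
      intro ξ
      rw [← frameMap_apply (fun i => a i y)]
      change ξ = A y (e.symm ξ)
      rw [← he]
      simp
    let L : E r →ₗ[ℝ] E r →ₗ[ℝ] E r :=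
      LinearMap.mk₂ ℝ (fun ξ η => fderiv ℝ θ y (ξ, 0) η)
        (fun ξ ξ' η => by
          rw [show ((ξ + ξ', 0) : E r × E s) = (ξ, 0) + (ξ', 0) by simp, map_add]; rfl)
        (fun c ξ η => by
          rw [show ((c • ξ, 0) : E r × E s) = c • (ξ, 0) by simp, map_smul]; rfl)
        (fun ξ η η' => map_add _ _ _) (fun c ξ η => map_smul _ _ _)
    have hL : ∀ i j, L (a i y) (a j y) = L (a j y) (a i y) := by
      intro i j
      change fderiv ℝ θ y (a i y, 0) (a j y) = fderiv ℝ θ y (a j y, 0) (a i y)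
      rw [h1, h1, hcomm y hy.1]
    intro ξ η
    change L ξ η = L η ξ
    rw [hexp ξ, hexp η]
    simp only [map_sum, map_smul, LinearMap.sum_apply, LinearMap.smul_apply]
    simp only [Finset.smul_sum]
    rw [Finset.sum_comm]
    refine Finset.sum_congr rfl fun i _ => Finset.sum_congr rfl fun j _ => ?_
    rw [hL, smul_comm]
  obtain ⟨u, hu, hud⟩ := exists_partial_primitive hV hzV hθ hsymm
  obtain ⟨W, hWs, hWo, hzW⟩ := mem_nhds_iff.1 (hud.and (hV.mem_nhds hzV))
  let g : E r × E s → E r × E s := fun y => (u y, y.2)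
  have hg : ContDiff ℝ ∞ g := hu.prodMk contDiff_snd
  have hgd : ∀ y, fderiv ℝ g y = (fderiv ℝ u y).prod (ContinuousLinearMap.snd ℝ (E r) (E s)) :=
    fun y => ((hu.differentiable (by simp) y).hasFDerivAt.prodMk hasFDerivAt_snd).fderiv
  have hinj : Function.Injective (fderiv ℝ g z) := by
    rw [injective_iff_map_eq_zero]
    rintro ⟨ξ, η⟩ h
    rw [hgd] at h
    have h2 : η = 0 := congrArg Prod.snd h
    subst h2
    have h1 : fderiv ℝ u z (ξ, 0) = 0 := congrArg Prod.fst h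
    rw [(hWs hzW).1] at h1
    obtain ⟨-, e, he⟩ := hzV
    have h3 : θ z ξ = e.symm ξ := by
      simp only [θ]
      rw [← he, ContinuousLinearMap.inverse_equiv]
      rfl
    rw [h3] at h1
    have : ξ = 0 := by simpa using h1
    simp [this]
  obtain ⟨β, hzβ, hβW, hβg, hs1, hs2⟩ := exists_chart_of_injective hWo hzW hg.contDiffOn hinj rfl
  refine ⟨β, hzβ, fun y hy => (hWs (hβW hy)).2.1, hs1, hs2, fun y _ => by rw [hβg], ?_⟩
  intro y hy i
  rw [hβg, hgd]
  refine Prod.ext ?_ rfl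
  change fderiv ℝ u y (a i y, 0) = EuclideanSpace.single i 1
  rw [(hWs (hβW hy)).1, hθa y (hWs (hβW hy)).2]

end Straightening

/-! ### Vector fields and Lie brackets in charts. -/

section Chart

open VectorField

variable {d : ℕ} {M : Type*} [TopologicalSpace M] [ChartedSpace (E d) M]
  {V : Type} [NormedAddCommGroup V] [NormedSpace ℝ V]

variable (d) in
/-- A chart with values in a normed space which is smooth in both directions. -/
structure IsSmoothChart (χ : OpenPartialHomeomorph M V) : Prop where
  smooth : ContMDiffOn (𝓡 d) 𝓘(ℝ, V) ∞ χ χ.source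
  smooth_symm : ContMDiffOn 𝓘(ℝ, V) (𝓡 d) ∞ χ.symm χ.target

lemma isSmoothChart_chartAt [IsManifold (𝓡 d) ∞ M] (p : M) :
    IsSmoothChart d (V := E d) (chartAt (E d) p) :=
  ⟨contMDiffOn_chart, contMDiffOn_chart_symm⟩

namespace IsSmoothChart

variable {χ : OpenPartialHomeomorph M V}

lemma trans (h : IsSmoothChart d χ) {W : Type} [NormedAddCommGroup W] [NormedSpace ℝ W]
    {β : OpenPartialHomeomorph V W} (h1 : ContDiffOn ℝ ∞ β β.source)
    (h2 : ContDiffOn ℝ ∞ β.symm β.target) : IsSmoothChart d (χ.trans β) where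
  smooth := by
    refine (contMDiffOn_iff_contDiffOn.2 h1).comp (h.smooth.mono ?_) ?_
    · rw [OpenPartialHomeomorph.trans_source]; exact Set.inter_subset_left
    · rw [OpenPartialHomeomorph.trans_source]; exact fun q hq => hq.2
  smooth_symm := by
    refine h.smooth_symm.comp ((contMDiffOn_iff_contDiffOn.2 h2).mono ?_) ?_
    · rw [OpenPartialHomeomorph.trans_target]; exact Set.inter_subset_left
    · rw [OpenPartialHomeomorph.trans_target]; exact fun q hq => hq.2

lemma contMDiffAt (h : IsSmoothChart d χ) {q : M} (hq : q ∈ χ.source) :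
    ContMDiffAt (𝓡 d) 𝓘(ℝ, V) ∞ χ q :=
  h.smooth.contMDiffAt (χ.open_source.mem_nhds hq)

lemma contMDiffAt_symm (h : IsSmoothChart d χ) {y : V} (hy : y ∈ χ.target) :
    ContMDiffAt 𝓘(ℝ, V) (𝓡 d) ∞ χ.symm y :=
  h.smooth_symm.contMDiffAt (χ.open_target.mem_nhds hy)

lemma mdifferentiableAt (h : IsSmoothChart d χ) {q : M} (hq : q ∈ χ.source) :
    MDifferentiableAt (𝓡 d) 𝓘(ℝ, V) χ q := (h.contMDiffAt hq).mdifferentiableAt (by simp)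

lemma mdifferentiableAt_symm (h : IsSmoothChart d χ) {y : V} (hy : y ∈ χ.target) :
    MDifferentiableAt 𝓘(ℝ, V) (𝓡 d) χ.symm y :=
  (h.contMDiffAt_symm hy).mdifferentiableAt (by simp)

lemma symm_mfderiv_apply (h : IsSmoothChart d χ) {q : M} (hq : q ∈ χ.source)
    (v : TangentSpace (𝓡 d) q) :
    mfderiv 𝓘(ℝ, V) (𝓡 d) χ.symm (χ q) (mfderiv (𝓡 d) 𝓘(ℝ, V) χ q v) = v := by
  have h1 : (χ.symm ∘ χ) =ᶠ[𝓝 q] id := by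
    filter_upwards [χ.open_source.mem_nhds hq] with x hx using χ.left_inv hx
  have h2 := mfderiv_comp q (h.mdifferentiableAt_symm (χ.map_source hq)) (h.mdifferentiableAt hq)
  rw [h1.mfderiv_eq, mfderiv_id] at h2
  exact (congrArg (fun L => L v) h2).symm

lemma mfderiv_symm_apply (h : IsSmoothChart d χ) {y : V} (hy : y ∈ χ.target) (v : V) :
    mfderiv (𝓡 d) 𝓘(ℝ, V) χ (χ.symm y) (mfderiv 𝓘(ℝ, V) (𝓡 d) χ.symm y v) = v := by
  have h1 : (χ ∘ χ.symm) =ᶠ[𝓝 y] id := by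
    filter_upwards [χ.open_target.mem_nhds hy] with x hx using χ.right_inv hx
  have h2 := mfderiv_comp y (h.mdifferentiableAt (χ.map_target hy)) (h.mdifferentiableAt_symm hy)
  rw [h1.mfderiv_eq, mfderiv_id] at h2
  exact (congrArg (fun L : V →L[ℝ] V => L v) h2).symm

lemma isInvertible_symm (h : IsSmoothChart d χ) {y : V} (hy : y ∈ χ.target) :
    (mfderiv 𝓘(ℝ, V) (𝓡 d) χ.symm y).IsInvertible := by
  refine ContinuousLinearMap.IsInvertible.of_inverse
    (g := mfderiv (𝓡 d) 𝓘(ℝ, V) χ (χ.symm y)) ?_ ?_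
  · refine ContinuousLinearMap.ext fun v => ?_
    have := h.symm_mfderiv_apply (χ.map_target hy) v
    rw [χ.right_inv hy] at this
    exact this
  · refine ContinuousLinearMap.ext fun v => ?_
    exact h.mfderiv_symm_apply hy v

/-- The expression of a vector field in a chart. -/
noncomputable def _root_.BSymp.chartField (χ : OpenPartialHomeomorph M V)
    (X : Π q : M, TangentSpace (𝓡 d) q) : V → V :=
  mpullback 𝓘(ℝ, V) (𝓡 d) χ.symm X

lemma chartField_apply (h : IsSmoothChart d χ) (X : Π q : M, TangentSpace (𝓡 d) q) {q : M}
    (hq : q ∈ χ.source) : chartField χ X (χ q) = mfderiv (𝓡 d) 𝓘(ℝ, V) χ q (X q) := by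
  have hinv := h.isInvertible_symm (χ.map_source hq)
  have h1 : mfderiv 𝓘(ℝ, V) (𝓡 d) χ.symm (χ q) (chartField χ X (χ q) : V) =
      X (χ.symm (χ q)) :=
    hinv.self_apply_inverse _
  have h2 := h.mfderiv_symm_apply (χ.map_source hq) (chartField χ X (χ q))
  rw [h1, χ.left_inv hq] at h2
  exact h2.symm

lemma mfderiv_eq_fderiv_chart (h : IsSmoothChart d χ) {G : Type} [NormedAddCommGroup G]
    [NormedSpace ℝ G] {u : M → G} {q : M} (hq : q ∈ χ.source)
    (hu : MDifferentiableAt (𝓡 d) 𝓘(ℝ, G) u q) (v : TangentSpace (𝓡 d) q) :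
    mfderiv (𝓡 d) 𝓘(ℝ, G) u q v =
      fderiv ℝ (u ∘ χ.symm) (χ q) (mfderiv (𝓡 d) 𝓘(ℝ, V) χ q v : V) := by
  have hu' : MDifferentiableAt (𝓡 d) 𝓘(ℝ, G) u (χ.symm (χ q)) := by rwa [χ.left_inv hq]
  have h1 := mfderiv_comp (χ q) hu' (h.mdifferentiableAt_symm (χ.map_source hq))
  rw [mfderiv_eq_fderiv] at h1
  rw [h1]
  have h2 := h.symm_mfderiv_apply hq v
  have h3 : mfderiv (𝓡 d) 𝓘(ℝ, G) u (χ.symm (χ q)) (mfderiv 𝓘(ℝ, V) (𝓡 d) χ.symm (χ q)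
    (mfderiv (𝓡 d) 𝓘(ℝ, V) χ q v)) = mfderiv (𝓡 d) 𝓘(ℝ, G) u q v := by
    rw [h2, χ.left_inv hq]
  exact h3.symm

variable [IsManifold (𝓡 d) ∞ M] [CompleteSpace V]

lemma contDiffOn_chartField (h : IsSmoothChart d χ) {X : Π q : M, TangentSpace (𝓡 d) q}
    (hX : ContMDiff (𝓡 d) (𝓡 d).tangent ∞ (fun q => (⟨q, X q⟩ : TangentBundle (𝓡 d) M))) :
    ContDiffOn ℝ ∞ (chartField χ X) χ.target := by
  have : IsManifold (𝓡 d) 1 M := IsManifold.of_le (n := ∞) (by exact_mod_cast le_top)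
  intro y hy
  have h1 := ContMDiffAt.mpullback_vectorField_preimage (m := ∞) (n := ∞)
      (I := 𝓘(ℝ, V)) (I' := 𝓡 d) (f := χ.symm) (x₀ := y) (V := X)
      hX.contMDiffAt (h.contMDiffAt_symm hy) (h.isInvertible_symm hy) (by simp)
  refine ContDiffAt.contDiffWithinAt (contMDiffAt_iff_contDiffAt.1 ?_)
  exact (contMDiff_snd_tangentBundle_modelSpace _ _).contMDiffAt.comp y h1

/-- Brackets are natural under pull-back by `χ.symm`, so commutation of fields on `M` can be read
off in any smooth chart. -/
lemma lieBracket_chartField (h : IsSmoothChart d χ) {X W : Π q : M, TangentSpace (𝓡 d) q}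
    (hX : ContMDiff (𝓡 d) (𝓡 d).tangent ∞ (fun q => (⟨q, X q⟩ : TangentBundle (𝓡 d) M)))
    (hW : ContMDiff (𝓡 d) (𝓡 d).tangent ∞ (fun q => (⟨q, W q⟩ : TangentBundle (𝓡 d) M)))
    {q : M} (hq : q ∈ χ.source) :
    lieBracket ℝ (chartField χ X) (chartField χ W) (χ q) =
      mfderiv (𝓡 d) 𝓘(ℝ, V) χ q (mlieBracket (𝓡 d) X W q) := by
  have : IsManifold (𝓡 d) (minSmoothness ℝ 3) M := by
    rw [minSmoothness_of_isRCLikeNormedField]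
    exact IsManifold.of_le (n := ∞) (WithTop.coe_le_coe.2 (le_top : (3 : ℕ∞) ≤ ⊤))
  have : IsManifold (𝓡 d) 1 M := IsManifold.of_le (n := ∞) (by exact_mod_cast le_top)
  rw [← h.chartField_apply (fun q => mlieBracket (𝓡 d) X W q) hq]
  have h1 := mpullback_mlieBracket (I := 𝓘(ℝ, V)) (I' := 𝓡 d) (f := χ.symm) (V := X) (W := W)
    (x₀ := χ q) (n := ∞) (hX.mdifferentiable (by simp) _) (hW.mdifferentiable (by simp) _)
    (h.contMDiffAt_symm (χ.map_source hq)) (by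
      rw [minSmoothness_of_isRCLikeNormedField]; exact two_le_infty_aux)
  refine Eq.trans ?_ h1.symm
  rw [← mlieBracketWithin_univ, mlieBracketWithin_eq_lieBracketWithin]
  exact (congrFun (lieBracketWithin_univ (𝕜 := ℝ) (E := V)) _).symm

end IsSmoothChart

section Derivation

/-- The two terms with the second derivative of `h` cancel by its symmetry. -/
lemma fderiv_lieBracket_apply {X : Type*} [NormedAddCommGroup X] [NormedSpace ℝ X]
    {h : X → ℝ} {V W : X → X} {x : X} (hh : ContDiffAt ℝ ∞ h x)
    (hV : DifferentiableAt ℝ V x) (hW : DifferentiableAt ℝ W x) :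
    fderiv ℝ h x (lieBracket ℝ V W x) =
      fderiv ℝ (fun y => fderiv ℝ h y (W y)) x (V x) -
        fderiv ℝ (fun y => fderiv ℝ h y (V y)) x (W x) := by
  have h2 : DifferentiableAt ℝ (fderiv ℝ h) x :=
    (hh.fderiv_right (m := 1) (by norm_cast)).differentiableAt (by simp)
  have hs : IsSymmSndFDerivAt ℝ h x := hh.isSymmSndFDerivAt (by simpa using two_le_infty_aux)
  rw [fderiv_clm_apply h2 hW, fderiv_clm_apply h2 hV, lieBracket, map_sub]
  have := hs (V x) (W x)
  simp [this]

variable [IsManifold (𝓡 d) ∞ M]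

/-- The derivative of a real function along a vector field. -/
noncomputable def derivAlong (X : Π q : M, TangentSpace (𝓡 d) q) (u : M → ℝ) (p : M) : ℝ :=
  mfderiv (𝓡 d) 𝓘(ℝ, ℝ) u p (X p)

/-- A Lie bracket acts on functions as the commutator of the derivations. -/
lemma mfderiv_mlieBracket_apply {u : M → ℝ} {O : Set M} (hO : IsOpen O)
    (hu : ContMDiffOn (𝓡 d) 𝓘(ℝ, ℝ) ∞ u O) {X W : Π q : M, TangentSpace (𝓡 d) q}
    (hX : ContMDiff (𝓡 d) (𝓡 d).tangent ∞ (fun q => (⟨q, X q⟩ : TangentBundle (𝓡 d) M)))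
    (hW : ContMDiff (𝓡 d) (𝓡 d).tangent ∞ (fun q => (⟨q, W q⟩ : TangentBundle (𝓡 d) M)))
    {p : M} (hp : p ∈ O) :
    derivAlong (fun q => mlieBracket (𝓡 d) X W q) u p =
      derivAlong X (derivAlong W u) p - derivAlong W (derivAlong X u) p := by
  set χ : OpenPartialHomeomorph M (E d) := chartAt (E d) p with hχ
  have h : IsSmoothChart d χ := isSmoothChart_chartAt p
  have hpχ : p ∈ χ.source := mem_chart_source _ p
  have hud : ∀ q ∈ O, MDifferentiableAt (𝓡 d) 𝓘(ℝ, ℝ) u q := fun q hq =>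
    (hu.contMDiffAt (hO.mem_nhds hq)).mdifferentiableAt (by simp)
  have hu' : ContDiffAt ℝ ∞ (u ∘ χ.symm) (χ p) := by
    rw [← contMDiffAt_iff_contDiffAt]
    refine ContMDiffAt.comp (χ p) ?_ (h.contMDiffAt_symm (χ.map_source hpχ))
    rw [χ.left_inv hpχ]
    exact hu.contMDiffAt (hO.mem_nhds hp)
  have hfield : ∀ {Y : Π q : M, TangentSpace (𝓡 d) q},
      ContMDiff (𝓡 d) (𝓡 d).tangent ∞ (fun q => (⟨q, Y q⟩ : TangentBundle (𝓡 d) M)) →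
      ContDiffAt ℝ ∞ (chartField χ Y) (χ p) := fun hY =>
    (h.contDiffOn_chartField hY).contDiffAt (χ.open_target.mem_nhds (χ.map_source hpχ))
  have hfun : ∀ Y : Π q : M, TangentSpace (𝓡 d) q,
      derivAlong Y u =ᶠ[𝓝 p]
        (fun y => fderiv ℝ (u ∘ χ.symm) y (chartField χ Y y)) ∘ χ := by
    intro Y
    filter_upwards [hO.mem_nhds hp, χ.open_source.mem_nhds hpχ] with q h1 h2
    rw [derivAlong, h.mfderiv_eq_fderiv_chart h2 (hud q h1), ← h.chartField_apply Y h2]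
    rfl
  have hder : ∀ {Y : Π q : M, TangentSpace (𝓡 d) q},
      ContMDiff (𝓡 d) (𝓡 d).tangent ∞ (fun q => (⟨q, Y q⟩ : TangentBundle (𝓡 d) M)) →
      ∀ v : TangentSpace (𝓡 d) p,
      mfderiv (𝓡 d) 𝓘(ℝ, ℝ) (derivAlong Y u) p v =
        fderiv ℝ (fun y => fderiv ℝ (u ∘ χ.symm) y (chartField χ Y y)) (χ p)
          (mfderiv (𝓡 d) 𝓘(ℝ, E d) χ p v : E d) := by
    intro Y hY v
    rw [(hfun Y).mfderiv_eq]
    have h1 : DifferentiableAt ℝ (fun y => fderiv ℝ (u ∘ χ.symm) y (chartField χ Y y)) (χ p) :=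
      ((hu'.fderiv_right (m := 1) (by norm_cast)).differentiableAt (by simp)).clm_apply
        ((hfield hY).differentiableAt (by simp))
    have h2 := mfderiv_comp p h1.mdifferentiableAt (h.mdifferentiableAt hpχ)
    rw [mfderiv_eq_fderiv] at h2
    exact congrArg (fun L => L v) h2
  have e1 : derivAlong (fun q => mlieBracket (𝓡 d) X W q) u p =
      fderiv ℝ (u ∘ χ.symm) (χ p) (lieBracket ℝ (chartField χ X) (chartField χ W) (χ p)) := by
    rw [h.lieBracket_chartField hX hW hpχ]
    exact h.mfderiv_eq_fderiv_chart hpχ (hud p hp) _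
  have e2 : derivAlong X (derivAlong W u) p = fderiv ℝ (fun y => fderiv ℝ (u ∘ χ.symm) y
      (chartField χ W y)) (χ p) (chartField χ X (χ p)) := by
    rw [h.chartField_apply X hpχ]
    exact hder hW _
  have e3 : derivAlong W (derivAlong X u) p = fderiv ℝ (fun y => fderiv ℝ (u ∘ χ.symm) y
      (chartField χ X y)) (χ p) (chartField χ W (χ p)) := by
    rw [h.chartField_apply W hpχ]
    exact hder hX _
  rw [e1, e2, e3, fderiv_lieBracket_apply hu' ((hfield hX).differentiableAt (by simp))
    ((hfield hW).differentiableAt (by simp))]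

end Derivation

end Chart

/-! ### Existence of flow boxes. -/

section FlowBox

open VectorField

variable {d r s : ℕ} {M : Type*} [TopologicalSpace M] [ChartedSpace (E d) M]

/-- A chart `β = (u, f)` in which the vector fields `X_i` are the coordinate fields `∂/∂u_i`. -/
structure IsFlowBox (f : M → E s) (X : Fin r → Π q : M, TangentSpace (𝓡 d) q)
    (β : OpenPartialHomeomorph M (E r × E s)) : Prop extends IsSmoothChart d β where
  snd_eq : ∀ q ∈ β.source, (β q).2 = f q
  mfderiv_eq : ∀ q ∈ β.source, ∀ i, mfderiv (𝓡 d) 𝓘(ℝ, E r × E s) β q (X i q) =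
    ((EuclideanSpace.single i 1, 0) : E r × E s)

/-- Supplies the `r` coordinates along the leaf which complete `f` to a chart. -/
lemma exists_linear_leftInverse_frame {V : Type} [NormedAddCommGroup V] [NormedSpace ℝ V]
    [FiniteDimensional ℝ V] {v : Fin r → V} (hv : LinearIndependent ℝ v) :
    ∃ π : V →L[ℝ] E r, ∀ i, π (v i) = EuclideanSpace.single i 1 := by
  obtain ⟨π, hπ⟩ := (Fintype.linearCombination ℝ v).exists_leftInverse_of_injective
    (LinearMap.ker_eq_bot.2 (by
      rw [← linearIndependent_iff_injective_fintypeLinearCombination]; exact hv))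
  refine ⟨((EuclideanSpace.equiv (Fin r) ℝ).symm.toLinearMap.comp π).toContinuousLinearMap, ?_⟩
  intro i
  have h1 := congrArg (fun L : (Fin r → ℝ) →ₗ[ℝ] (Fin r → ℝ) => L (Pi.single i 1)) hπ
  simp only [LinearMap.comp_apply, Fintype.linearCombination_apply_single, one_smul,
    LinearMap.id_apply] at h1
  change (EuclideanSpace.equiv (Fin r) ℝ).symm (π (v i)) = _
  rw [h1]
  rfl

/-- By the dimension count the kernel of `A` is exactly the span of the `v i`, and `π` is injective
on that span. -/
lemma injective_prod_of_surjective {V : Type} [NormedAddCommGroup V] [NormedSpace ℝ V]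
    [FiniteDimensional ℝ V] {v : Fin r → V} {π : V →L[ℝ] E r} {A : V →L[ℝ] E s}
    (hv : LinearIndependent ℝ v)
    (hπ : ∀ i, π (v i) = EuclideanSpace.single i 1) (hA : Function.Surjective A)
    (hAv : ∀ i, A (v i) = 0) (hdim : r + s = Module.finrank ℝ V) :
    Function.Injective (π.prod A) := by
  have hker : Submodule.span ℝ (Set.range v) = LinearMap.ker (A : V →ₗ[ℝ] E s) := by
    refine Submodule.eq_of_le_of_finrank_eq ?_ ?_
    · rw [Submodule.span_le]
      rintro _ ⟨i, rfl⟩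
      exact hAv i
    · have h1 := LinearMap.finrank_range_add_finrank_ker (A : V →ₗ[ℝ] E s)
      rw [LinearMap.range_eq_top.2 hA, finrank_top, finrank_euclideanSpace_fin] at h1
      rw [finrank_span_eq_card hv, Fintype.card_fin]
      omega
  rw [injective_iff_map_eq_zero]
  intro ξ hξ
  have h1 : π ξ = 0 := congrArg Prod.fst hξ
  have h2 : A ξ = 0 := congrArg Prod.snd hξ
  have h3 : ξ ∈ Submodule.span ℝ (Set.range v) := by rw [hker]; exact h2
  obtain ⟨c, rfl⟩ := (Submodule.mem_span_range_iff_exists_fun ℝ).1 h3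
  have h4 : ∀ i, c i = 0 := by
    intro i
    have := congrArg (fun x : E r => x i) h1
    simpa [map_sum, hπ, Finset.sum_apply, Pi.single_apply] using this
  simp [h4]

lemma IsSmoothChart.linearIndependent_chartField {V ι : Type} [NormedAddCommGroup V]
    [NormedSpace ℝ V] {χ : OpenPartialHomeomorph M V} (h : IsSmoothChart d χ)
    {X : ι → Π q : M, TangentSpace (𝓡 d) q} {p : M} (hp : p ∈ χ.source)
    (hli : LinearIndependent ℝ fun i => X i p) :
    LinearIndependent ℝ fun i => chartField χ (X i) (χ p) := by
  let L : TangentSpace (𝓡 d) p →L[ℝ] V := mfderiv (𝓡 d) 𝓘(ℝ, V) χ p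
  have hinj : Function.Injective L := Function.LeftInverse.injective (h.symm_mfderiv_apply hp)
  have h1 := hli.map' L.toLinearMap (LinearMap.ker_eq_bot.2 hinj)
  have h2 : (⇑L.toLinearMap ∘ fun i => X i p) = fun i => chartField χ (X i) (χ p) :=
    funext fun i => (h.chartField_apply (X i) hp).symm
  rwa [h2] at h1

/-- A submersion is a coordinate projection in a suitable chart. -/
lemma exists_isSmoothChart_snd_eq [IsManifold (𝓡 d) ∞ M] {f : M → E s}
    {X : Fin r → Π q : M, TangentSpace (𝓡 d) q} {O : Set M}
    (hO : IsOpen O) (hf : ContMDiffOn (𝓡 d) 𝓘(ℝ, E s) ∞ f O)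
    (hdim : r + s = d) {p : M} (hp : p ∈ O) (hli : LinearIndependent ℝ fun i => X i p)
    (htan : ∀ i, mfderiv (𝓡 d) 𝓘(ℝ, E s) f p (X i p) = 0)
    (hsurj : Function.Surjective (mfderiv (𝓡 d) 𝓘(ℝ, E s) f p)) :
    ∃ χ : OpenPartialHomeomorph M (E r × E s), p ∈ χ.source ∧ χ.source ⊆ O ∧
      IsSmoothChart d χ ∧ ∀ q ∈ χ.source, (χ q).2 = f q := by
  set ψ : OpenPartialHomeomorph M (E d) := chartAt (E d) p with hψ
  have h : IsSmoothChart d ψ := isSmoothChart_chartAt p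
  have hpψ : p ∈ ψ.source := mem_chart_source _ p
  have hfd : ∀ q ∈ O, MDifferentiableAt (𝓡 d) 𝓘(ℝ, E s) f q := fun q hq =>
    (hf.contMDiffAt (hO.mem_nhds hq)).mdifferentiableAt (by simp)
  let U : Set (E d) := ψ.target ∩ ψ.symm ⁻¹' O
  have hU : IsOpen U := ψ.symm.isOpen_inter_preimage hO
  have hpU : ψ p ∈ U := ⟨ψ.map_source hpψ, by rw [Set.mem_preimage, ψ.left_inv hpψ]; exact hp⟩
  have hfU : ContDiffOn ℝ ∞ (f ∘ ψ.symm) U := by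
    rw [← contMDiffOn_iff_contDiffOn]
    exact hf.comp (h.smooth_symm.mono Set.inter_subset_left) fun y hy => hy.2
  let v : Fin r → E d := fun i => chartField ψ (X i) (ψ p)
  have hv : LinearIndependent ℝ v := h.linearIndependent_chartField hpψ hli
  obtain ⟨π, hπ⟩ := exists_linear_leftInverse_frame hv
  let g : E d → E r × E s := fun y => (π y, f (ψ.symm y))
  have hg : ContDiffOn ℝ ∞ g U := π.contDiff.contDiffOn.prodMk hfU
  have hgd : fderiv ℝ g (ψ p) = π.prod (fderiv ℝ (f ∘ ψ.symm) (ψ p)) :=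
    (π.hasFDerivAt.prodMk ((hfU.contDiffAt (hU.mem_nhds hpU)).differentiableAt
      (by simp)).hasFDerivAt).fderiv
  have hinj : Function.Injective (fderiv ℝ g (ψ p)) := by
    rw [hgd]
    refine injective_prod_of_surjective hv hπ ?_ ?_ ?_
    · intro w
      obtain ⟨ξ, hξ⟩ := hsurj w
      exact ⟨_, (h.mfderiv_eq_fderiv_chart hpψ (hfd p hp) ξ).symm.trans hξ⟩
    · intro i
      exact (congrArg (fderiv ℝ (f ∘ ψ.symm) (ψ p)) (h.chartField_apply (X i) hpψ)).trans
        ((h.mfderiv_eq_fderiv_chart hpψ (hfd p hp) _).symm.trans (htan i))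
    · rw [finrank_euclideanSpace_fin, hdim]
  obtain ⟨χ₁, hpχ₁, hχ₁U, hχ₁g, hs1, hs2⟩ := exists_chart_of_injective hU hpU hg hinj
    (by rw [Module.finrank_prod]; simp only [finrank_euclideanSpace_fin]; omega)
  let χ : OpenPartialHomeomorph M (E r × E s) := ψ.trans χ₁
  have hχ : IsSmoothChart d χ := h.trans hs1 hs2
  have hχs : χ.source = ψ.source ∩ ψ ⁻¹' χ₁.source := ψ.trans_source χ₁
  have hpχ : p ∈ χ.source := by rw [hχs]; exact ⟨hpψ, hpχ₁⟩
  have hχO : χ.source ⊆ O := by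
    rw [hχs]
    rintro q ⟨hq1, hq2⟩
    have := (hχ₁U hq2).2
    rwa [Set.mem_preimage, ψ.left_inv hq1] at this
  have hχf : ∀ q ∈ χ.source, (χ q).2 = f q := by
    intro q hq
    rw [hχs] at hq
    change (χ₁ (ψ q)).2 = f q
    rw [hχ₁g]
    change f (ψ.symm (ψ q)) = f q
    rw [ψ.left_inv hq.1]
  exact ⟨χ, hpχ, hχO, hχ, hχf⟩

variable [IsManifold (𝓡 d) ∞ M]

/-- In a chart whose second component is `f` the fields are horizontal, because `f` is constant
along them. They are then a commuting frame of `E r` depending on parameters in `E s`, and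
`exists_straightening` applies; no flow has to be integrated. -/
lemma exists_isFlowBox {f : M → E s} {X : Fin r → Π q : M, TangentSpace (𝓡 d) q} {O : Set M}
    (hO : IsOpen O) (hf : ContMDiffOn (𝓡 d) 𝓘(ℝ, E s) ∞ f O)
    (hX : ∀ i, ContMDiff (𝓡 d) (𝓡 d).tangent ∞
      (fun q => (⟨q, X i q⟩ : TangentBundle (𝓡 d) M)))
    (hcomm : ∀ q ∈ O, ∀ i j, mlieBracket (𝓡 d) (X i) (X j) q = 0)
    (htan : ∀ q ∈ O, ∀ i, mfderiv (𝓡 d) 𝓘(ℝ, E s) f q (X i q) = 0)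
    (hdim : r + s = d) {p : M} (hp : p ∈ O) (hli : LinearIndependent ℝ fun i => X i p)
    (hsurj : Function.Surjective (mfderiv (𝓡 d) 𝓘(ℝ, E s) f p)) :
    ∃ β : OpenPartialHomeomorph M (E r × E s), p ∈ β.source ∧ β.source ⊆ O ∧
      IsFlowBox f X β := by
  have hfd : ∀ q ∈ O, MDifferentiableAt (𝓡 d) 𝓘(ℝ, E s) f q := fun q hq =>
    (hf.contMDiffAt (hO.mem_nhds hq)).mdifferentiableAt (by simp)
  obtain ⟨χ, hpχ, hχO, hχ, hχf⟩ := exists_isSmoothChart_snd_eq hO hf hdim hp hli (htan p hp) hsurj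
  have hsnd : ∀ y ∈ χ.target, ∀ i, (chartField χ (X i) y).2 = 0 := by
    intro y hy i
    have hq := χ.map_target hy
    have h1 := hχ.mfderiv_eq_fderiv_chart hq (hfd _ (hχO hq)) (X i (χ.symm y))
    rw [χ.right_inv hy] at h1
    have h2 : f ∘ χ.symm =ᶠ[𝓝 y] Prod.snd := by
      filter_upwards [χ.open_target.mem_nhds hy] with x hx
      change f (χ.symm x) = x.2
      rw [← hχf _ (χ.map_target hx), χ.right_inv hx]
    have h3 := hχ.chartField_apply (X i) hq
    rw [χ.right_inv hy] at h3
    rw [h2.fderiv_eq, fderiv_snd, ← h3] at h1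
    exact h1.symm.trans (htan _ (hχO hq) i)
  let a : Fin r → E r × E s → E r := fun i y => (chartField χ (X i) y).1
  have ha' : ∀ y ∈ χ.target, ∀ i, chartField χ (X i) y = (a i y, 0) := fun y hy i =>
    Prod.ext rfl (hsnd y hy i)
  have ha : ∀ i, ContDiffOn ℝ ∞ (a i) χ.target := fun i => (hχ.contDiffOn_chartField (hX i)).fst
  have hali : LinearIndependent ℝ fun i => a i (χ p) := by
    have h1 := hχ.linearIndependent_chartField hpχ hli
    have h2 : (fun i => chartField χ (X i) (χ p)) =
        LinearMap.inl ℝ (E r) (E s) ∘ fun i => a i (χ p) :=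
      funext fun i => ha' _ (χ.map_source hpχ) i
    rw [h2] at h1
    exact LinearIndependent.of_comp _ h1
  have hacomm : ∀ y ∈ χ.target, ∀ i j,
      fderiv ℝ (a j) y (a i y, 0) = fderiv ℝ (a i) y (a j y, 0) := by
    intro y hy i j
    have hq := χ.map_target hy
    have h1 := hχ.lieBracket_chartField (hX i) (hX j) hq
    rw [hcomm _ (hχO hq), χ.right_inv hy] at h1
    have h2 : lieBracket ℝ (chartField χ (X i)) (chartField χ (X j)) y = 0 :=
      h1.trans (map_zero _)
    have hda : ∀ k, fderiv ℝ (a k) y = (ContinuousLinearMap.fst ℝ (E r) (E s)).comp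
        (fderiv ℝ (chartField χ (X k)) y) := fun k =>
      ((((hχ.contDiffOn_chartField (hX k)).contDiffAt (χ.open_target.mem_nhds hy)).differentiableAt
        (by simp)).hasFDerivAt.fst).fderiv
    rw [lieBracket, ha' y hy, ha' y hy, sub_eq_zero] at h2
    rw [hda, hda]
    exact congrArg Prod.fst h2
  obtain ⟨β, hpβ, hβχ, ht1, ht2, hβsnd, hβd⟩ := exists_straightening χ.open_target
    (χ.map_source hpχ) ha hali hacomm
  have hsrc : (χ.trans β).source = χ.source ∩ χ ⁻¹' β.source := χ.trans_source β
  refine ⟨χ.trans β, by rw [hsrc]; exact ⟨hpχ, hpβ⟩,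
    by rw [hsrc]; exact Set.inter_subset_left.trans hχO, hχ.trans ht1 ht2, ?_, ?_⟩
  · intro q hq
    rw [hsrc] at hq
    exact (hβsnd _ hq.2).trans (hχf q hq.1)
  · intro q hq i
    rw [hsrc] at hq
    have h1 : MDifferentiableAt 𝓘(ℝ, E r × E s) 𝓘(ℝ, E r × E s) β (χ q) :=
      ((ht1.contDiffAt (β.open_source.mem_nhds hq.2)).differentiableAt
        (by simp)).mdifferentiableAt
    have h2 : mfderiv (𝓡 d) 𝓘(ℝ, E r × E s) (χ.trans β) q =
        (mfderiv 𝓘(ℝ, E r × E s) 𝓘(ℝ, E r × E s) β (χ q)).comp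
          (mfderiv (𝓡 d) 𝓘(ℝ, E r × E s) χ q) :=
      mfderiv_comp q h1 (hχ.mdifferentiableAt hq.1)
    rw [h2, mfderiv_eq_fderiv]
    have h3 := (hχ.chartField_apply (X i) hq.1).symm.trans (ha' _ (χ.map_source hq.1) i)
    exact (congrArg (fderiv ℝ β (χ q)) h3).trans (hβd _ hq.2 i)

end FlowBox

/-! ### Comparing flow boxes; curves tangent to the distribution. -/

section Curves

variable {d r s : ℕ} {M : Type*} [TopologicalSpace M] [ChartedSpace (E d) M]
  {f : M → E s} {X : Fin r → Π q : M, TangentSpace (𝓡 d) q} {R : Set M}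
  {β β' : OpenPartialHomeomorph M (E r × E s)}

/-- The vector `w` of `ℝʳ` as a horizontal vector of `ℝʳ × ℝˢ`. -/
def horizontal (w : E r) : E r × E s := (w, 0)

lemma horizontal_eq_sum (w : E r) :
    (horizontal w : E r × E s) = ∑ i, w i • ((EuclideanSpace.single i 1, 0) : E r × E s) := by
  refine Prod.ext ?_ ?_
  · simp only [horizontal, Prod.smul_mk, smul_zero, Prod.fst_sum]
    ext j
    simp [Pi.single_apply]
  · simp [horizontal, Prod.snd_sum]

lemma horizontal_add (v w : E r) :
    (horizontal (v + w) : E r × E s) = horizontal v + horizontal w := by simp [horizontal]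

lemma horizontal_smul (c : ℝ) (w : E r) :
    (horizontal (c • w) : E r × E s) = c • horizontal w := by simp [horizontal]

lemma horizontal_zero : (horizontal (0 : E r) : E r × E s) = 0 := rfl

lemma norm_horizontal (w : E r) : ‖(horizontal w : E r × E s)‖ = ‖w‖ := by
  simp [horizontal, Prod.norm_def]

namespace IsFlowBox

lemma mfderiv_symm_single (h : IsFlowBox f X β) {y : E r × E s} (hy : y ∈ β.target) (i : Fin r) :
    mfderiv 𝓘(ℝ, E r × E s) (𝓡 d) β.symm y ((EuclideanSpace.single i 1, 0) : E r × E s) =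
      X i (β.symm y) := by
  have h1 := h.symm_mfderiv_apply (β.map_target hy) (X i (β.symm y))
  rw [h.mfderiv_eq _ (β.map_target hy), β.right_inv hy] at h1
  exact h1

lemma mfderiv_symm_horizontal (h : IsFlowBox f X β) {y : E r × E s} (hy : y ∈ β.target)
    (w : E r) :
    mfderiv 𝓘(ℝ, E r × E s) (𝓡 d) β.symm y (horizontal w : E r × E s) =
      ∑ i, w i • X i (β.symm y) := by
  let L : (E r × E s) →L[ℝ] TangentSpace (𝓡 d) (β.symm y) :=
    mfderiv 𝓘(ℝ, E r × E s) (𝓡 d) β.symm y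
  change L (horizontal w) = _
  rw [horizontal_eq_sum, map_sum]
  refine Finset.sum_congr rfl fun i _ => ?_
  rw [map_smul]
  exact congrArg (w i • ·) (h.mfderiv_symm_single hy i)

lemma snd_symm (h : IsFlowBox f X β) {y : E r × E s} (hy : y ∈ β.target) :
    f (β.symm y) = y.2 := by
  rw [← h.snd_eq _ (β.map_target hy), β.right_inv hy]

/-- Both boxes carry `X i` to the same coordinate field, so the derivative of the transition fixes
horizontal vectors. -/
lemma fderiv_transition (h : IsFlowBox f X β) (h' : IsFlowBox f X β') {y : E r × E s}
    (hy : y ∈ β.target) (hy' : β.symm y ∈ β'.source) (w : E r) :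
    fderiv ℝ (β' ∘ β.symm) y (horizontal w) = horizontal w := by
  have h1 := mfderiv_comp y (h'.mdifferentiableAt hy') (h.mdifferentiableAt_symm hy)
  rw [mfderiv_eq_fderiv] at h1
  rw [h1]
  let L : TangentSpace (𝓡 d) (β.symm y) →L[ℝ] (E r × E s) :=
    mfderiv (𝓡 d) 𝓘(ℝ, E r × E s) β' (β.symm y)
  have h2 : L (∑ i, w i • X i (β.symm y)) = horizontal w := by
    rw [map_sum, horizontal_eq_sum]
    refine Finset.sum_congr rfl fun i _ => ?_
    rw [map_smul]
    exact congrArg (w i • ·) (h'.mfderiv_eq _ hy' i)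
  exact (congrArg L (h.mfderiv_symm_horizontal hy w)).trans h2

lemma contDiffAt_transition (h : IsFlowBox f X β) (h' : IsFlowBox f X β') {y : E r × E s}
    (hy : y ∈ β.target) (hy' : β.symm y ∈ β'.source) : ContDiffAt ℝ ∞ (β' ∘ β.symm) y := by
  rw [← contMDiffAt_iff_contDiffAt]
  exact (h'.contMDiffAt hy').comp y (h.contMDiffAt_symm hy)

/-- Transitions between flow boxes are translations along the leaves. -/
lemma transition_line (h : IsFlowBox f X β) (h' : IsFlowBox f X β') {y : E r × E s} {w : E r}
    {δ : ℝ} (hy : ∀ τ ∈ Set.Ioo (-δ) δ, y + τ • horizontal w ∈ β.target ∧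
      β.symm (y + τ • horizontal w) ∈ β'.source) {τ : ℝ} (hτ : τ ∈ Set.Ioo (-δ) δ) :
    β' (β.symm (y + τ • horizontal w)) = β' (β.symm y) + τ • horizontal w := by
  have hδ : 0 < δ := by linarith [hτ.1, hτ.2]
  have hd : ∀ σ ∈ Set.Ioo (-δ) δ, HasDerivAt
      (fun σ : ℝ => (β' ∘ β.symm) (y + σ • horizontal w) - σ • (horizontal w : E r × E s)) 0 σ := by
    intro σ hσ
    have h1 := ((h.contDiffAt_transition h' (hy σ hσ).1 (hy σ hσ).2).differentiableAt
      (by simp)).hasFDerivAt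
    have h2 : HasDerivAt (fun σ : ℝ => y + σ • (horizontal w : E r × E s)) (horizontal w) σ := by
      simpa using ((hasDerivAt_id σ).smul_const (horizontal w : E r × E s)).const_add y
    have h3 : HasDerivAt (fun σ : ℝ => σ • (horizontal w : E r × E s)) (horizontal w) σ := by
      simpa using (hasDerivAt_id σ).smul_const (horizontal w : E r × E s)
    have h4 := (h1.comp_hasDerivAt σ h2).sub h3
    rw [h.fderiv_transition h' (hy σ hσ).1 (hy σ hσ).2, sub_self] at h4
    exact h4
  have h1 := isOpen_Ioo.is_const_of_deriv_eq_zero (isPreconnected_Ioo)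
    (fun σ hσ => (hd σ hσ).differentiableAt.differentiableWithinAt)
    (fun σ hσ => (hd σ hσ).deriv) hτ (show (0 : ℝ) ∈ Set.Ioo (-δ) δ from ⟨by linarith, hδ⟩)
  simp only [zero_smul, add_zero, sub_zero, Function.comp_apply] at h1
  exact eq_add_of_sub_eq h1

variable [T2Space M]

/-- Both sides are the time-one flow of `∑ i, w i • X i` from `q`, computed in two boxes. The times
of agreement form a closed set because `M` is Hausdorff, and agreement at `τ` persists a little
beyond `τ` because transitions are translations (`transition_line`); so they agree on all of
`[0,1]`. -/
lemma symm_line_eq (h : IsFlowBox f X β) (h' : IsFlowBox f X β') {q : M} (hq : q ∈ β.source)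
    (hq' : q ∈ β'.source) {w : E r}
    (hw : ∀ τ ∈ Set.Icc (0 : ℝ) 1, β q + τ • horizontal w ∈ β.target)
    (hw' : ∀ τ ∈ Set.Icc (0 : ℝ) 1, β' q + τ • horizontal w ∈ β'.target) :
    β.symm (β q + horizontal w) = β'.symm (β' q + horizontal w) := by
  have hcont : ∀ {β : OpenPartialHomeomorph M (E r × E s)},
      (∀ τ ∈ Set.Icc (0 : ℝ) 1, β q + τ • horizontal w ∈ β.target) →
      ContinuousOn (fun τ : ℝ => β.symm (β q + τ • horizontal w)) (Set.Icc 0 1) := by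
    intro β hw
    exact β.symm.continuousOn.comp (by fun_prop) hw
  let S : Set ℝ := {τ | β.symm (β q + τ • horizontal w) = β'.symm (β' q + τ • horizontal w)}
  have hS : Set.Icc (0 : ℝ) 1 ⊆ S := by
    refine IsClosed.Icc_subset_of_forall_mem_nhdsWithin ?_ ?_ ?_
    · have := ((hcont hw).prodMk (hcont hw')).preimage_isClosed_of_isClosed isClosed_Icc
        (isClosed_diagonal (X := M))
      rw [Set.inter_comm]
      exact this
    · simp [S, β.left_inv hq, β'.left_inv hq']
    · rintro τ ⟨hτS, hτ⟩
      have hτ' : τ ∈ Set.Icc (0 : ℝ) 1 := Set.Ico_subset_Icc_self hτ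
      have hτS' : β.symm (β q + τ • horizontal w) = β'.symm (β' q + τ • horizontal w) := hτS
      let W : Set (E r × E s) := β.target ∩ β.symm ⁻¹' β'.source
      have hW : IsOpen W := β.symm.isOpen_inter_preimage β'.open_source
      have hyW : β q + τ • horizontal w ∈ W := by
        refine ⟨hw τ hτ', ?_⟩
        rw [Set.mem_preimage, hτS']
        exact β'.map_target (hw' τ hτ')
      have hlim : Continuous fun σ : ℝ => (β q + τ • horizontal w) + σ • horizontal w := by
        fun_prop
      have hlim' : Continuous fun σ : ℝ => (β' q + τ • horizontal w) + σ • horizontal w := by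
        fun_prop
      have hev : ∀ᶠ σ in 𝓝 (0 : ℝ), (β q + τ • horizontal w) + σ • horizontal w ∈ W ∧
          (β' q + τ • horizontal w) + σ • horizontal w ∈ β'.target := by
        refine (hlim.continuousAt.eventually (hW.mem_nhds ?_)).and
          (hlim'.continuousAt.eventually (β'.open_target.mem_nhds ?_))
        · simpa using hyW
        · simpa using hw' τ hτ'
      obtain ⟨δ, hδ, hball⟩ := Metric.eventually_nhds_iff_ball.1 hev
      rw [Real.ball_eq_Ioo] at hball
      simp only [zero_sub, zero_add] at hball
      have hmem : Set.Ioo (τ - δ) (τ + δ) ∈ 𝓝[>] τ :=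
        nhdsWithin_le_nhds (Ioo_mem_nhds (by linarith) (by linarith))
      filter_upwards [hmem] with σ hσ
      have hσ' : σ - τ ∈ Set.Ioo (-δ) δ := ⟨by linarith [hσ.1], by linarith [hσ.2]⟩
      have h1 := h.transition_line h' (fun ρ hρ => (hball ρ hρ).1) hσ'
      have e1 : β q + τ • horizontal w + (σ - τ) • horizontal w = β q + σ • horizontal w := by
        module
      have e2 : β' q + τ • horizontal w + (σ - τ) • horizontal w = β' q + σ • horizontal w := by
        module
      rw [hτS', β'.right_inv (hw' τ hτ'), e1, e2] at h1
      have h2 := (hball _ hσ').1.2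
      rw [Set.mem_preimage, e1] at h2
      change _ = _
      rw [← h1, β'.left_inv h2]
  have := hS (Set.right_mem_Icc.2 zero_le_one)
  simpa [S] using this

end IsFlowBox

/-- Two points are joined by a `C¹` curve in `R` which is tangent to the span of the `X_i`. -/
def TangentJoined (X : Fin r → Π q : M, TangentSpace (𝓡 d) q) (R : Set M) (p q : M) : Prop :=
  ∃ γ : ℝ → M, ContMDiffOn 𝓘(ℝ, ℝ) (𝓡 d) 1 γ (Set.Icc 0 1) ∧ γ 0 = p ∧ γ 1 = q ∧
    ∀ τ ∈ Set.Icc (0 : ℝ) 1, γ τ ∈ R ∧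
      mfderivWithin 𝓘(ℝ, ℝ) (𝓡 d) γ (Set.Icc 0 1) τ (1 : ℝ) ∈
        Submodule.span ℝ (Set.range fun i => X i (γ τ))

lemma IsFlowBox.tangentJoined (h : IsFlowBox f X β) (hR : β.source ⊆ R) {q : M}
    (hq : q ∈ β.source) {w : E r}
    (hw : ∀ τ ∈ Set.Icc (0 : ℝ) 1, β q + τ • horizontal w ∈ β.target) :
    TangentJoined X R q (β.symm (β q + horizontal w)) := by
  have hline : ∀ τ : ℝ, HasFDerivAt (fun τ : ℝ => β q + τ • (horizontal w : E r × E s))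
      (ContinuousLinearMap.toSpanSingleton ℝ (horizontal w)) τ := by
    intro τ
    refine HasDerivAt.hasFDerivAt ?_
    simpa using ((hasDerivAt_id τ).smul_const (horizontal w : E r × E s)).const_add (β q)
  refine ⟨fun τ => β.symm (β q + τ • horizontal w), ?_, by simp [β.left_inv hq], by simp, ?_⟩
  · have h1 : ContMDiff 𝓘(ℝ, ℝ) 𝓘(ℝ, E r × E s) 1
        fun τ : ℝ => β q + τ • (horizontal w : E r × E s) := by
      rw [contMDiff_iff_contDiff]; fun_prop
    exact (h.smooth_symm.of_le (by exact_mod_cast le_top)).comp h1.contMDiffOn hw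
  · intro τ hτ
    refine ⟨hR (β.map_target (hw τ hτ)), ?_⟩
    have h1 : HasMFDerivAt 𝓘(ℝ, ℝ) (𝓡 d) (fun τ => β.symm (β q + τ • horizontal w)) τ _ :=
      (h.mdifferentiableAt_symm (hw τ hτ)).hasMFDerivAt.comp τ (hline τ).hasMFDerivAt
    rw [(h1.hasMFDerivWithinAt (s := Set.Icc 0 1)).mfderivWithin
      ((uniqueDiffOn_Icc zero_lt_one τ hτ).uniqueMDiffWithinAt)]
    have h2 := h.mfderiv_symm_horizontal (hw τ hτ) w
    have h3 : ((mfderiv 𝓘(ℝ, E r × E s) (𝓡 d) β.symm (β q + τ • horizontal w)).comp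
        (ContinuousLinearMap.toSpanSingleton ℝ (horizontal w : E r × E s))) (1 : ℝ) =
        ∑ i, w i • X i (β.symm (β q + τ • horizontal w)) := by
      rw [← h2]
      exact congrArg (mfderiv 𝓘(ℝ, E r × E s) (𝓡 d) β.symm (β q + τ • horizontal w))
        (one_smul ℝ (horizontal w : E r × E s))
    refine Set.mem_of_eq_of_mem h3 ?_
    exact Submodule.sum_mem _ fun i _ => Submodule.smul_mem _ _ (Submodule.subset_span ⟨i, rfl⟩)

/-- The differential of `f` kills the span of the `X i`, so tangent curves stay in level sets. This
is what confines the leaves. -/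
lemma eqOn_of_tangent {γ : ℝ → M} (hR : IsOpen R) (hf : ContMDiffOn (𝓡 d) 𝓘(ℝ, E s) ∞ f R)
    (htan : ∀ q ∈ R, ∀ i, mfderiv (𝓡 d) 𝓘(ℝ, E s) f q (X i q) = 0)
    (hγ : ContMDiffOn 𝓘(ℝ, ℝ) (𝓡 d) 1 γ (Set.Icc 0 1))
    (hγt : ∀ τ ∈ Set.Icc (0 : ℝ) 1, γ τ ∈ R ∧
      mfderivWithin 𝓘(ℝ, ℝ) (𝓡 d) γ (Set.Icc 0 1) τ (1 : ℝ) ∈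
        Submodule.span ℝ (Set.range fun i => X i (γ τ))) :
    ∀ τ ∈ Set.Icc (0 : ℝ) 1, f (γ τ) = f (γ 0) := by
  have hder : ∀ τ ∈ Set.Icc (0 : ℝ) 1, HasFDerivWithinAt (f ∘ γ) (0 : ℝ →L[ℝ] E s)
      (Set.Icc 0 1) τ := by
    intro τ hτ
    obtain ⟨h1, h2⟩ := hγt τ hτ
    have h3 := ((hf.contMDiffAt (hR.mem_nhds h1)).mdifferentiableAt (by simp)).hasMFDerivAt
    have h4 := ((hγ τ hτ).mdifferentiableWithinAt (by simp)).hasMFDerivWithinAt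
    have h5 := (h3.comp_hasMFDerivWithinAt τ h4).hasFDerivWithinAt
    have h6 : ∀ v ∈ Submodule.span ℝ (Set.range fun i => X i (γ τ)),
        mfderiv (𝓡 d) 𝓘(ℝ, E s) f (γ τ) v = 0 := by
      intro v hv
      induction hv using Submodule.span_induction with
      | mem x hx => obtain ⟨i, rfl⟩ := hx; exact htan _ h1 i
      | zero => exact map_zero _
      | add x y _ _ hx hy => rw [map_add, hx, hy, add_zero]
      | smul c x _ hx => rw [map_smul, hx, smul_zero]
    have h7 : ∀ L : ℝ →L[ℝ] E s, HasFDerivWithinAt (f ∘ γ) L (Set.Icc 0 1) τ → L 1 = 0 →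
        HasFDerivWithinAt (f ∘ γ) (0 : ℝ →L[ℝ] E s) (Set.Icc 0 1) τ := by
      intro L hL hL1
      have : L = 0 := ContinuousLinearMap.ext_ring hL1
      rwa [this] at hL
    exact h7 _ h5 (h6 _ h2)
  intro τ hτ
  have h1 : Set.EqOn (fderivWithin ℝ (f ∘ γ) (Set.Icc 0 1)) 0 (Set.Icc 0 1) := fun σ hσ =>
    (hder σ hσ).fderivWithin (uniqueDiffOn_Icc zero_lt_one σ hσ)
  exact (convex_Icc (0 : ℝ) 1).is_const_of_fderivWithin_eq_zero (𝕜 := ℝ)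
    (fun σ hσ => (hder σ hσ).differentiableWithinAt) h1 hτ (Set.left_mem_Icc.2 zero_le_one)

end Curves

/-! ### Extension of local homomorphisms. -/

section LocalHom

variable {W A : Type*} [NormedAddCommGroup W] [NormedSpace ℝ W] [Monoid A] {ε : ℝ}

omit [NormedSpace ℝ W] in
lemma exists_nat_norm_smul_lt (hε : 0 < ε) (w : W) :
    ∃ N : ℕ, 0 < N ∧ ‖w‖ < N * ε := by
  obtain ⟨N, hN⟩ := exists_nat_gt (‖w‖ / ε)
  refine ⟨N, ?_, (div_lt_iff₀ hε).1 hN⟩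
  have : (0 : ℝ) < N := lt_of_le_of_lt (by positivity) hN
  exact_mod_cast this

lemma norm_inv_smul_lt {w : W} {N : ℕ} (hN : 0 < N) (hw : ‖w‖ < N * ε) :
    ‖(N : ℝ)⁻¹ • w‖ < ε := by
  have hN' : (0 : ℝ) < N := by exact_mod_cast hN
  rw [norm_smul, norm_inv, Real.norm_natCast, inv_mul_lt_iff₀ hN']
  exact hw

/-- Every `w` is an `N`-fold sum of `w / N`, which is small for large `N`. This carries properties
of the action from small to all times. -/
lemma induction_of_small (hε : 0 < ε) {Q : W → Prop} (hsmall : ∀ w, ‖w‖ < ε → Q w)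
    (hadd : ∀ v w, Q v → Q w → Q (v + w)) (w : W) : Q w := by
  obtain ⟨N, hN, hw⟩ := exists_nat_norm_smul_lt hε w
  have h1 : ∀ n : ℕ, Q (n • ((N : ℝ)⁻¹ • w)) := by
    intro n
    induction n with
    | zero => rw [zero_smul]; exact hsmall 0 (by simpa using hε)
    | succ n ih =>
      rw [succ_nsmul]
      exact hadd _ _ ih (hsmall _ (norm_inv_smul_lt hN hw))
  have h2 := h1 N
  rwa [← Nat.cast_smul_eq_nsmul ℝ, smul_smul, mul_inv_cancel₀ (by positivity), one_smul] at h2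

/-- A local homomorphism from a normed space to a monoid extends to a homomorphism. -/
lemma exists_hom_extending (hε : 0 < ε) {σ : W → A} (h0 : σ 0 = 1)
    (hadd : ∀ v w, ‖v‖ + ‖w‖ < ε → σ (v + w) = σ v * σ w) :
    ∃ Φ : W → A, (∀ v w, Φ (v + w) = Φ v * Φ w) ∧ ∀ w, ‖w‖ < ε → Φ w = σ w := by
  have hpow : ∀ (n : ℕ) (w : W), n * ‖w‖ < ε → σ ((n : ℝ) • w) = σ w ^ n := by
    intro n w
    induction n with
    | zero => intro _; simp [h0]
    | succ n ih =>
      intro h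
      push_cast at h
      have h' : n * ‖w‖ < ε := by nlinarith [norm_nonneg w]
      rw [pow_succ, ← ih h', ← hadd]
      · congr 1
        push_cast
        rw [add_smul, one_smul]
      · rw [norm_smul, Real.norm_natCast]
        linarith
  -- Refining the subdivision from `N` to `N * K` pieces does not change the value; two subdivisions
  -- are compared through their product.
  have hind : ∀ (w : W) (N K : ℕ), 0 < N → 0 < K → ‖w‖ < N * ε →
      σ ((N : ℝ)⁻¹ • w) ^ N = σ (((N * K : ℕ) : ℝ)⁻¹ • w) ^ (N * K) := by
    intro w N K hN hK hw
    have hN' : (0 : ℝ) < N := by exact_mod_cast hN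
    have hK' : (0 : ℝ) < K := by exact_mod_cast hK
    have h1 : (N : ℝ)⁻¹ • w = (K : ℝ) • (((N * K : ℕ) : ℝ)⁻¹ • w) := by
      rw [smul_smul]
      congr 1
      push_cast
      field_simp
    have h2 : K * ‖((N * K : ℕ) : ℝ)⁻¹ • w‖ < ε := by
      have := norm_inv_smul_lt hN hw
      rwa [h1, norm_smul, Real.norm_natCast] at this
    rw [h1, hpow K _ h2, ← pow_mul, mul_comm K N]
  choose N hN hNw using fun w : W => exists_nat_norm_smul_lt hε w
  let Φ : W → A := fun w => σ ((N w : ℝ)⁻¹ • w) ^ N w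
  have hΦ : ∀ (w : W) (K : ℕ), 0 < K → ‖w‖ < K * ε → Φ w = σ ((K : ℝ)⁻¹ • w) ^ K := by
    intro w K hK hw
    rw [hind w K (N w) hK (hN w) hw, mul_comm K]
    exact hind w (N w) K (hN w) hK (hNw w)
  refine ⟨Φ, ?_, ?_⟩
  · intro v w
    obtain ⟨K, hK, hKw⟩ := exists_nat_norm_smul_lt (W := ℝ) hε (‖v‖ + ‖w‖)
    rw [Real.norm_of_nonneg (by positivity)] at hKw
    have hv := norm_nonneg v
    have hw := norm_nonneg w
    rw [hΦ v K hK (by linarith), hΦ w K hK (by linarith),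
      hΦ (v + w) K hK ((norm_add_le v w).trans_lt hKw), smul_add]
    have hs : ‖(K : ℝ)⁻¹ • v‖ + ‖(K : ℝ)⁻¹ • w‖ < ε := by
      have hK' : (0 : ℝ) < K := by exact_mod_cast hK
      rw [norm_smul, norm_smul, ← mul_add, norm_inv, Real.norm_natCast, inv_mul_lt_iff₀ hK']
      exact hKw
    -- The monoid is not assumed commutative, but small values commute since `v + w = w + v`.
    have hc : Commute (σ ((K : ℝ)⁻¹ • v)) (σ ((K : ℝ)⁻¹ • w)) := by
      rw [Commute, SemiconjBy, ← hadd _ _ hs, ← hadd _ _ (by linarith), add_comm]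
    rw [hadd _ _ hs, hc.mul_pow]
  · intro w hw
    rw [hΦ w 1 one_pos (by simpa using hw)]
    simp

end LocalHom

/-! ### Neighbourhoods of a compact leaf saturated for curves in level sets. -/

section Tube

variable {M Y : Type*} [TopologicalSpace M] [T2Space M] [LocallyCompactSpace M]
  [TopologicalSpace Y] [T2Space Y]

/-- A compact isolated piece of a level set has a neighbourhood which is not left by curves
contained in the level sets. -/
lemma exists_tube {f : M → Y} {L O : Set M} {b : Y} (hL : IsCompact L) (hO : IsOpen O)
    (hLO : L ⊆ O) (hf : ContinuousOn f O) (hLb : ∀ q ∈ L, f q = b)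
    (hiso : ∀ q ∈ O, f q = b → q ∈ L) :
    ∃ V : Set M, IsOpen V ∧ L ⊆ V ∧ V ⊆ O ∧ ∀ γ : ℝ → M, ContinuousOn γ (Set.Icc 0 1) →
      γ 0 ∈ V → (∀ τ ∈ Set.Icc (0 : ℝ) 1, f (γ τ) = f (γ 0)) →
      ∀ τ ∈ Set.Icc (0 : ℝ) 1, γ τ ∈ V := by
  obtain ⟨W, hW, hLW, hWO, hWc⟩ := exists_open_between_and_isCompact_closure hL hO hLO
  have hWO' : W ⊆ O := subset_closure.trans hWO
  have hfrO : frontier W ⊆ O := frontier_subset_closure.trans hWO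
  have hK : IsCompact (f '' frontier W) :=
    (hWc.of_isClosed_subset isClosed_frontier frontier_subset_closure).image_of_continuousOn
      (hf.mono hfrO)
  -- Discard from `W` the levels which meet its frontier. The level `b` is not discarded near `L`,
  -- since in `O` it consists of `L`, which is away from the frontier; a curve in a remaining level
  -- cannot cross the frontier.
  refine ⟨W ∩ f ⁻¹' (f '' frontier W)ᶜ, (hf.mono hWO').isOpen_inter_preimage hW
    hK.isClosed.isOpen_compl, ?_, fun q hq => hWO' hq.1, ?_⟩
  · intro q hq
    refine ⟨hLW hq, ?_⟩
    rintro ⟨q', hq', h⟩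
    have h1 : q' ∈ L := hiso q' (hfrO hq') (h.trans (hLb q hq))
    exact hq'.2 (by rw [hW.interior_eq]; exact hLW h1)
  · intro γ hγ h0 hfγ
    have hpre : IsPreconnected (γ '' Set.Icc 0 1) := isPreconnected_Icc.image γ hγ
    have hsub : γ '' Set.Icc 0 1 ⊆ W := by
      refine hpre.subset_left_of_subset_union hW isClosed_closure.isOpen_compl
        (disjoint_compl_right.mono_left subset_closure) ?_ ?_
      · rintro _ ⟨τ, hτ, rfl⟩
        by_contra hcon
        simp only [Set.mem_union, Set.mem_compl_iff, not_or, not_not] at hcon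
        have hfr : γ τ ∈ frontier W := ⟨hcon.2, by rw [hW.interior_eq]; exact hcon.1⟩
        exact h0.2 ⟨γ τ, hfr, hfγ τ hτ⟩
      · exact ⟨γ 0, ⟨0, Set.left_mem_Icc.2 zero_le_one, rfl⟩, h0.1⟩
    intro τ hτ
    refine ⟨hsub ⟨τ, hτ, rfl⟩, ?_⟩
    rw [Set.mem_preimage, hfγ τ hτ]
    exact h0.2

end Tube

/-! ### The action of `ℝʳ` generated by the commuting fields. -/

section Action

variable {d r s : ℕ} {M : Type*} [TopologicalSpace M] [ChartedSpace (E d) M]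

/-- There are flow boxes around all points of `R`. -/
def HasFlowBoxes (f : M → E s) (X : Fin r → Π q : M, TangentSpace (𝓡 d) q) (R : Set M) : Prop :=
  ∀ p ∈ R, ∃ β : OpenPartialHomeomorph M (E r × E s), IsFlowBox f X β ∧ p ∈ β.source ∧
    β.source ⊆ R

/-- Around `q` there is a flow box in which steps of size `ε` are possible from all points
near `q`. -/
def HasStep (f : M → E s) (X : Fin r → Π q : M, TangentSpace (𝓡 d) q) (R : Set M) (ε : ℝ)
    (q : M) : Prop :=
  ∃ β : OpenPartialHomeomorph M (E r × E s), IsFlowBox f X β ∧ β.source ⊆ R ∧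
    ∀ᶠ q' in 𝓝 q, q' ∈ β.source ∧ ∀ w : E r, ‖w‖ < ε → β q' + horizontal w ∈ β.target

open Classical in
/-- The flow of the commuting vector fields `X_i`, for small times. -/
noncomputable def stepMap (f : M → E s) (X : Fin r → Π q : M, TangentSpace (𝓡 d) q) (R : Set M)
    (ε : ℝ) (w : E r) (q : M) : M :=
  if h : HasStep f X R ε q then h.choose.symm (h.choose q + horizontal w) else q

/-- An action of `ℝʳ` on the open set `V`, generated by the vector fields `X_i`. -/
structure IsTubeAction (f : M → E s) (X : Fin r → Π q : M, TangentSpace (𝓡 d) q) (R V : Set M)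
    (Ψ : E r → M → M) : Prop where
  isOpen : IsOpen V
  subset : V ⊆ R
  curve : ∀ γ : ℝ → M, ContinuousOn γ (Set.Icc 0 1) → γ 0 ∈ V →
    (∀ τ ∈ Set.Icc (0 : ℝ) 1, f (γ τ) = f (γ 0)) → ∀ τ ∈ Set.Icc (0 : ℝ) 1, γ τ ∈ V
  maps : ∀ q ∈ V, ∀ w, Ψ w q ∈ V
  zero : ∀ q ∈ V, Ψ 0 q = q
  add : ∀ q ∈ V, ∀ v w, Ψ (v + w) q = Ψ v (Ψ w q)
  map_eq : ∀ q ∈ V, ∀ w, f (Ψ w q) = f q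
  smooth : ∀ w, ContMDiffOn (𝓡 d) (𝓡 d) ∞ (Ψ w) V
  local_eq : ∀ β : OpenPartialHomeomorph M (E r × E s), IsFlowBox f X β → ∀ q ∈ V, q ∈ β.source →
    ∀ᶠ x : E r × M in 𝓝 (0, q), β x.2 + horizontal x.1 ∈ β.target ∧
      Ψ x.1 x.2 = β.symm (β x.2 + horizontal x.1)
  joined : ∀ q ∈ V, ∀ w, Relation.ReflTransGen (TangentJoined X R) q (Ψ w q)

variable {f : M → E s} {X : Fin r → Π q : M, TangentSpace (𝓡 d) q} {R : Set M}

lemma HasStep.mono {ε ε' : ℝ} (h : ε ≤ ε') {q : M} (hq : HasStep f X R ε' q) :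
    HasStep f X R ε q := by
  obtain ⟨β, hβ, hR, hev⟩ := hq
  exact ⟨β, hβ, hR, hev.mono fun q' h' => ⟨h'.1, fun w hw => h'.2 w (hw.trans_le h)⟩⟩

lemma isOpen_hasStep (ε : ℝ) : IsOpen {q | HasStep f X R ε q} := by
  rw [isOpen_iff_mem_nhds]
  rintro q ⟨β, hβ, hR, hev⟩
  filter_upwards [hev.eventually_nhds] with q' hq'
  exact ⟨β, hβ, hR, hq'⟩

lemma HasFlowBoxes.exists_hasStep (h : HasFlowBoxes f X R) {p : M} (hp : p ∈ R) :
    ∃ ε > 0, HasStep f X R ε p := by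
  obtain ⟨β, hβ, hpβ, hR⟩ := h p hp
  obtain ⟨ρ, hρ, hball⟩ := Metric.isOpen_iff.1 β.open_target _ (β.map_source hpβ)
  refine ⟨ρ / 2, by positivity, β, hβ, hR, ?_⟩
  filter_upwards [β.open_source.mem_nhds hpβ,
    (β.continuousAt hpβ).eventually (Metric.ball_mem_nhds _ (half_pos hρ))] with q' h1 h2
  refine ⟨h1, fun w hw => hball ?_⟩
  rw [Metric.mem_ball, dist_eq_norm]
  rw [dist_eq_norm] at h2
  calc ‖β q' + horizontal w - β p‖ = ‖(β q' - β p) + horizontal w‖ := by congr 1; abel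
    _ ≤ ‖β q' - β p‖ + ‖(horizontal w : E r × E s)‖ := norm_add_le _ _
    _ < ρ := by rw [norm_horizontal]; linarith

lemma HasFlowBoxes.exists_hasStep_of_isCompact (h : HasFlowBoxes f X R) {L : Set M}
    (hL : IsCompact L) (hLR : L ⊆ R) : ∃ ε > 0, ∀ q ∈ L, HasStep f X R ε q := by
  refine hL.induction_on (p := fun K => ∃ ε > 0, ∀ q ∈ K, HasStep f X R ε q)
    ⟨1, one_pos, by simp⟩ ?_ ?_ ?_
  · rintro K K' hK ⟨ε, hε, h'⟩
    exact ⟨ε, hε, fun q hq => h' q (hK hq)⟩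
  · rintro K K' ⟨ε, hε, h1⟩ ⟨ε', hε', h2⟩
    refine ⟨min ε ε', lt_min hε hε', ?_⟩
    rintro q (hq | hq)
    exacts [(h1 q hq).mono (min_le_left _ _), (h2 q hq).mono (min_le_right _ _)]
  · intro p hp
    obtain ⟨ε, hε, h1⟩ := h.exists_hasStep (hLR hp)
    exact ⟨_, nhdsWithin_le_nhds ((isOpen_hasStep ε).mem_nhds h1), ε, hε, fun q hq => hq⟩

lemma smul_mem_of_norm_lt {ε : ℝ} {w : E r} (hw : ‖w‖ < ε) {τ : ℝ} (hτ : τ ∈ Set.Icc (0 : ℝ) 1) :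
    ‖τ • w‖ < ε := by
  rw [norm_smul, Real.norm_of_nonneg hτ.1]
  exact (mul_le_of_le_one_left (norm_nonneg _) hτ.2).trans_lt hw

variable [T2Space M]

/-- The box chosen in `stepMap` is immaterial, by `symm_line_eq`. -/
lemma stepMap_eq {β : OpenPartialHomeomorph M (E r × E s)} (hβ : IsFlowBox f X β) {q : M}
    {ε : ℝ} {w : E r} (hw : ‖w‖ < ε) (hs : HasStep f X R ε q) (hq : q ∈ β.source)
    (hline : ∀ τ ∈ Set.Icc (0 : ℝ) 1, β q + τ • horizontal w ∈ β.target) :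
    stepMap f X R ε w q = β.symm (β q + horizontal w) := by
  obtain ⟨h1, -, h2⟩ := hs.choose_spec
  have h3 := h2.self_of_nhds
  rw [stepMap, dif_pos hs]
  refine h1.symm_line_eq hβ h3.1 hq (fun τ hτ => ?_) hline
  rw [← horizontal_smul]
  exact h3.2 _ (smul_mem_of_norm_lt hw hτ)

lemma HasStep.exists_flowBox {ε : ℝ} {q : M} (hs : HasStep f X R ε q) :
    ∃ β : OpenPartialHomeomorph M (E r × E s), IsFlowBox f X β ∧ β.source ⊆ R ∧
      q ∈ β.source ∧ (∀ w : E r, ‖w‖ < ε → β q + horizontal w ∈ β.target) ∧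
      ∀ᶠ q' in 𝓝 q, ∀ w : E r, ‖w‖ < ε →
        q' ∈ β.source ∧ β q' + horizontal w ∈ β.target ∧
          stepMap f X R ε w q' = β.symm (β q' + horizontal w) := by
  obtain ⟨β, hβ, hR, hev⟩ := id hs
  refine ⟨β, hβ, hR, hev.self_of_nhds.1, hev.self_of_nhds.2, ?_⟩
  filter_upwards [hev, (isOpen_hasStep ε).mem_nhds hs] with q' h1 h2 w hw
  refine ⟨h1.1, h1.2 w hw, stepMap_eq hβ hw h2 h1.1 fun τ hτ => ?_⟩
  rw [← horizontal_smul]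
  exact h1.2 _ (smul_mem_of_norm_lt hw hτ)

section Step

variable {V : Set M} {ε : ℝ}

lemma stepMap_zero (hε : 0 < ε) {q : M} (hs : HasStep f X R ε q) :
    stepMap f X R ε 0 q = q := by
  obtain ⟨β, hβ, hR, hq, -, hev⟩ := hs.exists_flowBox
  rw [(hev.self_of_nhds 0 (by simpa using hε)).2.2, horizontal_zero, add_zero, β.left_inv hq]

lemma apply_stepMap {q : M} (hs : HasStep f X R ε q) {w : E r} (hw : ‖w‖ < ε) :
    f (stepMap f X R ε w q) = f q := by
  obtain ⟨β, hβ, hR, hq, -, hev⟩ := hs.exists_flowBox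
  obtain ⟨-, h1, h2⟩ := hev.self_of_nhds w hw
  rw [h2, hβ.snd_symm h1, ← hβ.snd_eq q hq]
  simp [horizontal]

lemma tangentJoined_stepMap {q : M} (hs : HasStep f X R ε q) {w : E r} (hw : ‖w‖ < ε) :
    TangentJoined X R q (stepMap f X R ε w q) := by
  obtain ⟨β, hβ, hR, hq, hall, hev⟩ := hs.exists_flowBox
  rw [(hev.self_of_nhds w hw).2.2]
  refine hβ.tangentJoined hR hq fun τ hτ => ?_
  rw [← horizontal_smul]
  exact hall _ (smul_mem_of_norm_lt hw hτ)

lemma contMDiffAt_stepMap {q : M} (hs : HasStep f X R ε q) {w : E r} (hw : ‖w‖ < ε) :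
    ContMDiffAt (𝓡 d) (𝓡 d) ∞ (stepMap f X R ε w) q := by
  obtain ⟨β, hβ, hR, hq, hall, hev⟩ := hs.exists_flowBox
  have h1 : ContMDiffAt 𝓘(ℝ, E r × E s) 𝓘(ℝ, E r × E s) ∞ (fun y => y + horizontal w) (β q) := by
    rw [contMDiffAt_iff_contDiffAt]; fun_prop
  have h2 : ContMDiffAt (𝓡 d) (𝓡 d) ∞ (fun q' => β.symm (β q' + horizontal w)) q :=
    (hβ.contMDiffAt_symm (hall w hw)).comp q (h1.comp q (hβ.contMDiffAt hq))
  refine h2.congr_of_eventuallyEq ?_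
  filter_upwards [hev] with q' hq' using (hq' w hw).2.2

lemma stepMap_mem
    (hcurve : ∀ γ : ℝ → M, ContinuousOn γ (Set.Icc 0 1) → γ 0 ∈ V →
      (∀ τ ∈ Set.Icc (0 : ℝ) 1, f (γ τ) = f (γ 0)) → ∀ τ ∈ Set.Icc (0 : ℝ) 1, γ τ ∈ V)
    {q : M} (hqV : q ∈ V) (hs : HasStep f X R ε q) {w : E r} (hw : ‖w‖ < ε) :
    stepMap f X R ε w q ∈ V := by
  obtain ⟨β, hβ, hR, hq, hall, hev⟩ := hs.exists_flowBox
  rw [(hev.self_of_nhds w hw).2.2]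
  have hline : ∀ τ ∈ Set.Icc (0 : ℝ) 1, β q + τ • horizontal w ∈ β.target := fun τ hτ => by
    rw [← horizontal_smul]
    exact hall _ (smul_mem_of_norm_lt hw hτ)
  have := hcurve (fun τ => β.symm (β q + τ • horizontal w))
    (β.symm.continuousOn.comp (by fun_prop) hline) (by simpa [β.left_inv hq] using hqV) ?_ 1
    (Set.right_mem_Icc.2 zero_le_one)
  · simpa using this
  · intro τ hτ
    rw [hβ.snd_symm (hline τ hτ), hβ.snd_symm (hline 0 (Set.left_mem_Icc.2 zero_le_one))]
    simp [horizontal]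

/-- All three steps can be computed in one box around `q`, where they are translations; the bound on
`‖v‖ + ‖w‖` keeps the broken line inside that box. -/
lemma stepMap_add {q : M} {v w : E r} (hvw : ‖v‖ + ‖w‖ < ε) (hs : HasStep f X R ε q)
    (hs' : HasStep f X R ε (stepMap f X R ε w q)) :
    stepMap f X R ε (v + w) q = stepMap f X R ε v (stepMap f X R ε w q) := by
  obtain ⟨β, hβ, hR, hq, hall, hev⟩ := hs.exists_flowBox
  have hv := norm_nonneg v
  have hw := norm_nonneg w
  obtain ⟨-, h1, h2⟩ := hev.self_of_nhds w (by linarith)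
  have h3 : stepMap f X R ε w q ∈ β.source := by rw [h2]; exact β.map_target h1
  have h4 : β (stepMap f X R ε w q) = β q + horizontal w := by rw [h2, β.right_inv h1]
  rw [(hev.self_of_nhds (v + w) ((norm_add_le v w).trans_lt hvw)).2.2,
    stepMap_eq hβ (by linarith) hs' h3, h4, horizontal_add]
  · congr 1; abel
  · intro τ hτ
    rw [h4, add_assoc, ← horizontal_smul, ← horizontal_add]
    refine hall _ ((norm_add_le _ _).trans_lt ?_)
    have : ‖τ • v‖ ≤ ‖v‖ := by
      rw [norm_smul, Real.norm_of_nonneg hτ.1]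
      exact mul_le_of_le_one_left (norm_nonneg _) hτ.2
    linarith

lemma stepMap_local_eq (hε : 0 < ε) {β : OpenPartialHomeomorph M (E r × E s)}
    (hβ : IsFlowBox f X β) {q : M} (hs : HasStep f X R ε q) (hq : q ∈ β.source) :
    ∀ᶠ x : E r × M in 𝓝 (0, q), β x.2 + horizontal x.1 ∈ β.target ∧
      stepMap f X R ε x.1 x.2 = β.symm (β x.2 + horizontal x.1) := by
  obtain ⟨ρ, hρ, hball⟩ := Metric.isOpen_iff.1 β.open_target _ (β.map_source hq)
  have h1 : ∀ᶠ w : E r in 𝓝 0, ‖w‖ < min ε (ρ / 2) := by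
    have := Metric.ball_mem_nhds (0 : E r) (lt_min hε (half_pos hρ))
    filter_upwards [this] with w hw
    simpa using hw
  have h2 : ∀ᶠ q' in 𝓝 q, HasStep f X R ε q' ∧ q' ∈ β.source ∧
      β q' ∈ Metric.ball (β q) (ρ / 2) := by
    filter_upwards [(isOpen_hasStep ε).mem_nhds hs, β.open_source.mem_nhds hq,
      (β.continuousAt hq).preimage_mem_nhds (Metric.ball_mem_nhds _ (half_pos hρ))] with q' h h' h''
    exact ⟨h, h', h''⟩
  rw [nhds_prod_eq]
  filter_upwards [h1.prod_mk h2] with x hx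
  obtain ⟨hx1, hx2, hx3, hx4⟩ := hx
  have hline : ∀ τ ∈ Set.Icc (0 : ℝ) 1, β x.2 + τ • horizontal x.1 ∈ β.target := by
    intro τ hτ
    refine hball ?_
    have h5 := smul_mem_of_norm_lt hx1 hτ
    rw [Metric.mem_ball, dist_eq_norm] at hx4 ⊢
    rw [← horizontal_smul]
    calc ‖β x.2 + horizontal (τ • x.1) - β q‖
        = ‖(β x.2 - β q) + horizontal (τ • x.1)‖ := by congr 1; abel
      _ ≤ ‖β x.2 - β q‖ + ‖(horizontal (τ • x.1) : E r × E s)‖ := norm_add_le _ _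
      _ < ρ := by rw [norm_horizontal]; linarith [min_le_right ε (ρ / 2)]
  refine ⟨by simpa using hline 1 (Set.right_mem_Icc.2 zero_le_one), ?_⟩
  exact stepMap_eq hβ (hx1.trans_le (min_le_left _ _)) hx2 hx3 hline

open Classical in
-- By `hcurve` small steps preserve `V`, so they form a local homomorphism from `E r` to the monoid
-- `Function.End V`, which `exists_hom_extending` turns into an action. The same step size `ε` at
-- all points of `V` is what makes this possible.
lemma exists_isTubeAction_of_step (hε : 0 < ε) (hV : IsOpen V) (hVR : V ⊆ R)
    (hs : ∀ q ∈ V, HasStep f X R ε q)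
    (hcurve : ∀ γ : ℝ → M, ContinuousOn γ (Set.Icc 0 1) → γ 0 ∈ V →
      (∀ τ ∈ Set.Icc (0 : ℝ) 1, f (γ τ) = f (γ 0)) → ∀ τ ∈ Set.Icc (0 : ℝ) 1, γ τ ∈ V) :
    ∃ Ψ : E r → M → M, IsTubeAction f X R V Ψ := by
  -- The value `q` for large `w` is a dummy: only `‖w‖ < ε` enters the local homomorphism.
  let σ : E r → Function.End V := fun w q =>
    if hw : ‖w‖ < ε then ⟨stepMap f X R ε w q, stepMap_mem hcurve q.2 (hs q q.2) hw⟩ else q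
  have hσ : ∀ w (q : V), ‖w‖ < ε → (σ w q : M) = stepMap f X R ε w q := by
    intro w q hw
    simp only [σ, dif_pos hw]
  obtain ⟨Φ, hΦadd, hΦσ⟩ := exists_hom_extending (σ := σ) hε
    (by
      funext q
      refine Subtype.ext ?_
      rw [hσ 0 q (by simpa using hε)]
      exact stepMap_zero hε (hs q q.2))
    (by
      intro v w hvw
      have hv := norm_nonneg v
      have hw := norm_nonneg w
      funext q
      refine Subtype.ext ?_
      change (σ (v + w) q : M) = (σ v (σ w q) : M)
      rw [hσ _ _ ((norm_add_le v w).trans_lt hvw), hσ _ _ (by linarith), hσ _ _ (by linarith)]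
      exact stepMap_add hvw (hs q q.2) (hs _ (stepMap_mem hcurve q.2 (hs q q.2) (by linarith))))
  let Ψ : E r → M → M := fun w q => if hq : q ∈ V then Φ w ⟨q, hq⟩ else q
  have hΨ : ∀ w (q : V), Ψ w q = Φ w q := by
    intro w q
    simp only [Ψ, dif_pos q.2]
  have hΨs : ∀ w, ‖w‖ < ε → ∀ q ∈ V, Ψ w q = stepMap f X R ε w q := by
    intro w hw q hq
    rw [hΨ w ⟨q, hq⟩, hΦσ w hw, hσ w _ hw]
  have hmaps : ∀ q ∈ V, ∀ w, Ψ w q ∈ V := by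
    intro q hq w
    rw [hΨ w ⟨q, hq⟩]
    exact Subtype.coe_prop _
  have hadd : ∀ q ∈ V, ∀ v w, Ψ (v + w) q = Ψ v (Ψ w q) := by
    intro q hq v w
    rw [hΨ _ ⟨q, hq⟩, hΨ w ⟨q, hq⟩, hΨ, hΦadd]
    rfl
  refine ⟨Ψ, hV, hVR, hcurve, hmaps, ?_, hadd, ?_, ?_, ?_, ?_⟩
  · intro q hq
    rw [hΨs 0 (by simpa using hε) q hq]
    exact stepMap_zero hε (hs q hq)
  · intro q hq w
    revert q
    refine induction_of_small hε (Q := fun w => ∀ q ∈ V, f (Ψ w q) = f q) ?_ ?_ w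
    · intro w hw q hq
      rw [hΨs w hw q hq]
      exact apply_stepMap (hs q hq) hw
    · intro v w hv hw q hq
      rw [hadd q hq, hv _ (hmaps q hq w), hw q hq]
  · refine induction_of_small hε ?_ ?_
    · intro w hw
      refine ContMDiffOn.congr (f := stepMap f X R ε w) ?_ (hΨs w hw)
      exact fun q hq => (contMDiffAt_stepMap (hs q hq) hw).contMDiffWithinAt
    · intro v w hv hw
      exact (hv.comp hw fun q hq => hmaps q hq w).congr fun q hq => hadd q hq v w
  · intro β hβ q hqV hq
    have h1 : ∀ᶠ w : E r in 𝓝 0, ‖w‖ < ε := by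
      filter_upwards [Metric.ball_mem_nhds (0 : E r) hε] with w hw
      simpa using hw
    have h2 := h1.prod_mk (hV.mem_nhds hqV : ∀ᶠ q' in 𝓝 q, q' ∈ V)
    rw [← nhds_prod_eq] at h2
    filter_upwards [stepMap_local_eq hε hβ (hs q hqV) hq, h2] with x hx hx'
    refine ⟨hx.1, ?_⟩
    rw [hΨs x.1 hx'.1 x.2 hx'.2]
    exact hx.2
  · intro q hq w
    revert q
    refine induction_of_small hε
      (Q := fun w => ∀ q ∈ V, Relation.ReflTransGen (TangentJoined X R) q (Ψ w q)) ?_ ?_ w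
    · intro w hw q hq
      rw [hΨs w hw q hq]
      exact Relation.ReflTransGen.single (tangentJoined_stepMap (hs q hq) hw)
    · intro v w hv hw q hq
      rw [hadd q hq]
      exact (hw q hq).trans (hv _ (hmaps q hq w))

end Step

end Action

/-! ### The torus as a quotient of `ℝʳ`. -/

section Torus

variable {r : ℕ} {EN HN N : Type*} [NormedAddCommGroup EN] [NormedSpace ℝ EN]
  [TopologicalSpace HN] {J : ModelWithCorners ℝ EN HN} [TopologicalSpace N] [ChartedSpace HN N]

/-- The model with corners of the torus. -/
noncomputable abbrev torusFactorModel (r : ℕ) := ModelWithCorners.pi (fun _ : Fin r => 𝓡 1)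

lemma contMDiffAt_torus_iff {g : N → Torus r} {x : N} :
    ContMDiffAt J (torusFactorModel r) ∞ g x ↔
      ∀ i, ContMDiffAt J (𝓡 1) ∞ (fun y => g y i) x := by
  simp only [contMDiffAt_iff, continuousAt_pi, forall_and]
  refine and_congr Iff.rfl ?_
  exact contDiffWithinAt_pi (𝕜 := ℝ)

lemma contMDiff_torus_proj (i : Fin r) :
    ContMDiff (torusFactorModel r) (𝓡 1) ∞ (fun z : Torus r => z i) := fun z =>
  contMDiffAt_torus_iff.1 (contMDiffAt_id (x := z)) i

/-- The universal covering of the torus. -/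
noncomputable def torusExp (c : E r) : Torus r := fun i => Circle.exp (2 * Real.pi * c i)

lemma contMDiff_torusExp : ContMDiff 𝓘(ℝ, E r) (torusFactorModel r) ∞ (torusExp (r := r)) := by
  intro c
  rw [contMDiffAt_torus_iff]
  intro i
  have h1 : ContMDiff 𝓘(ℝ, E r) 𝓘(ℝ, ℝ) ∞ fun c : E r => 2 * Real.pi * c i := by
    rw [contMDiff_iff_contDiff]
    fun_prop
  exact (contMDiff_circleExp.comp h1) c

lemma torusExp_eq_iff {c c' : E r} :
    torusExp c = torusExp c' ↔ ∃ k : Fin r → ℤ, ∀ i, c i = c' i + k i := by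
  have hpi : (2 * Real.pi) ≠ 0 := by positivity
  have h1 : ∀ (x y : ℝ), Circle.exp (2 * Real.pi * x) = Circle.exp (2 * Real.pi * y) ↔
      ∃ m : ℤ, x = y + m := by
    intro x y
    rw [Circle.exp_eq_exp]
    refine exists_congr fun m => ?_
    rw [mul_comm (m : ℝ), ← mul_add]
    exact mul_right_inj' hpi
  rw [funext_iff, ← Classical.skolem (p := fun i (k : ℤ) => c i = c' i + k)]
  exact forall_congr' fun i => h1 _ _

attribute [local instance] finrank_real_complex_fact'

/-- Rotating `z` to `1` moves the cut of the argument away from `z`. The section is a right inverse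
everywhere, so only its smoothness is local. -/
lemma exists_circle_arg (z : Circle) : ∃ a : Circle → ℝ,
    (∀ w, Circle.exp (2 * Real.pi * a w) = w) ∧
      ∃ N : Set Circle, IsOpen N ∧ z ∈ N ∧ ContMDiffOn (𝓡 1) 𝓘(ℝ, ℝ) ∞ a N := by
  have hpi : (2 * Real.pi) ≠ 0 := by positivity
  refine ⟨fun w => ((z⁻¹ * w : Circle) : ℂ).arg / (2 * Real.pi) + (z : ℂ).arg / (2 * Real.pi),
    ?_, {w | ((z⁻¹ * w : Circle) : ℂ) ∈ Complex.slitPlane}, ?_, ?_, ?_⟩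
  · intro w
    rw [mul_add, mul_div_cancel₀ _ hpi, mul_div_cancel₀ _ hpi, Circle.exp_add, Circle.exp_arg,
      Circle.exp_arg, mul_comm, mul_inv_cancel_left]
  · exact Complex.isOpen_slitPlane.preimage (by fun_prop)
  · simp
  · intro w hw
    refine ContMDiffAt.contMDiffWithinAt ?_
    have h1 : ContMDiff (𝓡 1) (𝓡 1) ∞ fun w : Circle => z⁻¹ * w := contMDiff_mul_left
    have h2 : ContMDiff (𝓡 1) 𝓘(ℝ, ℂ) ∞ fun w : Circle => ((z⁻¹ * w : Circle) : ℂ) :=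
      contMDiff_coe_sphere.comp h1
    have h3 : ContDiffAt ℝ ∞ (fun ζ : ℂ => ζ.arg / (2 * Real.pi) + (z : ℂ).arg / (2 * Real.pi))
        ((z⁻¹ * w : Circle) : ℂ) := by
      have h4 : ContDiffAt ℝ ∞ Complex.log ((z⁻¹ * w : Circle) : ℂ) :=
        (Complex.contDiffAt_log hw).restrict_scalars ℝ
      have h5 : ContDiffAt ℝ ∞ (fun ζ : ℂ => ζ.arg) ((z⁻¹ * w : Circle) : ℂ) := by
        have := Complex.imCLM.contDiff.contDiffAt.comp _ h4
        refine this.congr_of_eventuallyEq (Filter.Eventually.of_forall fun ζ => ?_)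
        exact (Complex.log_im ζ).symm
      exact (h5.div_const _).add contDiffAt_const
    exact h3.contMDiffAt.comp w (h2 w)

lemma exists_torus_section (z : Torus r) : ∃ a : Torus r → E r, (∀ w, torusExp (a w) = w) ∧
    ∃ N : Set (Torus r), IsOpen N ∧ z ∈ N ∧
      ContMDiffOn (torusFactorModel r) 𝓘(ℝ, E r) ∞ a N := by
  choose a ha N hN hzN hs using fun i => exists_circle_arg (z i)
  refine ⟨fun w => WithLp.toLp 2 fun i => a i (w i), fun w => funext fun i => ha i (w i),
    Set.pi Set.univ N, isOpen_set_pi Set.finite_univ fun i _ => hN i, fun i _ => hzN i, ?_⟩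
  have h1 : ContMDiffOn (torusFactorModel r) 𝓘(ℝ, Fin r → ℝ) ∞
      (fun w : Torus r => fun i => a i (w i)) (Set.pi Set.univ N) := by
    rw [contMDiffOn_pi_space]
    intro i
    exact (hs i).comp (contMDiff_torus_proj i).contMDiffOn fun w hw => hw i trivial
  exact (EuclideanSpace.equiv (Fin r) ℝ).symm.contDiff.contMDiff.comp_contMDiffOn h1

end Torus

/-! ### Leaves near a compact leaf are orbits. -/

section Orbits

variable {d r s : ℕ} {M : Type*} [TopologicalSpace M] [ChartedSpace (E d) M]
  {f : M → E s} {X : Fin r → Π q : M, TangentSpace (𝓡 d) q} {R V : Set M} {Ψ : E r → M → M}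

/-- The set of points which are reached from `m` by piecewise `C¹` curves in `R` tangent to the
span of the `X_i`. -/
def tangentLeaf (X : Fin r → Π q : M, TangentSpace (𝓡 d) q) (R : Set M) (m : M) : Set M :=
  {q | Relation.ReflTransGen (TangentJoined X R) m q}

lemma HasFlowBoxes.isOpen (h : HasFlowBoxes f X R) : IsOpen R := by
  rw [isOpen_iff_mem_nhds]
  intro p hp
  obtain ⟨β, -, hpβ, hR⟩ := h p hp
  exact Filter.mem_of_superset (β.open_source.mem_nhds hpβ) hR

lemma HasFlowBoxes.contMDiffOn (h : HasFlowBoxes f X R) :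
    ContMDiffOn (𝓡 d) 𝓘(ℝ, E s) ∞ f R := by
  intro p hp
  obtain ⟨β, hβ, hpβ, hR⟩ := h p hp
  refine ContMDiffAt.contMDiffWithinAt ?_
  have h1 : ContMDiffAt (𝓡 d) 𝓘(ℝ, E s) ∞ (fun q => (β q).2) p :=
    (contDiff_snd.contMDiff (n := ∞)).contMDiffAt.comp p (hβ.contMDiffAt hpβ)
  refine h1.congr_of_eventuallyEq ?_
  filter_upwards [β.open_source.mem_nhds hpβ] with q hq using (hβ.snd_eq q hq).symm

lemma HasFlowBoxes.mfderiv_apply (h : HasFlowBoxes f X R) {q : M} (hq : q ∈ R) (i : Fin r) :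
    mfderiv (𝓡 d) 𝓘(ℝ, E s) f q (X i q) = 0 := by
  obtain ⟨β, hβ, hqβ, -⟩ := h q hq
  have h1 : f =ᶠ[𝓝 q] Prod.snd ∘ β := by
    filter_upwards [β.open_source.mem_nhds hqβ] with q hq using (hβ.snd_eq q hq).symm
  have h2 := mfderiv_comp q (I := 𝓡 d) (I' := 𝓘(ℝ, E r × E s)) (I'' := 𝓘(ℝ, E s))
    (g := (Prod.snd : E r × E s → E s)) (f := β)
    differentiableAt_snd.mdifferentiableAt (hβ.mdifferentiableAt hqβ)
  rw [h1.mfderiv_eq, h2, mfderiv_eq_fderiv, fderiv_snd]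
  exact congrArg Prod.snd (hβ.mfderiv_eq q hqβ i)

lemma HasFlowBoxes.apply_eq_of_joined (h : HasFlowBoxes f X R) {p q : M}
    (hpq : TangentJoined X R p q) : f q = f p := by
  obtain ⟨γ, h1, rfl, rfl, h4⟩ := hpq
  exact eqOn_of_tangent h.isOpen h.contMDiffOn (fun q hq => h.mfderiv_apply hq) h1 h4 1
    (Set.right_mem_Icc.2 zero_le_one)

lemma HasFlowBoxes.apply_eq_of_mem_tangentLeaf (h : HasFlowBoxes f X R) {m q : M}
    (hq : q ∈ tangentLeaf X R m) : f q = f m := by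
  induction hq with
  | refl => rfl
  | tail _ h1 ih => rw [h.apply_eq_of_joined h1, ih]

lemma tangentLeaf_subset {m : M} (hm : m ∈ R) : tangentLeaf X R m ⊆ R := by
  intro q hq
  induction hq with
  | refl => exact hm
  | tail _ h1 ih =>
    obtain ⟨γ, -, -, rfl, h4⟩ := h1
    exact (h4 1 (Set.right_mem_Icc.2 zero_le_one)).1

variable [T2Space M]

/-- Near a compact leaf, the vector fields `X_i` generate an action of `ℝʳ`. -/
lemma HasFlowBoxes.exists_isTubeAction (h : HasFlowBoxes f X R) {m : M} (hm : m ∈ R)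
    (hc : IsCompact (tangentLeaf X R m)) :
    ∃ (V : Set M) (Ψ : E r → M → M), IsTubeAction f X R V Ψ ∧ m ∈ V := by
  have : LocallyCompactSpace M := ChartedSpace.locallyCompactSpace (E d) M
  set L := tangentLeaf X R m with hL
  have hmL : m ∈ L := Relation.ReflTransGen.refl
  obtain ⟨ε, hε, hstep⟩ := h.exists_hasStep_of_isCompact hc (tangentLeaf_subset hm)
  -- Besides a uniform step size, `O` records that the leaf is isolated in its level: near a point
  -- of `O` the level of `m` contains only points of `L`.
  let O : Set M := {p | p ∈ R ∧ HasStep f X R ε p ∧ ∀ᶠ q in 𝓝 p, f q = f m → q ∈ L}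
  have hO : IsOpen O := by
    rw [isOpen_iff_mem_nhds]
    rintro p ⟨h1, h2, h3⟩
    filter_upwards [h.isOpen.mem_nhds h1, (isOpen_hasStep ε).mem_nhds h2,
      h3.eventually_nhds] with q h1 h2 h3 using ⟨h1, h2, h3⟩
  have hLO : L ⊆ O := by
    intro p hp
    refine ⟨tangentLeaf_subset hm hp, hstep p hp, ?_⟩
    obtain ⟨β, hβ, hpβ, hR⟩ := h p (tangentLeaf_subset hm hp)
    obtain ⟨ρ, hρ, hball⟩ := Metric.isOpen_iff.1 β.open_target _ (β.map_source hpβ)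
    filter_upwards [β.open_source.mem_nhds hpβ,
      (β.continuousAt hpβ).preimage_mem_nhds (Metric.ball_mem_nhds _ hρ)] with q hq1 hq2 hq3
    -- Equal values of `f` mean that `p` and `q` lie in one horizontal slice of the box, so a
    -- straight segment in the slice joins them.
    have h2 : β q - β p = horizontal ((β q).1 - (β p).1) := by
      refine Prod.ext rfl ?_
      change (β q).2 - (β p).2 = 0
      rw [hβ.snd_eq q hq1, hβ.snd_eq p hpβ, hq3, h.apply_eq_of_mem_tangentLeaf hp, sub_self]
    have h3 : β p + horizontal ((β q).1 - (β p).1) = β q := by rw [← h2]; abel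
    have h4 := hβ.tangentJoined hR hpβ (w := (β q).1 - (β p).1) (by
      intro τ hτ
      refine hball ?_
      rw [Set.mem_preimage, Metric.mem_ball, dist_eq_norm, h2, norm_horizontal] at hq2
      rw [Metric.mem_ball, dist_eq_norm, add_sub_cancel_left, ← horizontal_smul, norm_horizontal]
      exact smul_mem_of_norm_lt hq2 hτ)
    rw [h3, β.left_inv hq1] at h4
    exact Relation.ReflTransGen.tail hp h4
  obtain ⟨V, hV, hLV, hVO, hcurve⟩ := exists_tube hc hO hLO
    (h.contMDiffOn.continuousOn.mono fun p hp => hp.1)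
    (fun q hq => h.apply_eq_of_mem_tangentLeaf hq) (fun q hq => hq.2.2.self_of_nhds)
  obtain ⟨Ψ, hΨ⟩ := exists_isTubeAction_of_step hε hV (fun p hp => (hVO hp).1)
    (fun p hp => (hVO hp).2.1) hcurve
  exact ⟨V, Ψ, hΨ, hLV hmL⟩

namespace IsTubeAction

variable (hΨ : IsTubeAction f X R V Ψ)
include hΨ

omit [T2Space M] in
lemma neg_apply {q : M} (hq : q ∈ V) (w : E r) : Ψ (-w) (Ψ w q) = q := by
  rw [← hΨ.add q hq, neg_add_cancel, hΨ.zero q hq]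

omit [T2Space M] in
/-- Near a point `q`, the points with the same value of `f` are in the orbit of `q`. -/
lemma eventually_mem_orbit (h : HasFlowBoxes f X R) {q : M} (hq : q ∈ V) :
    ∀ᶠ q' in 𝓝 q, f q' = f q → ∃ w, q' = Ψ w q := by
  obtain ⟨β, hβ, hqβ, -⟩ := h q (hΨ.subset hq)
  have h1 := hΨ.local_eq β hβ q hq hqβ
  have h2 : Filter.Tendsto (fun q' => ((β q').1 - (β q).1, q)) (𝓝 q) (𝓝 (0, q)) := by
    refine Filter.Tendsto.prodMk_nhds ?_ tendsto_const_nhds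
    have h3 := (continuous_fst.continuousAt.comp (β.continuousAt hqβ)).sub_const (β q).1
    simpa [ContinuousAt] using h3
  filter_upwards [h2.eventually h1, β.open_source.mem_nhds hqβ] with q' h3 h4 h5
  refine ⟨(β q').1 - (β q).1, ?_⟩
  have h6 : β q + horizontal ((β q').1 - (β q).1) = β q' := by
    refine Prod.ext (by simp [horizontal]) ?_
    change (β q).2 + 0 = (β q').2
    rw [add_zero, hβ.snd_eq q hqβ, hβ.snd_eq q' h4, h5]
  rw [h3.2]
  change q' = β.symm (β q + horizontal ((β q').1 - (β q).1))
  rw [h6, β.left_inv h4]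

omit [T2Space M] in
-- The curve stays in `V` and in one level of `f`, so by `eventually_mem_orbit` nearby points of it
-- lie in one orbit; connectedness of `[0,1]` does the rest.
lemma mem_orbit_of_joined (h : HasFlowBoxes f X R) {p q : M} (hp : p ∈ V)
    (hpq : TangentJoined X R p q) : ∃ w, q = Ψ w p := by
  obtain ⟨γ, h1, rfl, rfl, h4⟩ := hpq
  have hf := eqOn_of_tangent h.isOpen h.contMDiffOn (fun q hq => h.mfderiv_apply hq) h1 h4
  have hV := hΨ.curve γ h1.continuousOn hp hf
  refine isPreconnected_Icc.induction₂ (s := Set.Icc (0 : ℝ) 1)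
    (fun τ σ => ∃ w, γ σ = Ψ w (γ τ)) ?_ ?_ ?_ (Set.left_mem_Icc.2 zero_le_one)
    (Set.right_mem_Icc.2 zero_le_one)
  · intro τ hτ
    have h5 := (h1.continuousOn τ hτ).eventually (hΨ.eventually_mem_orbit h (hV τ hτ))
    filter_upwards [h5, self_mem_nhdsWithin] with σ h6 hσ
    exact h6 (by rw [hf σ hσ, hf τ hτ])
  · rintro τ₁ τ₂ τ₃ hτ₁ - - ⟨w, hw⟩ ⟨w', hw'⟩
    exact ⟨w' + w, by rw [hw', hw, hΨ.add _ (hV τ₁ hτ₁)]⟩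
  · rintro τ₁ τ₂ hτ₁ - ⟨w, hw⟩
    exact ⟨-w, by rw [hw, hΨ.neg_apply (hV τ₁ hτ₁)]⟩

omit [T2Space M] in
lemma tangentLeaf_eq (h : HasFlowBoxes f X R) {q : M} (hq : q ∈ V) :
    tangentLeaf X R q = Set.range fun w => Ψ w q := by
  ext q'
  constructor
  · intro hq'
    induction hq' with
    | refl => exact ⟨0, hΨ.zero q hq⟩
    | tail _ h1 ih =>
      obtain ⟨w, rfl⟩ := ih
      obtain ⟨w', rfl⟩ := hΨ.mem_orbit_of_joined h (hΨ.maps q hq w) h1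
      exact ⟨w' + w, hΨ.add q hq w' w⟩
  · rintro ⟨w, rfl⟩
    exact hΨ.joined q hq w

end IsTubeAction

end Orbits

/-! ### Discrete cocompact subgroups of `ℝʳ`. -/

section Lattice

variable {r : ℕ}

/-- By `hcov` a linear form vanishing on `Λ` is bounded, hence zero, so `Λ` spans. A discrete
spanning subgroup has a `ℤ`-basis which is an `ℝ`-basis of the space. -/
lemma exists_lattice_basis (Λ : AddSubgroup (E r)) (hdisc : ∀ᶠ v in 𝓝 (0 : E r), v ∈ Λ → v = 0)
    {C : ℝ} (hcov : ∀ v : E r, ∃ w, ‖w‖ ≤ C ∧ v - w ∈ Λ) :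
    ∃ l : Fin r → E r, LinearIndependent ℝ l ∧ (∀ i, l i ∈ Λ) ∧
      ∀ c : E r, frameMap l c ∈ Λ → ∃ k : Fin r → ℤ, ∀ i, c i = k i := by
  let L : Submodule ℤ (E r) := AddSubgroup.toIntSubmodule Λ
  have hL : ∀ v, v ∈ L ↔ v ∈ Λ := fun v => Iff.rfl
  have : DiscreteTopology L := by
    have h1 : IsOpen ({0} : Set L) := by
      rw [isOpen_iff_mem_nhds]
      rintro x rfl
      have h2 : Filter.Tendsto (fun x : L => (x : E r)) (𝓝 0) (𝓝 0) :=
        continuous_subtype_val.tendsto (0 : L)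
      filter_upwards [h2.eventually hdisc] with x hx
      exact Subtype.ext (hx x.2)
    exact discreteTopology_of_isOpen_singleton_zero h1
  have hspan : Submodule.span ℝ (L : Set (E r)) = ⊤ := by
    by_contra hne
    obtain ⟨g, hg0, hg⟩ := Submodule.exists_le_ker_of_lt_top _ (lt_top_iff_ne_top.2 hne)
    apply hg0
    let g' : E r →L[ℝ] ℝ := LinearMap.toContinuousLinearMap g
    have hbound : ∀ v, |g v| ≤ ‖g'‖ * C := by
      intro v
      obtain ⟨w, hw, hvw⟩ := hcov v
      have h1 : g (v - w) = 0 := hg (Submodule.subset_span hvw)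
      rw [map_sub, sub_eq_zero] at h1
      rw [h1]
      exact (g'.le_opNorm w).trans (mul_le_mul_of_nonneg_left hw (norm_nonneg _))
    ext v
    by_contra hv
    have hv' : 0 < |g v| := abs_pos.2 hv
    have hK : 0 ≤ ‖g'‖ * C := (abs_nonneg _).trans (hbound v)
    have h2 := hbound (((‖g'‖ * C + 1) / |g v|) • v)
    rw [map_smul, smul_eq_mul, abs_mul, abs_of_nonneg (by positivity),
      div_mul_cancel₀ _ hv'.ne'] at h2
    linarith
  have : IsZLattice ℝ L := ⟨hspan⟩
  have : Module.Finite ℤ L := ZLattice.module_finite ℝ L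
  have : Module.Free ℤ L := ZLattice.module_free ℝ L
  let b : Module.Basis (Fin r) ℤ L := Module.finBasisOfFinrankEq ℤ L
    (by rw [ZLattice.rank ℝ L, finrank_euclideanSpace_fin])
  let b' := b.ofZLatticeBasis ℝ L
  have hb' : ∀ i, b' i = b i := fun i => b.ofZLatticeBasis_apply ℝ L i
  refine ⟨b', b'.linearIndependent, fun i => by rw [hb']; exact (b i).2, ?_⟩
  intro c hc
  refine ⟨fun i => b.repr ⟨_, hc⟩ i, fun i => ?_⟩
  have h1 := b.ofZLatticeBasis_repr_apply ℝ L ⟨frameMap b' c, hc⟩ i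
  rw [← h1]
  simp only [frameMap_apply]
  change c i = b'.repr (∑ j, c j • b' j) i
  rw [b'.repr_sum_self]

end Lattice

/-! ### Local sections and smooth families of periods. -/

section Periods

variable {d r s : ℕ} {M : Type*} [TopologicalSpace M] [ChartedSpace (E d) M]
  {f : M → E s} {X : Fin r → Π q : M, TangentSpace (𝓡 d) q} {R V : Set M} {Ψ : E r → M → M}

/-- A smooth local section of `f` over the open set `B`. -/
structure IsLocalSection (d : ℕ) [ChartedSpace (E d) M] (f : M → E s) (V : Set M) (B : Set (E s))
    (σ : E s → M) : Prop where
  isOpen : IsOpen B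
  smooth : ContMDiffOn 𝓘(ℝ, E s) (𝓡 d) ∞ σ B
  apply_eq : ∀ b ∈ B, f (σ b) = b
  mem : ∀ b ∈ B, σ b ∈ V

lemma IsLocalSection.mono {B B' : Set (E s)} {σ : E s → M} (hσ : IsLocalSection d f V B σ)
    (hB' : IsOpen B') (h : B' ⊆ B) : IsLocalSection d f V B' σ :=
  ⟨hB', hσ.smooth.mono h, fun b hb => hσ.apply_eq b (h hb), fun b hb => hσ.mem b (h hb)⟩

lemma IsFlowBox.exists_isLocalSection {β : OpenPartialHomeomorph M (E r × E s)}
    (hβ : IsFlowBox f X β) (hV : IsOpen V) {m : M} (hm : m ∈ V) (hmβ : m ∈ β.source) :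
    ∃ (B : Set (E s)) (σ : E s → M), IsLocalSection d f V B σ ∧ f m ∈ B ∧ σ (f m) = m := by
  let ι : E s → E r × E s := fun b => ((β m).1, b)
  have hι : ContDiff ℝ ∞ ι := contDiff_const.prodMk contDiff_id
  let W : Set (E r × E s) := β.target ∩ β.symm ⁻¹' V
  have hW : IsOpen W := β.symm.isOpen_inter_preimage hV
  have hιm : ι (f m) = β m := Prod.ext rfl (hβ.snd_eq m hmβ).symm
  refine ⟨ι ⁻¹' W, fun b => β.symm (ι b), ⟨hW.preimage hι.continuous, ?_, ?_, ?_⟩, ?_, ?_⟩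
  · exact hβ.smooth_symm.comp hι.contMDiff.contMDiffOn fun b hb => hb.1
  · exact fun b hb => hβ.snd_symm hb.1
  · exact fun b hb => hb.2
  · refine ⟨?_, ?_⟩
    · rw [hιm]; exact β.map_source hmβ
    · rw [Set.mem_preimage, hιm, β.left_inv hmβ]; exact hm
  · change β.symm (ι (f m)) = m
    rw [hιm, β.left_inv hmβ]

namespace IsTubeAction

variable {B : Set (E s)} {σ : E s → M}

/-- In a flow box, the action on a local section is a translation by a function of the
parameters. -/
lemma exists_local_form (hΨ : IsTubeAction f X R V Ψ) (hσ : IsLocalSection d f V B σ)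
    {β : OpenPartialHomeomorph M (E r × E s)} (hβ : IsFlowBox f X β) {v : E r} {b : E s}
    (hb : b ∈ B) (hvb : Ψ v (σ b) ∈ β.source) :
    ∃ (N : Set (E s)) (κ : E s → E r), IsOpen N ∧ b ∈ N ∧ N ⊆ B ∧ ContDiffOn ℝ ∞ κ N ∧
      (∀ b' ∈ N, Ψ v (σ b') ∈ β.source ∧ β (Ψ v (σ b')) = (v + κ b', b')) ∧
      ∀ᶠ x : E r × E s in 𝓝 (v, b), (x.1 + κ x.2, x.2) ∈ β.target ∧
        Ψ x.1 (σ x.2) = β.symm (x.1 + κ x.2, x.2) := by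
  have hs : ContMDiffOn 𝓘(ℝ, E s) (𝓡 d) ∞ (fun b => Ψ v (σ b)) B :=
    (hΨ.smooth v).comp hσ.smooth fun b hb => hσ.mem b hb
  let N : Set (E s) := B ∩ (fun b => Ψ v (σ b)) ⁻¹' β.source
  have hN : IsOpen N := hs.continuousOn.isOpen_inter_preimage hσ.isOpen β.open_source
  let κ : E s → E r := fun b => (β (Ψ v (σ b))).1 - v
  have hβeq : ∀ b' ∈ N, β (Ψ v (σ b')) = (v + κ b', b') := by
    intro b' hb'
    refine Prod.ext (by simp [κ]) ?_
    rw [hβ.snd_eq _ hb'.2, hΨ.map_eq _ (hσ.mem b' hb'.1), hσ.apply_eq b' hb'.1]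
  refine ⟨N, κ, hN, ⟨hb, hvb⟩, Set.inter_subset_left, ?_, fun b' hb' => ⟨hb'.2, hβeq b' hb'⟩, ?_⟩
  · have h1 : ContMDiffOn 𝓘(ℝ, E s) 𝓘(ℝ, E r × E s) ∞ (fun b => β (Ψ v (σ b))) N :=
      hβ.smooth.comp (hs.mono Set.inter_subset_left) fun b hb => hb.2
    exact ((contMDiffOn_iff_contDiffOn.1 h1).fst).sub contDiffOn_const
  · have hq : Ψ v (σ b) ∈ V := hΨ.maps _ (hσ.mem b hb) v
    have h1 := hΨ.local_eq β hβ _ hq hvb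
    have h2 : Filter.Tendsto (fun x : E r × E s => (x.1 - v, Ψ v (σ x.2))) (𝓝 (v, b))
        (𝓝 (0, Ψ v (σ b))) := by
      refine Filter.Tendsto.prodMk_nhds ?_ ?_
      · have : Continuous fun x : E r × E s => x.1 - v := by fun_prop
        simpa using this.tendsto (v, b)
      · have h3 : ContinuousAt (fun b => Ψ v (σ b)) b :=
          hs.continuousOn.continuousAt (hσ.isOpen.mem_nhds hb)
        exact ContinuousAt.comp (f := fun x : E r × E s => x.2) (x := (v, b)) h3
          continuousAt_snd
    filter_upwards [h2.eventually h1, continuousAt_snd.preimage_mem_nhds (hN.mem_nhds ⟨hb, hvb⟩)]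
      with x hx hxN
    have h4 : β (Ψ v (σ x.2)) + horizontal (x.1 - v) = (x.1 + κ x.2, x.2) := by
      rw [hβeq _ hxN]
      refine Prod.ext ?_ (by simp [horizontal])
      change v + κ x.2 + (x.1 - v) = x.1 + κ x.2
      abel
    rw [h4] at hx
    refine ⟨hx.1, ?_⟩
    rw [← hx.2, ← hΨ.add _ (hσ.mem _ hxN.1), sub_add_cancel]

/-- The action on a local section is smooth in all variables. -/
lemma contMDiffAt_section (hΨ : IsTubeAction f X R V Ψ) (hσ : IsLocalSection d f V B σ)
    (h : HasFlowBoxes f X R) {v : E r} {b : E s} (hb : b ∈ B) :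
    ContMDiffAt 𝓘(ℝ, E r × E s) (𝓡 d) ∞ (fun x : E r × E s => Ψ x.1 (σ x.2)) (v, b) := by
  obtain ⟨β, hβ, hq, -⟩ := h _ (hΨ.subset (hΨ.maps _ (hσ.mem b hb) v))
  obtain ⟨N, κ, hN, hbN, -, hκ, -, hev⟩ := hΨ.exists_local_form hσ hβ hb hq
  have h1 : ContDiffAt ℝ ∞ (fun x : E r × E s => (x.1 + κ x.2, x.2)) (v, b) :=
    (contDiffAt_fst.add ((hκ.contDiffAt (hN.mem_nhds hbN)).comp (v, b) contDiffAt_snd)).prodMk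
      contDiffAt_snd
  have h2 := (hβ.contMDiffAt_symm hev.self_of_nhds.1).comp (v, b) h1.contMDiffAt
  refine h2.congr_of_eventuallyEq ?_
  filter_upwards [hev] with x hx using hx.2

/-- Local inverses of the action on a local section. -/
lemma exists_local_inverse (hΨ : IsTubeAction f X R V Ψ) (hσ : IsLocalSection d f V B σ)
    (h : HasFlowBoxes f X R) {v : E r} {b : E s} (hb : b ∈ B) :
    ∃ (N : Set M) (u : M → E r), IsOpen N ∧ Ψ v (σ b) ∈ N ∧ N ⊆ R ∧
      ContMDiffOn (𝓡 d) 𝓘(ℝ, E r) ∞ u N ∧ u (Ψ v (σ b)) = v ∧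
      ∀ q ∈ N, f q ∈ B ∧ Ψ (u q) (σ (f q)) = q := by
  obtain ⟨β, hβ, hq, hR⟩ := h _ (hΨ.subset (hΨ.maps _ (hσ.mem b hb) v))
  obtain ⟨N₁, κ, hN₁, hbN₁, hN₁B, hκ, hκb, hev⟩ := hΨ.exists_local_form hσ hβ hb hq
  set q₀ := Ψ v (σ b) with hq₀
  have hfq₀ : f q₀ = b := by rw [hΨ.map_eq _ (hσ.mem b hb), hσ.apply_eq b hb]
  -- In the box `Ψ u (σ b)` has coordinates `(u + κ b, b)`; this equation is solved for `u`.
  let u : M → E r := fun q => (β q).1 - κ (f q)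
  let S : Set M := β.source ∩ f ⁻¹' N₁
  have hfs : ContMDiffOn (𝓡 d) 𝓘(ℝ, E s) ∞ f β.source := h.contMDiffOn.mono hR
  have hS : IsOpen S := hfs.continuousOn.isOpen_inter_preimage β.open_source hN₁
  have hq₀S : q₀ ∈ S := ⟨hq, by rw [Set.mem_preimage, hfq₀]; exact hbN₁⟩
  have hu : ContMDiffOn (𝓡 d) 𝓘(ℝ, E r) ∞ u S := by
    have h1 : ContMDiffOn (𝓡 d) 𝓘(ℝ, E r) ∞ (fun q => (β q).1) S :=
      (contDiff_fst.contMDiff (n := ∞)).comp_contMDiffOn (hβ.smooth.mono Set.inter_subset_left)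
    have h2 : ContMDiffOn (𝓡 d) 𝓘(ℝ, E r) ∞ (fun q => κ (f q)) S :=
      (contMDiffOn_iff_contDiffOn.2 hκ).comp (hfs.mono Set.inter_subset_left) fun q hq => hq.2
    exact h1.sub h2
  have huq₀ : u q₀ = v := by
    change (β q₀).1 - κ (f q₀) = v
    rw [hfq₀, (hκb b hbN₁).2]
    simp
  have hlim : Filter.Tendsto (fun q => (u q, f q)) (𝓝 q₀) (𝓝 (v, b)) := by
    refine Filter.Tendsto.prodMk_nhds ?_ ?_
    · rw [← huq₀]
      exact hu.continuousOn.continuousAt (hS.mem_nhds hq₀S)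
    · rw [← hfq₀]
      exact hfs.continuousOn.continuousAt (β.open_source.mem_nhds hq)
  obtain ⟨N, hNs, hN, hq₀N⟩ := mem_nhds_iff.1
    (Filter.inter_mem (hlim.eventually hev) (hS.mem_nhds hq₀S))
  refine ⟨N, u, hN, hq₀N, fun q hq => hR (hNs hq).2.1, hu.mono fun q hq => (hNs hq).2, huq₀, ?_⟩
  intro q hq
  obtain ⟨h1, h2⟩ := hNs hq
  refine ⟨hN₁B h2.2, ?_⟩
  have h3 : ((u q + κ (f q), f q) : E r × E s) = β q :=
    Prod.ext (sub_add_cancel _ _) (hβ.snd_eq q h2.1).symm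
  have h4 : Ψ (u q) (σ (f q)) = β.symm (u q + κ (f q), f q) := h1.2
  rw [h4, h3, β.left_inv h2.1]

/-- A period of the action at one point of a local section extends to a smooth family of
periods. -/
lemma exists_period (hΨ : IsTubeAction f X R V Ψ) (hσ : IsLocalSection d f V B σ)
    (h : HasFlowBoxes f X R) {v : E r} {b : E s} (hb : b ∈ B) (hv : Ψ v (σ b) = σ b) :
    ∃ (N : Set (E s)) (l : E s → E r), IsOpen N ∧ b ∈ N ∧ N ⊆ B ∧ ContDiffOn ℝ ∞ l N ∧
      l b = v ∧ (∀ b' ∈ N, Ψ (l b') (σ b') = σ b') ∧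
      ∀ᶠ x : E r × E s in 𝓝 (v, b), Ψ x.1 (σ x.2) = σ x.2 → x.1 = l x.2 := by
  obtain ⟨β, hβ, hq, hR⟩ := h _ (hΨ.subset (hσ.mem b hb))
  obtain ⟨N₀, κ₀, hN₀, hbN₀, hN₀B, hκ₀, hκ₀b, -⟩ := hΨ.exists_local_form hσ hβ (v := 0) hb
    (by rwa [hΨ.zero _ (hσ.mem b hb)])
  obtain ⟨N₁, κ, hN₁, hbN₁, hN₁B, hκ, hκb, hev⟩ := hΨ.exists_local_form hσ hβ (v := v) hb
    (by rwa [hv])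
  have hσβ : ∀ b' ∈ N₀, σ b' ∈ β.source ∧ β (σ b') = (κ₀ b', b') := by
    intro b' hb'
    have := hκ₀b b' hb'
    rwa [hΨ.zero _ (hσ.mem _ (hN₀B hb')), zero_add] at this
  -- In the box `σ b` is `(κ₀ b, b)` and `Ψ w (σ b)` is `(w + κ b, b)`, so the equation for a period
  -- is linear. Its solution is explicit, smooth and locally unique.
  let l : E s → E r := fun b => κ₀ b - κ b
  have hl : ContDiffOn ℝ ∞ l (N₀ ∩ N₁) :=
    (hκ₀.mono Set.inter_subset_left).sub (hκ.mono Set.inter_subset_right)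
  have hlb : l b = v := by
    have h1 := (hκb b hbN₁).2
    rw [hv, (hσβ b hbN₀).2] at h1
    have h2 : κ₀ b = v + κ b := congrArg Prod.fst h1
    simp [l, h2]
  have hlim : Filter.Tendsto (fun b' => (l b', b')) (𝓝 b) (𝓝 (v, b)) := by
    refine Filter.Tendsto.prodMk_nhds ?_ Filter.tendsto_id
    rw [← hlb]
    exact hl.continuousOn.continuousAt ((hN₀.inter hN₁).mem_nhds ⟨hbN₀, hbN₁⟩)
  obtain ⟨N, hNs, hN, hbN⟩ := mem_nhds_iff.1
    (Filter.inter_mem (hlim.eventually hev) ((hN₀.inter hN₁).mem_nhds ⟨hbN₀, hbN₁⟩))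
  refine ⟨N, l, hN, hbN, fun b' hb' => hN₀B (hNs hb').2.1, hl.mono fun b' hb' => (hNs hb').2,
    hlb, ?_, ?_⟩
  · intro b' hb'
    obtain ⟨h1, h2⟩ := hNs hb'
    have h3 : Ψ (l b') (σ b') = β.symm (l b' + κ b', b') := h1.2
    rw [h3, sub_add_cancel, ← (hσβ b' h2.1).2, β.left_inv (hσβ b' h2.1).1]
  · filter_upwards [hev, continuousAt_snd.preimage_mem_nhds (hN₀.mem_nhds hbN₀)] with x hx hxN hx'
    have h1 := (hσβ x.2 hxN).2
    rw [← hx', hx.2, β.right_inv hx.1] at h1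
    have h2 : x.1 + κ x.2 = κ₀ x.2 := congrArg Prod.fst h1
    exact eq_sub_of_add_eq h2

end IsTubeAction

end Periods

/-! ### Frames of periods and the trivialization by tori. -/

section Trivialization

variable {d r s : ℕ} {M : Type*} [TopologicalSpace M] [ChartedSpace (E d) M]
  {f : M → E s} {X : Fin r → Π q : M, TangentSpace (𝓡 d) q} {R V : Set M} {Ψ : E r → M → M}
  {B : Set (E s)} {σ : E s → M} {l : E s → Fin r → E r}

namespace IsTubeAction

/-- The group of periods of a point. -/
def periodGroup (hΨ : IsTubeAction f X R V Ψ) {q : M} (hq : q ∈ V) : AddSubgroup (E r) where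
  carrier := {v | Ψ v q = q}
  zero_mem' := hΨ.zero q hq
  add_mem' {a b} ha hb := by
    change Ψ (a + b) q = q
    rw [hΨ.add q hq, hb, ha]
  neg_mem' {a} ha := by
    have := hΨ.neg_apply hq a
    rwa [ha] at this

lemma mem_periodGroup (hΨ : IsTubeAction f X R V Ψ) {q : M} (hq : q ∈ V) {v : E r} :
    v ∈ hΨ.periodGroup hq ↔ Ψ v q = q := Iff.rfl

lemma apply_eq_apply_iff (hΨ : IsTubeAction f X R V Ψ) {q : M} (hq : q ∈ V) {v w : E r} :
    Ψ v q = Ψ w q ↔ Ψ (v - w) q = q := by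
  constructor
  · intro h
    rw [sub_eq_neg_add, hΨ.add q hq, h, hΨ.neg_apply hq]
  · intro h
    rw [← sub_add_cancel v w, add_comm, hΨ.add q hq, h]

lemma frameMap_mem_periodGroup (hΨ : IsTubeAction f X R V Ψ) {q : M} (hq : q ∈ V)
    {l : Fin r → E r} (hl : ∀ i, Ψ (l i) q = q) {c : E r} {k : Fin r → ℤ}
    (hk : ∀ i, c i = k i) : Ψ (frameMap l c) q = q := by
  rw [← hΨ.mem_periodGroup hq, frameMap_apply]
  refine sum_mem fun i _ => ?_
  rw [hk, Int.cast_smul_eq_zsmul]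
  exact zsmul_mem ((hΨ.mem_periodGroup hq).2 (hl i)) _

/-- Periods are discrete because `exists_period`, applied to the period `0`, gives local uniqueness.
They are cocompact because the orbit is compact: finitely many local inverses of `v ↦ Ψ v (σ b)`
cover it, so every point of it is reached by a time of bounded norm. -/
lemma exists_period_basis (hΨ : IsTubeAction f X R V Ψ) (hσ : IsLocalSection d f V B σ)
    (h : HasFlowBoxes f X R) {b : E s} (hb : b ∈ B)
    (hc : IsCompact (Set.range fun w => Ψ w (σ b))) :
    ∃ l : Fin r → E r, LinearIndependent ℝ l ∧ (∀ i, Ψ (l i) (σ b) = σ b) ∧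
      ∀ c : E r, Ψ (frameMap l c) (σ b) = σ b → ∃ k : Fin r → ℤ, ∀ i, c i = k i := by
  have hq := hσ.mem b hb
  have hdisc : ∀ᶠ v in 𝓝 (0 : E r), v ∈ hΨ.periodGroup hq → v = 0 := by
    obtain ⟨N, l, -, -, -, -, hl0, -, hev⟩ := hΨ.exists_period hσ h hb (hΨ.zero _ hq)
    have h1 : Filter.Tendsto (fun v : E r => (v, b)) (𝓝 0) (𝓝 (0, b)) :=
      (Continuous.prodMk_left b).tendsto 0
    filter_upwards [h1.eventually hev] with v hv hv'
    exact (hv hv').trans hl0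
  have hcov : ∃ C, ∀ q' ∈ Set.range (fun w => Ψ w (σ b)), ∃ w, ‖w‖ ≤ C ∧ Ψ w (σ b) = q' := by
    have h1 : ∃ C, ∀ q' ∈ Set.range (fun w => Ψ w (σ b)), q' ∈ Set.range (fun w => Ψ w (σ b)) →
        ∃ w, ‖w‖ ≤ C ∧ Ψ w (σ b) = q' := by
      refine hc.induction_on (p := fun S => ∃ C, ∀ q' ∈ S, q' ∈ Set.range (fun w => Ψ w (σ b)) →
        ∃ w, ‖w‖ ≤ C ∧ Ψ w (σ b) = q') ⟨0, by simp⟩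
        (fun S T hST ⟨C, hC⟩ => ⟨C, fun q' hq' => hC q' (hST hq')⟩) ?_ ?_
      · rintro S T ⟨C, hC⟩ ⟨D, hD⟩
        refine ⟨max C D, fun q' hq' hq'' => ?_⟩
        rcases hq' with hq' | hq'
        · obtain ⟨w, h1, h2⟩ := hC q' hq' hq''
          exact ⟨w, h1.trans (le_max_left _ _), h2⟩
        · obtain ⟨w, h1, h2⟩ := hD q' hq' hq''
          exact ⟨w, h1.trans (le_max_right _ _), h2⟩
      · rintro _ ⟨v, rfl⟩
        obtain ⟨N, u, hN, hvN, -, hu, huv, hinv⟩ := hΨ.exists_local_inverse hσ h (v := v) hb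
        have h2 : ContinuousAt u (Ψ v (σ b)) := hu.continuousOn.continuousAt (hN.mem_nhds hvN)
        have h3 : ∀ᶠ q' in 𝓝 (Ψ v (σ b)), ‖u q'‖ < ‖v‖ + 1 :=
          h2.norm.eventually_lt continuousAt_const (by simp [huv])
        refine ⟨_, mem_nhdsWithin_of_mem_nhds (Filter.inter_mem h3 (hN.mem_nhds hvN)), ‖v‖ + 1, ?_⟩
        rintro q' ⟨h4, h5⟩ ⟨w, rfl⟩
        refine ⟨u (Ψ w (σ b)), le_of_lt h4, ?_⟩
        have := (hinv _ h5).2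
        rwa [hΨ.map_eq _ hq, hσ.apply_eq b hb] at this
    obtain ⟨C, hC⟩ := h1
    exact ⟨C, fun q' hq' => hC q' hq' hq'⟩
  obtain ⟨C, hC⟩ := hcov
  exact exists_lattice_basis (hΨ.periodGroup hq) hdisc (C := C) fun v => by
    obtain ⟨w, h1, h2⟩ := hC _ ⟨v, rfl⟩
    exact ⟨w, h1, (hΨ.apply_eq_apply_iff hq).1 h2.symm⟩

end IsTubeAction

/-- A smooth family of bases of the lattices of periods along a local section. -/
structure IsPeriodFrame (Ψ : E r → M → M) (B : Set (E s)) (σ : E s → M)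
    (l : E s → Fin r → E r) : Prop where
  smooth : ContDiffOn ℝ ∞ l B
  invertible : ∀ b ∈ B, ∃ e : E r ≃L[ℝ] E r, (e : E r →L[ℝ] E r) = frameMap (l b)
  period : ∀ b ∈ B, ∀ i, Ψ (l b i) (σ b) = σ b
  integral : ∀ b ∈ B, ∀ c : E r, Ψ (frameMap (l b) c) (σ b) = σ b →
    ∃ k : Fin r → ℤ, ∀ i, c i = k i

omit [TopologicalSpace M] in
lemma IsPeriodFrame.mono {B' : Set (E s)} (hl : IsPeriodFrame Ψ B σ l) (h : B' ⊆ B) :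
    IsPeriodFrame Ψ B' σ l :=
  ⟨hl.smooth.mono h, fun b hb => hl.invertible b (h hb), fun b hb => hl.period b (h hb),
    fun b hb => hl.integral b (h hb)⟩

lemma exists_equiv_eq_frameMap {v : Fin r → E r} (hv : LinearIndependent ℝ v) :
    ∃ e : E r ≃L[ℝ] E r, (e : E r →L[ℝ] E r) = frameMap v := by
  have hinj : Function.Injective (frameMap v : E r →ₗ[ℝ] E r) := by
    rw [injective_iff_map_eq_zero]
    intro x hx
    have hx' : ∑ i, x i • v i = 0 := by rw [← frameMap_apply]; exact hx
    ext i
    exact Fintype.linearIndependent_iff.1 hv _ hx' i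
  exact ⟨(LinearEquiv.ofInjectiveEndo _ hinj).toContinuousLinearEquiv, by ext; rfl⟩

/-- Integrality of the coefficients of a period thus needs to be checked only for `c` in the unit
cube, which is compact. -/
lemma exists_integral_translate (c : E r) : ∃ c' : E r,
    c' ∈ (WithLp.toLp 2) '' (Set.pi Set.univ fun _ : Fin r => Set.Icc (0 : ℝ) 1) ∧
      ∃ k : Fin r → ℤ, ∀ i, (c - c') i = k i :=
  ⟨WithLp.toLp 2 fun i => Int.fract (c i),
    ⟨_, fun i _ => ⟨Int.fract_nonneg _, (Int.fract_lt_one _).le⟩, rfl⟩,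
    fun i => ⌊c i⌋, fun i => by simp [Int.self_sub_fract]⟩

variable [T2Space M]

/-- A basis of periods at `b` extends smoothly by `exists_period`; what has to be excluded is
additional periods over nearby points. Near a `c` which gives a period at `b`, local uniqueness
excludes them; near any other `c`, continuity and the Hausdorff property do. Compactness of the unit
cube makes the neighbourhood of `b` uniform in `c`. -/
lemma IsTubeAction.exists_isPeriodFrame (hΨ : IsTubeAction f X R V Ψ)
    (hσ : IsLocalSection d f V B σ) (h : HasFlowBoxes f X R) {b : E s} (hb : b ∈ B)
    (hc : IsCompact (Set.range fun w => Ψ w (σ b))) :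
    ∃ (B' : Set (E s)) (l : E s → Fin r → E r), IsOpen B' ∧ b ∈ B' ∧ B' ⊆ B ∧
      IsPeriodFrame Ψ B' σ l := by
  obtain ⟨l₀, hli, hl₀, hint⟩ := hΨ.exists_period_basis hσ h hb hc
  choose N l hN hbN hNB hl hlb hlσ hev using fun i => hΨ.exists_period hσ h hb (hl₀ i)
  let l' : E s → Fin r → E r := fun b i => l i b
  have hl'b : l' b = l₀ := funext hlb
  let B₁ : Set (E s) := B ∩ ⋂ i, N i
  have hB₁ : IsOpen B₁ := hσ.isOpen.inter (isOpen_iInter_of_finite hN)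
  have hbB₁ : b ∈ B₁ := ⟨hb, Set.mem_iInter.2 hbN⟩
  have hl's : ContDiffOn ℝ ∞ l' B₁ := contDiffOn_pi.2 fun i =>
    (hl i).mono fun b hb => Set.mem_iInter.1 hb.2 i
  have hA : ContDiffOn ℝ ∞ (fun b => frameMap (l' b)) B₁ := contDiff_frameMap.comp_contDiffOn hl's
  let B₂ : Set (E s) :=
    B₁ ∩ (fun b => frameMap (l' b)) ⁻¹' Set.range ((↑) : (E r ≃L[ℝ] E r) → E r →L[ℝ] E r)
  have hB₂ : IsOpen B₂ := hA.continuousOn.isOpen_inter_preimage hB₁ ContinuousLinearEquiv.isOpen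
  have hbB₂ : b ∈ B₂ := ⟨hbB₁, by
    rw [Set.mem_preimage, hl'b]
    exact exists_equiv_eq_frameMap hli⟩
  have hper : ∀ b' ∈ B₁, ∀ i, Ψ (l' b' i) (σ b') = σ b' := fun b' hb' i =>
    hlσ i b' (Set.mem_iInter.1 hb'.2 i)
  have hAb : ContinuousAt (fun b => frameMap (l' b)) b :=
    hA.continuousOn.continuousAt (hB₁.mem_nhds hbB₁)
  have hlim : ∀ c : E r, Filter.Tendsto (fun z : E s × E r => (frameMap (l' z.1) z.2, z.1))
      (𝓝 (b, c)) (𝓝 (frameMap (l' b) c, b)) := by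
    intro c
    refine Filter.Tendsto.prodMk_nhds ?_ continuousAt_fst
    have h1 : ContinuousAt (fun z : E s × E r => frameMap (l' z.1)) (b, c) :=
      ContinuousAt.comp (f := fun z : E s × E r => z.1) (x := (b, c)) hAb continuousAt_fst
    exact h1.clm_apply continuousAt_snd
  have hint' : ∀ c : E r, ∀ᶠ z : E s × E r in 𝓝 (b, c),
      Ψ (frameMap (l' z.1) z.2) (σ z.1) = σ z.1 → ∃ k : Fin r → ℤ, ∀ i, z.2 i = k i := by
    intro c
    by_cases hcΨ : Ψ (frameMap (l' b) c) (σ b) = σ b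
    · obtain ⟨k, hk⟩ := hint c (by rwa [← hl'b])
      obtain ⟨-, l₁, -, -, -, -, -, -, hev⟩ := hΨ.exists_period hσ h hb hcΨ
      have h1 := (hlim c).eventually hev
      have h2 : Filter.Tendsto (fun z : E s × E r => (z.1, c)) (𝓝 (b, c)) (𝓝 (b, c)) := by
        have : Continuous fun z : E s × E r => (z.1, c) := by fun_prop
        exact this.tendsto (b, c)
      filter_upwards [h1, h2.eventually h1,
        continuousAt_fst.preimage_mem_nhds (hB₂.mem_nhds hbB₂)] with z h3 h4 hz hz'
      obtain ⟨e, he⟩ := hz.2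
      -- Both `z.2` and the integral vector `c` give periods at `σ z.1` close to the same period
      -- over `b`, so these periods coincide.
      have h5 := (h3 hz').trans (h4 (hΨ.frameMap_mem_periodGroup (hσ.mem _ hz.1.1)
        (hper _ hz.1) hk)).symm
      have h6 : z.2 = c := by
        refine e.injective ?_
        have : ∀ x, e x = frameMap (l' z.1) x := fun x => congrArg (fun L => L x) he
        rw [this, this]
        exact h5
      exact ⟨k, by rwa [h6]⟩
    · have h1 : Filter.Tendsto (fun z : E s × E r => Ψ (frameMap (l' z.1) z.2) (σ z.1))
          (𝓝 (b, c)) (𝓝 (Ψ (frameMap (l' b) c) (σ b))) :=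
        (hΨ.contMDiffAt_section hσ h hb).continuousAt.tendsto.comp (hlim c)
      have h2 : Filter.Tendsto (fun z : E s × E r => σ z.1) (𝓝 (b, c)) (𝓝 (σ b)) :=
        Filter.Tendsto.comp (hσ.smooth.continuousOn.continuousAt (hσ.isOpen.mem_nhds hb))
          continuousAt_fst
      filter_upwards [(h1.prodMk_nhds h2).eventually
        (isClosed_diagonal.isOpen_compl.mem_nhds hcΨ)] with z hz hz' using absurd hz' hz
  have hcube : IsCompact
      ((WithLp.toLp 2) '' (Set.pi Set.univ fun _ : Fin r => Set.Icc (0 : ℝ) 1) : Set (E r)) :=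
    (isCompact_univ_pi fun _ => isCompact_Icc).image (PiLp.continuous_toLp 2 _)
  obtain ⟨B', hB's, hB', hbB'⟩ := mem_nhds_iff.1 (Filter.inter_mem
    (hcube.eventually_forall_of_forall_eventually (x₀ := b) (P := fun b' c =>
      Ψ (frameMap (l' b') c) (σ b') = σ b' → ∃ k : Fin r → ℤ, ∀ i, c i = k i)
      fun c _ => hint' c) (hB₂.mem_nhds hbB₂))
  refine ⟨B', l', hB', hbB', fun b' hb' => (hB's hb').2.1.1, hl's.mono fun b' hb' => (hB's hb').2.1,
    fun b' hb' => (hB's hb').2.2, fun b' hb' => hper b' (hB's hb').2.1, ?_⟩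
  intro b' hb' c hcΨ
  obtain ⟨c', hc', k, hk⟩ := exists_integral_translate c
  have h1 := hΨ.frameMap_mem_periodGroup (hσ.mem _ (hB's hb').2.1.1) (hper b' (hB's hb').2.1) hk
  have hV := hσ.mem _ (hB's hb').2.1.1
  rw [map_sub, ← hΨ.apply_eq_apply_iff hV, hcΨ] at h1
  obtain ⟨k', hk'⟩ := (hB's hb').1 c' hc' h1.symm
  refine ⟨fun i => k i + k' i, fun i => ?_⟩
  have := hk i
  rw [PiLp.sub_apply, hk', sub_eq_iff_eq_add] at this
  rw [this]
  push_cast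
  rfl

omit [T2Space M] in
-- In the coordinates of the frame the period lattice is `ℤʳ`, so each orbit is the torus.
lemma IsPeriodFrame.apply_eq_apply_iff (hl : IsPeriodFrame Ψ B σ l)
    (hΨ : IsTubeAction f X R V Ψ) (hσ : IsLocalSection d f V B σ) {b : E s} (hb : b ∈ B)
    {c c' : E r} : Ψ (frameMap (l b) c) (σ b) = Ψ (frameMap (l b) c') (σ b) ↔
      torusExp c = torusExp c' := by
  have hV := hσ.mem b hb
  rw [hΨ.apply_eq_apply_iff hV, ← map_sub, torusExp_eq_iff]
  constructor
  · intro h1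
    obtain ⟨k, hk⟩ := hl.integral b hb _ h1
    exact ⟨k, fun i => by rw [← hk i]; simp⟩
  · rintro ⟨k, hk⟩
    exact hΨ.frameMap_mem_periodGroup hV (hl.period b hb) (k := k) fun i => by simp [hk i]

omit [T2Space M] in
/-- The trivialization of the foliation by the orbits over the domain of a frame of periods. -/
lemma IsPeriodFrame.exists_trivialization (hl : IsPeriodFrame Ψ B σ l)
    (hΨ : IsTubeAction f X R V Ψ) (hσ : IsLocalSection d f V B σ) (h : HasFlowBoxes f X R) :
    ∃ φ : OpenPartialHomeomorph M (Torus r × E s),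
      φ.source = {q | ∃ b ∈ B, ∃ v, Ψ v (σ b) = q} ∧ φ.target = Set.univ ×ˢ B ∧
      (∀ q ∈ φ.source, (φ q).2 = f q) ∧
      ContMDiffOn (𝓡 d) (torusModel r s) ∞ φ φ.source ∧
      ContMDiffOn (torusModel r s) (𝓡 d) ∞ φ.symm φ.target := by
  let A : E s → E r →L[ℝ] E r := fun b => frameMap (l b)
  have hA : ContDiffOn ℝ ∞ A B := contDiff_frameMap.comp_contDiffOn hl.smooth
  have hAinv : ∀ b ∈ B, ∀ v, A b ((A b).inverse v) = v := by
    intro b hb v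
    obtain ⟨e, he⟩ := hl.invertible b hb
    have : A b = e := he.symm
    rw [this, ContinuousLinearMap.inverse_equiv]
    exact e.apply_symm_apply v
  have hAinvs : ContDiffOn ℝ ∞ (fun b => (A b).inverse) B := by
    intro b hb
    obtain ⟨e, he⟩ := hl.invertible b hb
    have h1 : ContDiffAt ℝ ∞ ContinuousLinearMap.inverse (A b) := by
      change ContDiffAt ℝ ∞ ContinuousLinearMap.inverse (frameMap (l b))
      rw [← he]; exact contDiffAt_map_inverse e
    exact h1.comp_contDiffWithinAt b (hA b hb)
  let U : Set M := {q | ∃ b ∈ B, ∃ v, Ψ v (σ b) = q}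
  have hU : ∀ q ∈ U, f q ∈ B ∧ ∃ c, Ψ (A (f q) c) (σ (f q)) = q := by
    rintro _ ⟨b, hb, v, rfl⟩
    have h1 : f (Ψ v (σ b)) = b := by rw [hΨ.map_eq _ (hσ.mem b hb), hσ.apply_eq b hb]
    rw [h1]
    exact ⟨hb, (A b).inverse v, by rw [hAinv b hb]⟩
  have hloc : ∀ q ∈ U, ∃ (N : Set M) (u : M → E r), IsOpen N ∧ q ∈ N ∧ N ⊆ U ∧ N ⊆ R ∧
      ContMDiffOn (𝓡 d) 𝓘(ℝ, E r) ∞ u N ∧ ∀ q' ∈ N, Ψ (A (f q') (u q')) (σ (f q')) = q' := by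
    rintro _ ⟨b, hb, v, rfl⟩
    obtain ⟨N, u, hN, hvN, hNR, hu, -, hinv⟩ := hΨ.exists_local_inverse hσ h (v := v) hb
    refine ⟨N, fun q => (A (f q)).inverse (u q), hN, hvN,
      fun q hq => ⟨f q, (hinv q hq).1, u q, (hinv q hq).2⟩, hNR, ?_, ?_⟩
    · have h1 : ContMDiffOn (𝓡 d) 𝓘(ℝ, E r →L[ℝ] E r) ∞ (fun q => (A (f q)).inverse) N :=
        hAinvs.contMDiffOn.comp (h.contMDiffOn.mono hNR) fun q hq => (hinv q hq).1
      exact h1.clm_apply hu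
    · intro q hq
      rw [hAinv _ (hinv q hq).1]
      exact (hinv q hq).2
  have hc : ∀ q, ∃ c, q ∈ U → Ψ (A (f q) c) (σ (f q)) = q := by
    intro q
    by_cases hq : q ∈ U
    · obtain ⟨-, c, hc⟩ := hU q hq
      exact ⟨c, fun _ => hc⟩
    · exact ⟨0, fun h => absurd h hq⟩
  -- Neither `c` nor the section `a` below is continuous. Only `torusExp (c q)` and orbit points
  -- enter, and `apply_eq_apply_iff` allows replacing `c` and `a` locally by smooth choices.
  choose c hc using hc
  obtain ⟨a, ha, -⟩ := exists_torus_section (1 : Torus r)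
  have hfΘ : ∀ b ∈ B, ∀ v, f (Ψ v (σ b)) = b := fun b hb v => by
    rw [hΨ.map_eq _ (hσ.mem b hb), hσ.apply_eq b hb]
  have hs : ContMDiffOn (𝓡 d) (torusModel r s) ∞ (fun q => (torusExp (c q), f q)) U := by
    intro q hq
    obtain ⟨N, u, hN, hqN, hNU, hNR, hu, hinv⟩ := hloc q hq
    have h1 : ContMDiffAt (𝓡 d) (torusModel r s) ∞ (fun q => (torusExp (u q), f q)) q :=
      ContMDiffAt.prodMk
        ((contMDiff_torusExp (u q)).comp q (hu.contMDiffAt (hN.mem_nhds hqN)))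
        (h.contMDiffOn.contMDiffAt (h.isOpen.mem_nhds (hNR hqN)))
    refine (h1.congr_of_eventuallyEq ?_).contMDiffWithinAt
    filter_upwards [hN.mem_nhds hqN] with q' hq'
    refine Prod.ext ?_ rfl
    exact (hl.apply_eq_apply_iff hΨ hσ (hU q' (hNU hq')).1).1
      ((hc q' (hNU hq')).trans (hinv q' hq').symm)
  have hs' : ContMDiffOn (torusModel r s) (𝓡 d) ∞
      (fun x : Torus r × E s => Ψ (A x.2 (a x.1)) (σ x.2)) (Set.univ ×ˢ B) := by
    rintro ⟨z, b⟩ ⟨-, hb⟩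
    obtain ⟨a', ha', N, hN, hzN, has⟩ := exists_torus_section z
    have h0 : ContMDiffAt (torusModel r s) 𝓘(ℝ, E r →L[ℝ] E r) ∞
        (fun x : Torus r × E s => A x.2) (z, b) :=
      (hA.contDiffAt (hσ.isOpen.mem_nhds hb)).contMDiffAt.comp (z, b) contMDiffAt_snd
    have h1 : ContMDiffAt (torusModel r s) 𝓘(ℝ, E r) ∞
        (fun x : Torus r × E s => a' x.1) (z, b) :=
      (has.contMDiffAt (hN.mem_nhds hzN)).comp (z, b) contMDiffAt_fst
    have h2 : ContMDiffAt (torusModel r s) 𝓘(ℝ, E r × E s) ∞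
        (fun x : Torus r × E s => (A x.2 (a' x.1), x.2)) (z, b) :=
      (h0.clm_apply h1).prodMk_space contMDiffAt_snd
    have h3 := (hΨ.contMDiffAt_section hσ h (v := A b (a' z)) hb).comp (z, b) h2
    refine (h3.congr_of_eventuallyEq ?_).contMDiffWithinAt
    filter_upwards [continuousAt_snd.preimage_mem_nhds (hσ.isOpen.mem_nhds hb)] with x hx
    exact (hl.apply_eq_apply_iff hΨ hσ hx).2 (by rw [ha, ha'])
  let φ : OpenPartialHomeomorph M (Torus r × E s) :=
    { toFun := fun q => (torusExp (c q), f q)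
      invFun := fun x => Ψ (A x.2 (a x.1)) (σ x.2)
      source := U
      target := Set.univ ×ˢ B
      map_source' := fun q hq => ⟨trivial, (hU q hq).1⟩
      map_target' := fun x hx => ⟨x.2, hx.2, _, rfl⟩
      left_inv' := by
        intro q hq
        refine Eq.trans ?_ (hc q hq)
        exact (hl.apply_eq_apply_iff hΨ hσ (hU q hq).1).2 (ha _)
      right_inv' := by
        rintro ⟨z, b⟩ ⟨-, hb⟩
        have h1 := hfΘ b hb (A b (a z))
        have h2 := hc _ ⟨b, hb, A b (a z), rfl⟩
        rw [h1] at h2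
        refine Prod.ext ?_ h1
        exact ((hl.apply_eq_apply_iff hΨ hσ hb).1 h2).trans (ha z)
      open_source := by
        rw [isOpen_iff_mem_nhds]
        intro q hq
        obtain ⟨N, -, hN, hqN, hNU, -⟩ := hloc q hq
        exact Filter.mem_of_superset (hN.mem_nhds hqN) hNU
      open_target := isOpen_univ.prod hσ.isOpen
      continuousOn_toFun := hs.continuousOn
      continuousOn_invFun := hs'.continuousOn }
  exact ⟨φ, rfl, rfl, fun q _ => rfl, hs, hs'⟩

/-- Near a compact leaf, the foliation by the leaves is a trivial foliation by tori. -/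
theorem HasFlowBoxes.exists_trivialization (h : HasFlowBoxes f X R) {m : M} (hm : m ∈ R)
    (hc : IsCompact (tangentLeaf X R m)) :
    ∃ (ε : ℝ) (φ : OpenPartialHomeomorph M (Torus r × E s)), 0 < ε ∧
      tangentLeaf X R m ⊆ φ.source ∧ φ.source ⊆ R ∧
      φ.target = Set.univ ×ˢ Metric.ball (f m) ε ∧
      (∀ q ∈ φ.source, (φ q).2 = f q) ∧
      ContMDiffOn (𝓡 d) (torusModel r s) ∞ φ φ.source ∧
      ContMDiffOn (torusModel r s) (𝓡 d) ∞ φ.symm φ.target ∧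
      ∀ q ∈ φ.source, tangentLeaf X R q = {q' ∈ φ.source | f q' = f q} := by
  obtain ⟨V, Ψ, hΨ, hmV⟩ := h.exists_isTubeAction hm hc
  obtain ⟨β, hβ, hmβ, -⟩ := h m hm
  obtain ⟨B, σ, hσ, hmB, hσm⟩ := hβ.exists_isLocalSection hΨ.isOpen hmV hmβ
  obtain ⟨B', l, hB', hmB', hB'B, hl⟩ := hΨ.exists_isPeriodFrame hσ h hmB
    (by rw [hσm, ← hΨ.tangentLeaf_eq h hmV]; exact hc)
  obtain ⟨ε, hε, hball⟩ := Metric.isOpen_iff.1 hB' _ hmB'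
  have hσ' := hσ.mono Metric.isOpen_ball (hball.trans hB'B)
  obtain ⟨φ, h1, h2, h3, h4, h5⟩ := (hl.mono hball).exists_trivialization hΨ hσ' h
  have hV : ∀ q ∈ φ.source, q ∈ V := by
    rw [h1]
    rintro _ ⟨b, hb, v, rfl⟩
    exact hΨ.maps _ (hσ'.mem b hb) v
  refine ⟨ε, φ, hε, ?_, fun q hq => hΨ.subset (hV q hq), h2, h3, h4, h5, ?_⟩
  · rw [hΨ.tangentLeaf_eq h hmV, h1]
    rintro _ ⟨w, rfl⟩
    exact ⟨f m, Metric.mem_ball_self hε, w, by rw [hσm]⟩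
  · intro q hq
    rw [hΨ.tangentLeaf_eq h (hV q hq)]
    have hq' := hq
    rw [h1] at hq' ⊢
    obtain ⟨b, hb, v, rfl⟩ := hq'
    have hbV := hσ'.mem b hb
    ext q'
    constructor
    · rintro ⟨w, rfl⟩
      exact ⟨⟨b, hb, w + v, hΨ.add _ hbV w v⟩, hΨ.map_eq _ (hΨ.maps _ hbV v) w⟩
    · rintro ⟨⟨b', hb', v', rfl⟩, hf⟩
      rw [hΨ.map_eq _ hbV, hΨ.map_eq _ (hσ'.mem b' hb'), hσ'.apply_eq b hb,
        hσ'.apply_eq b' hb'] at hf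
      subst hf
      exact ⟨v' - v, by simp only [← hΨ.add _ hbV, sub_add_cancel]⟩

end Trivialization

/-! ### `b`-differentials and Hamiltonian vector fields. -/

section BCovectors

variable {d : ℕ} {M : Type*} [TopologicalSpace M] [ChartedSpace (E d) M]
  [IsManifold (𝓡 d) ∞ M] {Z : Set M}

lemma contMDiffOn_derivAlong {u : M → ℝ} {O : Set M} (hO : IsOpen O)
    (hu : ContMDiffOn (𝓡 d) 𝓘(ℝ, ℝ) ∞ u O) {X : Π q : M, TangentSpace (𝓡 d) q}
    (hX : ContMDiff (𝓡 d) (𝓡 d).tangent ∞ (fun q => (⟨q, X q⟩ : TangentBundle (𝓡 d) M))) :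
    ContMDiffOn (𝓡 d) 𝓘(ℝ, ℝ) ∞ (derivAlong X u) O := by
  intro p hp
  set χ : OpenPartialHomeomorph M (E d) := chartAt (E d) p with hχ
  have h : IsSmoothChart d χ := isSmoothChart_chartAt p
  have hpχ : p ∈ χ.source := mem_chart_source _ p
  have hu' : ContDiffAt ℝ ∞ (u ∘ χ.symm) (χ p) := by
    rw [← contMDiffAt_iff_contDiffAt]
    refine ContMDiffAt.comp (χ p) ?_ (h.contMDiffAt_symm (χ.map_source hpχ))
    rw [χ.left_inv hpχ]
    exact hu.contMDiffAt (hO.mem_nhds hp)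
  have h1 : ContDiffAt ℝ ∞ (fun y => fderiv ℝ (u ∘ χ.symm) y (chartField χ X y)) (χ p) :=
    (hu'.fderiv_right (m := ∞) (by simp)).clm_apply
      ((h.contDiffOn_chartField hX).contDiffAt (χ.open_target.mem_nhds (χ.map_source hpχ)))
  refine ((h1.contMDiffAt.comp p (h.contMDiffAt hpχ)).congr_of_eventuallyEq
    ?_).contMDiffWithinAt
  filter_upwards [hO.mem_nhds hp, χ.open_source.mem_nhds hpχ] with q h1 h2
  rw [derivAlong, h.mfderiv_eq_fderiv_chart h2
    ((hu.contMDiffAt (hO.mem_nhds h1)).mdifferentiableAt (by simp)), ← h.chartField_apply X h2]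
  rfl

lemma contMDiffOn_lieDeriv {u : M → ℝ} {O : Set M} (hO : IsOpen O)
    (hu : ContMDiffOn (𝓡 d) 𝓘(ℝ, ℝ) ∞ u O) (X : BVectorField d Z) :
    ContMDiffOn (𝓡 d) 𝓘(ℝ, ℝ) ∞ (lieDeriv X u) O :=
  contMDiffOn_derivAlong hO hu X.1.contMDiff

lemma lieDeriv_congr {u v : M → ℝ} {p : M} (h : u =ᶠ[𝓝 p] v) (X : BVectorField d Z) :
    lieDeriv X u p = lieDeriv X v p := by
  rw [lieDeriv, lieDeriv, h.mfderiv_eq]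
  rfl

lemma lieDeriv_neg (u : M → ℝ) (p : M) (X : BVectorField d Z) :
    lieDeriv X (fun q => -u q) p = -lieDeriv X u p := by
  have := mfderiv_neg (I := 𝓡 d) (f := u) (x := p)
  exact congrArg (fun L => L (X.1 p)) this

omit [IsManifold (𝓡 d) ∞ M] in
-- If `Z` contained a neighbourhood of `p`, then `h` would vanish near `p`, against `dh ≠ 0`.
-- Density of the complement makes the limits defining `b`-differentials unique.
lemma IsDefiningFunctionOn.neBot_nhdsWithin {U : Set M} {h : M → ℝ}
    (hh : IsDefiningFunctionOn d Z U h) {p : M} (hp : p ∈ U) : (𝓝[Zᶜ] p).NeBot := by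
  by_contra hne
  rw [Filter.not_neBot, ← Filter.empty_mem_iff_bot] at hne
  have h1 : ∀ᶠ q in 𝓝 p, q ∈ Z := by
    have h2 : ∀ᶠ q in 𝓝[Zᶜ] p, False := hne
    rw [eventually_nhdsWithin_iff] at h2
    filter_upwards [h2] with q hq using by_contra hq
  have h2 : h =ᶠ[𝓝 p] fun _ => 0 := by
    filter_upwards [h1, hh.isOpen.mem_nhds hp] with q h3 h4 using (hh.zero_iff q h4).2 h3
  refine hh.mfderiv_ne p ⟨hp, h1.self_of_nhds⟩ ?_
  rw [h2.mfderiv_eq]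
  exact mfderiv_const

namespace IsHypersurface

variable (hZ : IsHypersurface d Z)
include hZ

omit [IsManifold (𝓡 d) ∞ M] in
lemma isOpen_compl : IsOpen Zᶜ := hZ.isClosed.isOpen_compl

omit [IsManifold (𝓡 d) ∞ M] in
lemma neBot_nhdsWithin (p : M) : (𝓝[Zᶜ] p).NeBot := by
  by_cases hp : p ∈ Z
  · obtain ⟨U, h, hpU, hh⟩ := hZ.exists_defining p hp
    exact hh.neBot_nhdsWithin hpU
  · rw [hZ.isOpen_compl.nhdsWithin_eq hp]
    infer_instance

lemma bDifferential_unique {f : M → OnePoint ℝ} {p : M} {η η' : BCotangent d Z p}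
    (h : IsBDifferentialAt f p η) (h' : IsBDifferentialAt f p η') : η = η' := by
  have := hZ.neBot_nhdsWithin p
  ext Y
  exact tendsto_nhds_unique (h Y) (h' Y)

lemma bDifferential_eq {f : M → OnePoint ℝ} {p : M} {η : BCotangent d Z p}
    (h : IsBDifferentialAt f p η) : bDifferential d Z f p = η := by
  have h1 : ∃ η : BCotangent d Z p, IsBDifferentialAt f p η := ⟨η, h⟩
  rw [bDifferential, dif_pos h1]
  exact hZ.bDifferential_unique h1.choose_spec h

/-- The `b`-differential of a function which is smooth near `p`. -/
lemma exists_isBDifferentialAt {f : M → OnePoint ℝ} {g : M → ℝ} {O : Set M} (hO : IsOpen O)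
    (hg : ContMDiffOn (𝓡 d) 𝓘(ℝ, ℝ) ∞ g O) (hfg : ∀ q ∈ O, q ∉ Z → finitePart f q = g q)
    {p : M} (hp : p ∈ O) :
    ∃ η : BCotangent d Z p, IsBDifferentialAt f p η ∧ ∀ Y, η (bValue p Y) = lieDeriv Y g p := by
  let L : BVectorField d Z →ₗ[ℝ] ℝ :=
    { toFun := fun Y => lieDeriv Y g p
      map_add' := fun Y W => map_add (mfderiv (𝓡 d) 𝓘(ℝ, ℝ) g p) (Y.1 p) (W.1 p)
      map_smul' := fun c Y => map_smul (mfderiv (𝓡 d) 𝓘(ℝ, ℝ) g p) c (Y.1 p) }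
  have hL : vanishingAt d Z p ≤ LinearMap.ker L := by
    refine Submodule.span_le.2 ?_
    rintro Y ⟨u, X, hu, hY⟩
    change mfderiv (𝓡 d) 𝓘(ℝ, ℝ) g p (Y.1 p) = 0
    rw [hY p, hu, zero_smul]
    exact map_zero (mfderiv (𝓡 d) 𝓘(ℝ, ℝ) g p)
  refine ⟨(vanishingAt d Z p).liftQ L hL, fun Y => ?_, fun Y => rfl⟩
  have h1 : ContinuousAt (lieDeriv Y g) p :=
    (contMDiffOn_lieDeriv hO hg Y).continuousOn.continuousAt (hO.mem_nhds hp)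
  refine (h1.tendsto.mono_left nhdsWithin_le_nhds).congr' ?_
  filter_upwards [self_mem_nhdsWithin, mem_nhdsWithin_of_mem_nhds (hO.mem_nhds hp)] with q h2 h3
  refine lieDeriv_congr ?_ Y
  filter_upwards [hZ.isOpen_compl.mem_nhds h2, hO.mem_nhds h3] with q' h4 h5
  exact (hfg q' h5 h4).symm

lemma apply_bValue_eq {f : M → OnePoint ℝ} {g : M → ℝ} {O : Set M} (hO : IsOpen O)
    (hg : ContMDiffOn (𝓡 d) 𝓘(ℝ, ℝ) ∞ g O) (hfg : ∀ q ∈ O, q ∉ Z → finitePart f q = g q)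
    {p : M} (hp : p ∈ O) {η : BCotangent d Z p} (hη : IsBDifferentialAt f p η)
    (Y : BVectorField d Z) : η (bValue p Y) = lieDeriv Y g p := by
  obtain ⟨η', h1, h2⟩ := hZ.exists_isBDifferentialAt hO hg hfg hp
  rw [hZ.bDifferential_unique hη h1, h2]

/-- `b`-differentials are linear in the function. -/
lemma isBDifferentialAt_combination {f f₁ f₂ : M → OnePoint ℝ} {a b : ℝ}
    (hf : ∀ q ∉ Z, finitePart f q = a * finitePart f₁ q + b * finitePart f₂ q)
    (hf₁ : ContMDiffOn (𝓡 d) 𝓘(ℝ, ℝ) ∞ (finitePart f₁) Zᶜ)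
    (hf₂ : ContMDiffOn (𝓡 d) 𝓘(ℝ, ℝ) ∞ (finitePart f₂) Zᶜ) {p : M} {η₁ η₂ : BCotangent d Z p}
    (h₁ : IsBDifferentialAt f₁ p η₁) (h₂ : IsBDifferentialAt f₂ p η₂) :
    IsBDifferentialAt f p (a • η₁ + b • η₂) := by
  intro Y
  refine (((h₁ Y).const_mul a).add ((h₂ Y).const_mul b)).congr' ?_
  filter_upwards [self_mem_nhdsWithin] with q hq
  have hd₁ : MDifferentiableAt (𝓡 d) 𝓘(ℝ, ℝ) (finitePart f₁) q :=
    (hf₁.contMDiffAt (hZ.isOpen_compl.mem_nhds hq)).mdifferentiableAt (by simp)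
  have hd₂ : MDifferentiableAt (𝓡 d) 𝓘(ℝ, ℝ) (finitePart f₂) q :=
    (hf₂.contMDiffAt (hZ.isOpen_compl.mem_nhds hq)).mdifferentiableAt (by simp)
  have h3 : finitePart f =ᶠ[𝓝 q] a • finitePart f₁ + b • finitePart f₂ := by
    filter_upwards [hZ.isOpen_compl.mem_nhds hq] with q' hq' using hf q' hq'
  let L₁ : E d →L[ℝ] ℝ := mfderiv (𝓡 d) 𝓘(ℝ, ℝ) (finitePart f₁) q
  let L₂ : E d →L[ℝ] ℝ := mfderiv (𝓡 d) 𝓘(ℝ, ℝ) (finitePart f₂) q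
  have h4 : mfderiv (𝓡 d) 𝓘(ℝ, ℝ) (a • finitePart f₁ + b • finitePart f₂) q = a • L₁ + b • L₂ :=
    ((hd₁.hasMFDerivAt.const_smul a).add (hd₂.hasMFDerivAt.const_smul b)).mfderiv
  rw [lieDeriv_congr h3]
  exact (congrArg (fun L : E d →L[ℝ] ℝ => L (Y.1 q)) h4).symm

end IsHypersurface

/-- The anchor map from the `b`-tangent space to the tangent space is well defined. -/
lemma apply_eq_zero_of_bValue_eq_zero {p : M} {Y : BVectorField d Z} (h : bValue p Y = 0) :
    Y.1 p = 0 := by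
  have h1 : Y ∈ vanishingAt d Z p := (Submodule.Quotient.mk_eq_zero _).1 h
  refine Submodule.span_induction (p := fun Y _ => Y.1 p = 0) ?_ rfl ?_ ?_ h1
  · rintro Y ⟨u, X, hu, hY⟩
    rw [hY p, hu, zero_smul]
  · intro Y W _ _ hY hW
    change Y.1 p + W.1 p = 0
    rw [hY, hW, add_zero]
  · intro c Y _ hY
    change c • Y.1 p = 0
    rw [hY, smul_zero]

namespace BSymplecticForm

variable (Ω : BSymplecticForm d Z)

lemma neg_swap (p : M) (v w : BTangent d Z p) : -Ω.form p v w = Ω.form p w v := by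
  have h := Ω.alternating p (v + w)
  simp only [map_add, LinearMap.add_apply, Ω.alternating, zero_add, add_zero] at h
  linarith

lemma eq_of_forall_bValue {X Y : BVectorField d Z} {p : M}
    (h : ∀ W : BVectorField d Z, Ω.form p (bValue p X) (bValue p W) =
      Ω.form p (bValue p Y) (bValue p W)) : X.1 p = Y.1 p := by
  have h1 : bValue p (X - Y) = 0 := by
    refine Ω.nondegenerate p _ fun w => ?_
    obtain ⟨W, rfl⟩ := (vanishingAt d Z p).mkQ_surjective w
    rw [map_sub, map_sub, LinearMap.sub_apply, sub_eq_zero]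
    exact h W
  exact sub_eq_zero.1 (apply_eq_zero_of_bValue_eq_zero h1)

variable {Ω}

lemma hamiltonianVF_eq (hZ : IsHypersurface d Z) {f : M → OnePoint ℝ} {X : BVectorField d Z}
    (h : IsHamiltonianVectorField Ω f X) : hamiltonianVF Ω f = X := by
  have h1 : ∃ X, IsHamiltonianVectorField Ω f X := ⟨X, h⟩
  rw [hamiltonianVF, dif_pos h1]
  refine Subtype.ext (ContMDiffSection.ext fun p => Ω.eq_of_forall_bValue fun W => ?_)
  have h2 := hZ.bDifferential_unique (h1.choose_spec p) (h p)
  exact congrArg (fun η : BCotangent d Z p => η (bValue p W)) (neg_injective h2)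

/-- Zero is the default value of `hamiltonianVF`, so a nonzero value certifies existence. -/
lemma isHamiltonianVectorField_of_ne_zero {f : M → OnePoint ℝ} (h : hamiltonianVF Ω f ≠ 0) :
    IsHamiltonianVectorField Ω f (hamiltonianVF Ω f) := by
  have h1 : ∃ X, IsHamiltonianVectorField Ω f X := by
    by_contra h2
    exact h (by rw [hamiltonianVF, dif_neg h2])
  rw [hamiltonianVF, dif_pos h1]
  exact h1.choose_spec

end BSymplecticForm

lemma finitePart_eq {M : Type*} {f : M → OnePoint ℝ} {p : M} {x : ℝ} (h : f p = (x : OnePoint ℝ)) :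
    finitePart f p = x := by
  rw [finitePart, h]
  rfl

omit [IsManifold (𝓡 d) ∞ M] in
lemma IsDefiningFunctionOn.contMDiffAt_log {U : Set M} {h : M → ℝ}
    (hh : IsDefiningFunctionOn d Z U h) {p : M} (hpU : p ∈ U) (hp : p ∉ Z) :
    ContMDiffAt (𝓡 d) 𝓘(ℝ, ℝ) ∞ (fun q => Real.log |h q|) p := by
  simp only [Real.log_abs]
  have h1 : h p ≠ 0 := fun h0 => hp ((hh.zero_iff p hpU).1 h0)
  exact (Real.contDiffAt_log.2 h1).contMDiffAt.comp p
    (hh.smooth.contMDiffAt (hh.isOpen.mem_nhds hpU))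

omit [IsManifold (𝓡 d) ∞ M] in
lemma IsBFunction.contMDiffOn_finitePart {f : M → OnePoint ℝ} (hf : IsBFunction d Z f) :
    ContMDiffOn (𝓡 d) 𝓘(ℝ, ℝ) ∞ (finitePart f) Zᶜ := by
  rcases hf with ⟨g, hg, hfg⟩ | ⟨c, h, g, -, hh, hg, -, hfg⟩
  · exact hg.contMDiffOn.congr fun p _ => finitePart_eq (hfg p)
  · refine ContMDiffOn.congr (f := fun p => c * Real.log |h p| + g p) ?_
      fun p hp => finitePart_eq (hfg p hp)
    intro p hp
    have h1 : ContMDiffAt (𝓡 d) 𝓘(ℝ, ℝ) ∞ (fun q => c * Real.log |h q| + g q) p :=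
      ((contMDiffAt_const (c := c)).mul (hh.contMDiffAt_log trivial hp)).add (hg p)
    exact h1.contMDiffWithinAt

end BCovectors

/-! ### Linear algebra of covectors. -/

section LinearAlgebra

lemma surjective_pi_of_linearIndependent {V : Type*} [AddCommGroup V] [Module ℝ V] {k : ℕ}
    {η : Fin k → Module.Dual ℝ V} (h : LinearIndependent ℝ η) :
    Function.Surjective (LinearMap.pi η) := by
  rw [← LinearMap.range_eq_top]
  by_contra hne
  obtain ⟨g, hg0, hg⟩ := Submodule.exists_le_ker_of_lt_top _ (lt_top_iff_ne_top.2 hne)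
  have hgx : ∀ x : Fin k → ℝ, g x = ∑ i, g (Pi.single i 1) * x i := by
    intro x
    conv_lhs => rw [← Finset.univ_sum_single x]
    rw [map_sum]
    refine Finset.sum_congr rfl fun i _ => ?_
    rw [mul_comm, ← smul_eq_mul, ← map_smul, ← Pi.single_smul, smul_eq_mul, mul_one]
  apply hg0
  have h1 : ∑ i, g (Pi.single i 1) • η i = 0 := by
    ext v
    have h2 : g (LinearMap.pi η v) = 0 := hg ⟨v, rfl⟩
    rw [hgx] at h2
    simpa using h2
  have h3 := Fintype.linearIndependent_iff.1 h _ h1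
  refine LinearMap.ext fun x => ?_
  rw [hgx]
  simp [h3]

/-- The `ξ j` lie in the annihilator of the span of the `x i`, whose dimension is the codimension of
that span. -/
lemma card_add_card_le_finrank {V : Type*} [AddCommGroup V] [Module ℝ V]
    [FiniteDimensional ℝ V] {κ ι : Type*} [Fintype κ] [Fintype ι] {ξ : κ → Module.Dual ℝ V}
    {x : ι → V} (hξ : LinearIndependent ℝ ξ) (hx : LinearIndependent ℝ x)
    (h : ∀ j i, ξ j (x i) = 0) :
    Fintype.card κ + Fintype.card ι ≤ Module.finrank ℝ V := by
  let W := Submodule.span ℝ (Set.range x)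
  have h1 : ∀ j, ξ j ∈ W.dualAnnihilator := by
    intro j
    rw [Submodule.mem_dualAnnihilator]
    intro w hw
    have : W ≤ LinearMap.ker (ξ j) := by
      refine Submodule.span_le.2 ?_
      rintro _ ⟨i, rfl⟩
      exact h j i
    exact this hw
  have h2 : Fintype.card κ ≤ Module.finrank ℝ W.dualAnnihilator := by
    rw [← finrank_span_eq_card hξ]
    refine Submodule.finrank_mono (Submodule.span_le.2 ?_)
    rintro _ ⟨j, rfl⟩
    exact h1 j
  have h3 := Subspace.finrank_add_finrank_dualAnnihilator_eq W
  rw [finrank_span_eq_card hx] at h3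
  omega

end LinearAlgebra

/-! ### Integrable systems: openness, commutation, existence of a singular function. -/

section System

variable {d : ℕ} {M : Type*} [TopologicalSpace M] [ChartedSpace (E d) M]
  [IsManifold (𝓡 d) ∞ M] {Z : Set M} {Ω : BSymplecticForm d Z} {r s : ℕ}
  {F : Fin s → M → OnePoint ℝ}

/-- The Lie bracket of the Hamiltonian vector fields of two functions in involution is in the
kernel of the form. -/
lemma BSymplecticForm.form_bBracket_eq_zero (Ω : BSymplecticForm d Z) {O : Set M} (hO : IsOpen O)
    {u v : M → ℝ} (hu : ContMDiffOn (𝓡 d) 𝓘(ℝ, ℝ) ∞ u O) (hv : ContMDiffOn (𝓡 d) 𝓘(ℝ, ℝ) ∞ v O)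
    {X Y : BVectorField d Z}
    (hX : ∀ q ∈ O, ∀ W : BVectorField d Z, Ω.form q (bValue q X) (bValue q W) = -lieDeriv W u q)
    (hY : ∀ q ∈ O, ∀ W : BVectorField d Z, Ω.form q (bValue q Y) (bValue q W) = -lieDeriv W v q)
    (hXv : ∀ q ∈ O, lieDeriv X v q = 0) (hYu : ∀ q ∈ O, lieDeriv Y u q = 0)
    (W : BVectorField d Z) {q : M} (hq : q ∈ O) :
    Ω.form q (bValue q (bBracket X Y)) (bValue q W) = 0 := by
  have hconst : ∀ {w : M → ℝ}, (∀ q ∈ O, w q = 0) → lieDeriv W w q = 0 := by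
    intro w hw
    have h1 : w =ᶠ[𝓝 q] fun _ => 0 := by
      filter_upwards [hO.mem_nhds hq] with q' hq' using hw q' hq'
    rw [lieDeriv_congr h1, lieDeriv, mfderiv_const]
    rfl
  have e1 : lieDeriv X (fun q => Ω.form q (bValue q Y) (bValue q W)) q =
      -lieDeriv X (lieDeriv W v) q := by
    rw [← lieDeriv_neg]
    refine lieDeriv_congr ?_ X
    filter_upwards [hO.mem_nhds hq] with q' hq' using hY q' hq' W
  have e2 : lieDeriv Y (fun q => Ω.form q (bValue q X) (bValue q W)) q =
      -lieDeriv Y (lieDeriv W u) q := by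
    rw [← lieDeriv_neg]
    refine lieDeriv_congr ?_ Y
    filter_upwards [hO.mem_nhds hq] with q' hq' using hX q' hq' W
  have e3 : lieDeriv W (fun q => Ω.form q (bValue q X) (bValue q Y)) q = 0 :=
    hconst fun q' hq' => by rw [hX q' hq' Y, hYu q' hq', neg_zero]
  -- Since `X v = 0`, this term cancels the derivative in `e1`; likewise `e5` cancels `e2`. In
  -- `Ω.closed` only the term with the bracket of `X` and `Y` survives.
  have e4 : Ω.form q (bValue q (bBracket X W)) (bValue q Y) = lieDeriv X (lieDeriv W v) q := by
    have h1 : lieDeriv (bBracket X W) v q =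
        lieDeriv X (lieDeriv W v) q - lieDeriv W (lieDeriv X v) q :=
      mfderiv_mlieBracket_apply hO hv X.1.contMDiff W.1.contMDiff hq
    rw [← Ω.neg_swap, hY q hq, neg_neg, h1, hconst hXv, sub_zero]
  have e5 : Ω.form q (bValue q (bBracket Y W)) (bValue q X) = lieDeriv Y (lieDeriv W u) q := by
    have h1 : lieDeriv (bBracket Y W) u q =
        lieDeriv Y (lieDeriv W u) q - lieDeriv W (lieDeriv Y u) q :=
      mfderiv_mlieBracket_apply hO hu Y.1.contMDiff W.1.contMDiff hq
    rw [← Ω.neg_swap, hX q hq, neg_neg, h1, hconst hYu, sub_zero]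
  have key : ∀ {a b c a' b' c' : ℝ}, a - b + c - c' + b' - a' = 0 → a = -b' → b = -a' → c = 0 →
      c' = 0 := by
    intros
    linarith
  exact key (Ω.closed X Y W q) (e1.trans (congrArg Neg.neg e4.symm))
    (e2.trans (congrArg Neg.neg e5.symm)) e3

namespace IsIntegrableSystem

variable (hF : IsIntegrableSystem Ω r F)
include hF

lemma isBFunction (i : Fin s) : IsBFunction d Z (F i) :=
  (lt_or_ge i.val r).elim (hF.bFunction i) fun h => Or.inl (hF.smoothFun i h)

lemma contMDiffOn_finitePart (i : Fin s) :
    ContMDiffOn (𝓡 d) 𝓘(ℝ, ℝ) ∞ (finitePart (F i)) Zᶜ :=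
  (hF.isBFunction i).contMDiffOn_finitePart

/-- Independence of the Hamiltonian fields at one point shows that none of them is the default value
`0`, so they are genuine. -/
lemma isHamiltonianVectorField {i : Fin s} (hi : i.val < r) :
    IsHamiltonianVectorField Ω (F i) (hamiltonianVF Ω (F i)) := by
  obtain ⟨p, -, hp⟩ := hF.hamiltonian_independent
  refine BSymplecticForm.isHamiltonianVectorField_of_ne_zero fun h0 => ?_
  refine hp.ne_zero ⟨i, hi⟩ ?_
  change (hamiltonianVF Ω (F i)).1 p = 0
  rw [h0]
  rfl

variable (hZ : IsHypersurface d Z)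
include hZ

lemma isBDifferentialAt (i : Fin s) (p : M) :
    IsBDifferentialAt (F i) p (bDifferential d Z (F i) p) := by
  rcases lt_or_ge i.val r with hi | hi
  · have h := hF.isHamiltonianVectorField hi p
    rwa [hZ.bDifferential_eq h]
  · obtain ⟨g, hg, hfg⟩ := hF.smoothFun i hi
    obtain ⟨η, hη, -⟩ := hZ.exists_isBDifferentialAt (f := F i) isOpen_univ hg.contMDiffOn
      (fun q _ _ => finitePart_eq (hfg q)) (Set.mem_univ p)
    rwa [hZ.bDifferential_eq hη]

lemma bDifferential_eq_form {i : Fin s} (hi : i.val < r) (p : M) :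
    bDifferential d Z (F i) p = -Ω.form p (bValue p (hamiltonianVF Ω (F i))) :=
  hZ.bDifferential_eq (hF.isHamiltonianVectorField hi p)

lemma bDifferential_apply_smooth {i : Fin s} {g : M → ℝ}
    (hg : ContMDiff (𝓡 d) 𝓘(ℝ, ℝ) ∞ g) (hfg : ∀ p ∉ Z, F i p = (g p : OnePoint ℝ)) (p : M)
    (Y : BVectorField d Z) : bDifferential d Z (F i) p (bValue p Y) = lieDeriv Y g p :=
  hZ.apply_bValue_eq isOpen_univ hg.contMDiffOn (fun q _ hq => finitePart_eq (hfg q hq))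
    (Set.mem_univ p) (hF.isBDifferentialAt hZ i p) Y

lemma bDifferential_apply_of_notMem (i : Fin s) {p : M} (hp : p ∉ Z) (Y : BVectorField d Z) :
    bDifferential d Z (F i) p (bValue p Y) = lieDeriv Y (finitePart (F i)) p :=
  hZ.apply_bValue_eq hZ.isOpen_compl (hF.contMDiffOn_finitePart i) (fun _ _ _ => rfl) hp
    (hF.isBDifferentialAt hZ i p) Y

lemma continuous_bDifferential_apply (i : Fin s) (Y : BVectorField d Z) :
    Continuous fun p => bDifferential d Z (F i) p (bValue p Y) := by
  rcases lt_or_ge i.val r with hi | hi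
  · have h : (fun p => bDifferential d Z (F i) p (bValue p Y)) = fun p =>
        -Ω.form p (bValue p (hamiltonianVF Ω (F i))) (bValue p Y) := by
      funext p
      rw [hF.bDifferential_eq_form hZ hi]
      rfl
    rw [h]
    exact (Ω.smooth _ _).continuous.neg
  · obtain ⟨g, hg, hfg⟩ := hF.smoothFun i hi
    simp only [hF.bDifferential_apply_smooth hZ hg fun p _ => hfg p]
    exact (contMDiffOn_univ.1 (contMDiffOn_lieDeriv isOpen_univ hg.contMDiffOn Y)).continuous

/-- Choose `b`-vector fields dual at `p` to the given covectors. The matrix of pairings is the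
identity at `p` and depends continuously on the point, so no local frame of the `b`-tangent bundle
is needed. -/
lemma isOpen_independentSet : IsOpen (independentSet d Z F) := by
  rw [isOpen_iff_mem_nhds]
  intro p hp
  choose v hv using fun k => surjective_pi_of_linearIndependent (η := fun i =>
    bDifferential d Z (F i) p) hp (Pi.single k 1)
  choose Y hY using fun k => (vanishingAt d Z p).mkQ_surjective (v k)
  let A : M → Matrix (Fin s) (Fin s) ℝ := fun q => Matrix.of fun i k =>
    bDifferential d Z (F i) q (bValue q (Y k))
  have hA : Continuous fun q => (A q).det :=
    Continuous.matrix_det (continuous_matrix fun i k => hF.continuous_bDifferential_apply hZ i _)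
  have hAp : A p = 1 := by
    ext i k
    have h1 : bDifferential d Z (F i) p (bValue p (Y k)) =
        bDifferential d Z (F i) p (v k) := congrArg _ (hY k)
    have h2 := congrFun (hv k) i
    change bDifferential d Z (F i) p (bValue p (Y k)) = _
    rw [h1]
    refine h2.trans ?_
    rw [Pi.single_apply, Matrix.one_apply]
  have h1 : ∀ᶠ q in 𝓝 p, (A q).det ≠ 0 := by
    refine hA.continuousAt.eventually_ne ?_
    simp [hAp]
  filter_upwards [h1] with q hq
  refine Fintype.linearIndependent_iff.2 fun a ha => ?_
  refine congrFun (Matrix.eq_zero_of_vecMul_eq_zero hq ?_)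
  funext k
  have h2 := congrArg (fun η : BCotangent d Z q => η (bValue q (Y k))) ha
  simpa [Matrix.vecMul, dotProduct, A] using h2

omit hZ hF in
lemma _root_.BSymp.isOpen_hamiltonianIndependentSet :
    IsOpen (hamiltonianIndependentSet Ω r F) := by
  rw [isOpen_iff_mem_nhds]
  intro p hp
  set χ : OpenPartialHomeomorph M (E d) := chartAt (E d) p with hχ
  have h : IsSmoothChart d χ := isSmoothChart_chartAt p
  have hpχ : p ∈ χ.source := mem_chart_source _ p
  let Y : {i : Fin s // i.val < r} → Π q : M, TangentSpace (𝓡 d) q := fun i q =>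
    (hamiltonianVF Ω (F i)).1 q
  have h1 : LinearIndependent ℝ fun i => chartField χ (Y i) (χ p) :=
    h.linearIndependent_chartField hpχ hp
  have h2 : ContinuousAt (fun q => fun i => chartField χ (Y i) (χ q)) p := by
    refine continuousAt_pi.2 fun i => ?_
    refine ContinuousAt.comp (f := χ) ?_ (χ.continuousAt hpχ)
    exact (h.contDiffOn_chartField (hamiltonianVF Ω (F i)).1.contMDiff).continuousOn.continuousAt
      (χ.open_target.mem_nhds (χ.map_source hpχ))
  filter_upwards [h2.preimage_mem_nhds (isOpen_setOfPred_linearIndependent.mem_nhds h1),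
    χ.open_source.mem_nhds hpχ] with q h3 h4
  let L : TangentSpace (𝓡 d) q →L[ℝ] E d := mfderiv (𝓡 d) 𝓘(ℝ, E d) χ q
  refine LinearIndependent.of_comp L.toLinearMap ?_
  have h5 : (⇑L.toLinearMap ∘ fun i => Y i q) = fun i => chartField χ (Y i) (χ q) :=
    funext fun i => (h.chartField_apply (Y i) h4).symm
  change LinearIndependent ℝ (⇑L.toLinearMap ∘ fun i => Y i q)
  rw [h5]
  exact h3

lemma isOpen_regularSet : IsOpen (regularSet Ω r F) :=
  (hF.isOpen_independentSet hZ).inter isOpen_hamiltonianIndependentSet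

/-- The Hamiltonian vector fields of functions in involution commute. -/
lemma bBracket_eq_zero {i k : Fin s} (hi : i.val < r) (hk : k.val < r) (p : M) :
    (bBracket (hamiltonianVF Ω (F i)) (hamiltonianVF Ω (F k))).1 p = 0 := by
  have hform : ∀ {j : Fin s}, j.val < r → ∀ q ∈ Zᶜ, ∀ W : BVectorField d Z,
      Ω.form q (bValue q (hamiltonianVF Ω (F j))) (bValue q W) =
        -lieDeriv W (finitePart (F j)) q := by
    intro j hj q hq W
    rw [← hF.bDifferential_apply_of_notMem hZ j hq W, hF.bDifferential_eq_form hZ hj]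
    simp
  have hinv : ∀ {j l : Fin s}, j.val < r → ∀ q ∈ Zᶜ,
      lieDeriv (hamiltonianVF Ω (F j)) (finitePart (F l)) q = 0 := by
    intro j l hj q hq
    rw [← hF.bDifferential_apply_of_notMem hZ l hq]
    exact hF.involution j l hj q
  refine Ω.eq_of_forall_bValue (Y := (0 : BVectorField d Z)) fun W => ?_
  rw [map_zero, map_zero, LinearMap.zero_apply]
  -- The functions are smooth only off `Z`, so the bracket is paired with `W` there; the pairing is
  -- continuous, hence vanishes on `Z` too.
  have := hZ.neBot_nhdsWithin p
  refine tendsto_nhds_unique (l := 𝓝[Zᶜ] p)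
    (((Ω.smooth _ W).continuous.tendsto p).mono_left nhdsWithin_le_nhds)
    (tendsto_const_nhds.congr' ?_)
  filter_upwards [self_mem_nhdsWithin (s := Zᶜ)] with q hq
  exact (Ω.form_bBracket_eq_zero hZ.isOpen_compl (hF.contMDiffOn_finitePart i)
    (hF.contMDiffOn_finitePart k) (hform hi) (hform hk) (hinv hi) (hinv hk) W hq).symm

/-- One of the first `r` functions has a singularity along `Z`. -/
lemma exists_not_isSmoothFun {m : M} (hmZ : m ∈ Z) (hm : m ∈ regularSet Ω r F) :
    ∃ j : Fin s, j.val < r ∧ ¬ IsSmoothFun d (F j) := by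
  -- For smooth functions the `b`-differentials at `m` see only the ordinary differentials on
  -- vectors tangent to `Z`. Their independence therefore makes the `dg_i` independent even together
  -- with `dh`. All `s + 1` covectors annihilate the `r` Hamiltonian vectors, which is too many in
  -- dimension `r + s`.
  by_contra! hsm
  have hsm' : ∀ i, IsSmoothFun d (F i) := fun i =>
    (lt_or_ge i.val r).elim (hsm i) (hF.smoothFun i)
  choose g hg hfg using hsm'
  have hval : ∀ i (Y : BVectorField d Z), bDifferential d Z (F i) m (bValue m Y) =
      lieDeriv Y (g i) m := fun i Y =>
    hF.bDifferential_apply_smooth hZ (hg i) (fun p _ => hfg i p) m Y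
  obtain ⟨U, h, hmU, hh⟩ := hZ.exists_defining m hmZ
  let ξ₀ : E d →L[ℝ] ℝ := mfderiv (𝓡 d) 𝓘(ℝ, ℝ) h m
  let ξ₁ : Fin s → E d →L[ℝ] ℝ := fun i => mfderiv (𝓡 d) 𝓘(ℝ, ℝ) (g i) m
  let ξ : Option (Fin s) → Module.Dual ℝ (E d) := fun o => (o.elim ξ₀ ξ₁).toLinearMap
  let x : {i : Fin s // i.val < r} → E d := fun i => (hamiltonianVF Ω (F i)).1 m
  have hξ : LinearIndependent ℝ ξ := by
    refine Fintype.linearIndependent_iff.2 fun a ha => ?_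
    rw [Fintype.sum_option] at ha
    have h0 : ∀ v : E d, ξ none v = 0 → ∑ i, a (some i) * ξ (some i) v = 0 := by
      intro v hv
      have h2 := congrArg (fun L : Module.Dual ℝ (E d) => L v) ha
      simpa [hv] using h2
    have h1 : ∑ i, a (some i) • bDifferential d Z (F i) m = 0 := by
      ext Y
      have h4 : ∀ i, bDifferential d Z (F i) m (bValue m Y) = ξ (some i) (Y.1 m) := fun i =>
        hval i Y
      have h5 : ∑ i, a (some i) * bDifferential d Z (F i) m (bValue m Y) = 0 := by
        simp only [h4]
        exact h0 (Y.1 m) (Y.2 m hmZ U h hmU hh)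
      refine Eq.trans ?_ h5
      rw [LinearMap.comp_apply, LinearMap.sum_apply]
      rfl
    have h6 := Fintype.linearIndependent_iff.1 hm.1 _ h1
    simp only [h6, zero_smul, Finset.sum_const_zero, add_zero, smul_eq_zero] at ha
    have h7 : ξ none ≠ 0 := by
      intro h0
      refine hh.mfderiv_ne m ⟨hmU, hmZ⟩ (ContinuousLinearMap.ext fun v => ?_)
      exact congrArg (fun L : Module.Dual ℝ (E d) => L v) h0
    rintro (_ | i)
    exacts [ha.resolve_right h7, h6 i]
  have hann : ∀ j i, ξ j (x i) = 0 := by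
    rintro (_ | j) ⟨i, hi⟩
    · exact (hamiltonianVF Ω (F i)).2 m hmZ U h hmU hh
    · exact (hval j _).symm.trans (hF.involution i j hi m)
  have hcard := card_add_card_le_finrank hξ hm.2 hann
  have hr : Fintype.card {i : Fin s // i.val < r} = r := by
    rw [Fintype.card_congr (Fin.castLEquiv hF.rank_le).symm, Fintype.card_fin]
  rw [Fintype.card_option, Fintype.card_fin, hr, finrank_euclideanSpace_fin] at hcard
  have := hF.dim_eq
  omega

end IsIntegrableSystem

end System

/-! ### Defining functions and the singular part of a `b`-function. -/

section Extension

variable {d : ℕ} {M : Type*} [TopologicalSpace M] [ChartedSpace (E d) M] {Z : Set M}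

/-- A function off `Z` which extends smoothly over `Z` near each point extends smoothly. -/
lemma IsHypersurface.exists_contMDiff_extension (hZ : IsHypersurface d Z) {u : M → ℝ}
    (h : ∀ p, ∃ (U : Set M) (v : M → ℝ), IsOpen U ∧ p ∈ U ∧ ContMDiffOn (𝓡 d) 𝓘(ℝ, ℝ) ∞ v U ∧
      ∀ q ∈ U, q ∉ Z → u q = v q) :
    ∃ w : M → ℝ, ContMDiff (𝓡 d) 𝓘(ℝ, ℝ) ∞ w ∧ ∀ q ∉ Z, w q = u q := by
  have hw : ∀ {U : Set M} {v : M → ℝ}, IsOpen U → ContMDiffOn (𝓡 d) 𝓘(ℝ, ℝ) ∞ v U →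
      (∀ q ∈ U, q ∉ Z → u q = v q) → ∀ q ∈ U, extendFrom Zᶜ u q = v q := by
    intro U v hU hv huv q hq
    have := hZ.neBot_nhdsWithin q
    refine extendFrom_eq (mem_closure_iff_nhdsWithin_neBot.2 this) ?_
    refine ((hv.continuousOn.continuousAt (hU.mem_nhds hq)).tendsto.mono_left
      nhdsWithin_le_nhds).congr' ?_
    filter_upwards [self_mem_nhdsWithin, mem_nhdsWithin_of_mem_nhds (hU.mem_nhds hq)]
      with q' h1 h2 using (huv q' h2 h1).symm
  refine ⟨extendFrom Zᶜ u, fun p => ?_, fun q hq => ?_⟩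
  · obtain ⟨U, v, hU, hpU, hv, huv⟩ := h p
    refine (hv.contMDiffAt (hU.mem_nhds hpU)).congr_of_eventuallyEq ?_
    filter_upwards [hU.mem_nhds hpU] with q hq using hw hU hv huv q hq
  · obtain ⟨U, v, hU, hqU, hv, huv⟩ := h q
    rw [hw hU hv huv q hqU, huv q hqU hq]

variable [IsManifold (𝓡 d) ∞ M]

/-- The quotient of two local defining functions is smooth and does not vanish. -/
lemma IsDefiningFunctionOn.exists_eq_mul {U : Set M} {h k : M → ℝ}
    (hh : IsDefiningFunctionOn d Z U h) (hk : IsDefiningFunctionOn d Z U k) {p : M} (hpU : p ∈ U)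
    (hp : p ∈ Z) : ∃ (V : Set M) (w : M → ℝ), IsOpen V ∧ p ∈ V ∧ V ⊆ U ∧
      ContMDiffOn (𝓡 d) 𝓘(ℝ, ℝ) ∞ w V ∧ ∀ q ∈ V, w q ≠ 0 ∧ h q = w q * k q := by
  set χ : OpenPartialHomeomorph M (E d) := chartAt (E d) p with hχ
  have hs : IsSmoothChart d χ := isSmoothChart_chartAt p
  have hpχ : p ∈ χ.source := mem_chart_source _ p
  let T : Set (E d) := χ.target ∩ χ.symm ⁻¹' U
  have hT : IsOpen T := χ.symm.isOpen_inter_preimage hh.isOpen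
  have hpT : χ p ∈ T := ⟨χ.map_source hpχ, by rwa [Set.mem_preimage, χ.left_inv hpχ]⟩
  have hsm : ∀ {g : M → ℝ}, IsDefiningFunctionOn d Z U g →
      ContDiffOn ℝ ∞ (g ∘ χ.symm) T := fun hg =>
    contMDiffOn_iff_contDiffOn.1
      (hg.smooth.comp (hs.smooth_symm.mono Set.inter_subset_left) fun y hy => hy.2)
  have hder : ∀ {g : M → ℝ}, IsDefiningFunctionOn d Z U g →
      fderiv ℝ (g ∘ χ.symm) (χ p) ≠ 0 := by
    intro g hg h0
    refine hg.mfderiv_ne p ⟨hpU, hp⟩ (ContinuousLinearMap.ext fun v => ?_)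
    rw [hs.mfderiv_eq_fderiv_chart hpχ
      ((hg.smooth.contMDiffAt (hg.isOpen.mem_nhds hpU)).mdifferentiableAt (by simp)), h0]
    rfl
  have hzero : ∀ {g : M → ℝ}, IsDefiningFunctionOn d Z U g → ∀ y ∈ T,
      ((g ∘ χ.symm) y = 0 ↔ χ.symm y ∈ Z) := fun hg y hy => hg.zero_iff _ hy.2
  have hkp : (k ∘ χ.symm) (χ p) = 0 := (hzero hk _ hpT).2 (by rwa [χ.left_inv hpχ])
  obtain ⟨u, V, hV, hpV, hu, huV⟩ := exists_eq_mul_of_vanishing hT hpT (hsm hk) (hsm hh) hkp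
    (hder hk) fun y hy h0 => (hzero hh y hy).2 ((hzero hk y hy).1 h0)
  -- As `k` vanishes at `p`, the derivative of `h = u k` there is `u` times that of `k`, and it is
  -- not zero.
  have hup : u (χ p) ≠ 0 := by
    intro h0
    refine hder hh ?_
    have h1 : (h ∘ χ.symm) =ᶠ[𝓝 (χ p)] u * (k ∘ χ.symm) := by
      filter_upwards [hV.mem_nhds hpV] with y hy using huV y hy
    rw [h1.fderiv_eq, fderiv_mul ((hu.contDiffAt (hV.mem_nhds hpV)).differentiableAt (by simp))
      (((hsm hk).contDiffAt (hT.mem_nhds hpT)).differentiableAt (by simp)), h0, hkp]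
    simp
  let V' : Set (E d) := V ∩ u ⁻¹' {0}ᶜ
  have hV' : IsOpen V' := hu.continuousOn.isOpen_inter_preimage hV isOpen_compl_singleton
  let N : Set M := (χ.source ∩ χ ⁻¹' V') ∩ U
  refine ⟨N, u ∘ χ, (χ.isOpen_inter_preimage hV').inter hh.isOpen, ⟨⟨hpχ, hpV, hup⟩, hpU⟩,
    Set.inter_subset_right, ?_, ?_⟩
  · exact (contMDiffOn_iff_contDiffOn.2 hu).comp (hs.smooth.mono fun q hq => hq.1.1)
      fun q hq => hq.1.2.1
  · rintro q ⟨⟨hq, hqV⟩, -⟩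
    refine ⟨hqV.2, ?_⟩
    have := huV _ hqV.1
    simpa [χ.left_inv hq] using this

/-- Near `Z` one has `h = w k` with `w` smooth and nonvanishing, so the difference is `log|w|`.
Hence one function `t` serves for the singular parts of all `F i`. -/
lemma IsDefiningFunction.exists_log_sub_log (hZ : IsHypersurface d Z) {h k : M → ℝ}
    (hh : IsDefiningFunction d Z h) (hk : IsDefiningFunction d Z k) :
    ∃ u : M → ℝ, ContMDiff (𝓡 d) 𝓘(ℝ, ℝ) ∞ u ∧
      ∀ q ∉ Z, u q = Real.log |h q| - Real.log |k q| := by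
  refine hZ.exists_contMDiff_extension fun p => ?_
  by_cases hp : p ∈ Z
  · obtain ⟨V, w, hV, hpV, -, hw, hwV⟩ := IsDefiningFunctionOn.exists_eq_mul hh hk trivial hp
    refine ⟨V, fun q => Real.log (w q), hV, hpV, fun q hq => ?_, fun q hq hqZ => ?_⟩
    · exact ((Real.contDiffAt_log.2 (hwV q hq).1).contMDiffAt.comp q
        (hw.contMDiffAt (hV.mem_nhds hq))).contMDiffWithinAt
    · have hkq : k q ≠ 0 := fun h0 => hqZ ((hk.zero_iff q trivial).1 h0)
      rw [Real.log_abs, Real.log_abs, (hwV q hq).2, Real.log_mul (hwV q hq).1 hkq,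
        add_sub_cancel_right]
  · refine ⟨Zᶜ, _, hZ.isOpen_compl, hp, fun q hq => ?_, fun q _ _ => rfl⟩
    exact ((hh.contMDiffAt_log trivial hq).sub
      (hk.contMDiffAt_log trivial hq)).contMDiffWithinAt

omit [IsManifold (𝓡 d) ∞ M] in
lemma IsDefiningFunction.mul {h w : M → ℝ} (hh : IsDefiningFunction d Z h)
    (hw : ContMDiff (𝓡 d) 𝓘(ℝ, ℝ) ∞ w) (hw0 : ∀ p, w p ≠ 0) :
    IsDefiningFunction d Z fun p => w p * h p where
  isOpen := isOpen_univ
  smooth := hw.contMDiffOn.mul hh.smooth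
  zero_iff q _ := by
    rw [mul_eq_zero, or_iff_right (hw0 q)]
    exact hh.zero_iff q trivial
  mfderiv_ne := by
    rintro q ⟨-, hq⟩ h0
    have h1 := (hw.mdifferentiableAt (by simp) (x := q)).hasMFDerivAt.mul
      ((hh.smooth.contMDiffAt Filter.univ_mem).mdifferentiableAt (by simp) (x := q)).hasMFDerivAt
    have h2 : h q = 0 := (hh.zero_iff q trivial).2 hq
    refine hh.mfderiv_ne q ⟨trivial, hq⟩ (ContinuousLinearMap.ext fun v => ?_)
    have h3 := congrArg (fun L : E d →L[ℝ] ℝ => L v) (h1.mfderiv.symm.trans h0)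
    let Lh : E d →L[ℝ] ℝ := mfderiv (𝓡 d) 𝓘(ℝ, ℝ) h q
    let Lw : E d →L[ℝ] ℝ := mfderiv (𝓡 d) 𝓘(ℝ, ℝ) w q
    have h4 : w q * Lh v + h q * Lw v = 0 := h3
    rw [h2, zero_mul, add_zero] at h4
    exact (mul_eq_zero.1 h4).resolve_left (hw0 q)

omit [IsManifold (𝓡 d) ∞ M] in
-- The smooth part is absorbed into the defining function: `c log|h| + g = c log|exp(g/c) h|`.
lemma IsBFunction.exists_eq_mul_log {f : M → OnePoint ℝ} (hf : IsBFunction d Z f)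
    (hns : ¬ IsSmoothFun d f) : ∃ (c : ℝ) (t : M → ℝ), c ≠ 0 ∧ IsDefiningFunction d Z t ∧
      (∀ p ∈ Z, f p = OnePoint.infty) ∧
      ∀ p ∉ Z, f p = ((c * Real.log |t p| : ℝ) : OnePoint ℝ) := by
  obtain ⟨c, h, g, hc, hh, hg, hfZ, hf⟩ := hf.resolve_left hns
  have hw : ContMDiff (𝓡 d) 𝓘(ℝ, ℝ) ∞ fun p => Real.exp (g p / c) :=
    Real.contDiff_exp.contMDiff.comp (hg.div_const c)
  refine ⟨c, _, hc, hh.mul hw fun p => (Real.exp_pos _).ne', hfZ, fun p hp => ?_⟩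
  have hhp : h p ≠ 0 := fun h0 => hp ((hh.zero_iff p trivial).1 h0)
  rw [hf p hp, Real.log_abs, Real.log_abs, Real.log_mul (Real.exp_pos _).ne' hhp, Real.log_exp,
    mul_add, mul_div_cancel₀ _ hc, add_comm]

/-- Every `b`-function is `c log |t|` up to a smooth function, for a fixed defining function. -/
lemma IsBFunction.exists_eq_mul_log_add (hZ : IsHypersurface d Z) {f : M → OnePoint ℝ}
    (hf : IsBFunction d Z f) {t : M → ℝ} (ht : IsDefiningFunction d Z t) :
    ∃ (c : ℝ) (g : M → ℝ), ContMDiff (𝓡 d) 𝓘(ℝ, ℝ) ∞ g ∧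
      (∀ p ∉ Z, f p = ((c * Real.log |t p| + g p : ℝ) : OnePoint ℝ)) ∧
      (IsSmoothFun d f → c = 0 ∧ ∀ p, f p = (g p : OnePoint ℝ)) := by
  -- For smooth `f` the equality `f = g` is kept on `Z` as well, so that the last `s - r` functions
  -- can be left untouched.
  by_cases hs : IsSmoothFun d f
  · obtain ⟨g, hg, hfg⟩ := hs
    exact ⟨0, g, hg, fun p _ => by rw [zero_mul, zero_add, hfg p], fun _ => ⟨rfl, hfg⟩⟩
  · obtain ⟨c, h, hc, hh, -, hf⟩ := hf.exists_eq_mul_log hs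
    obtain ⟨u, hu, huZ⟩ := hh.exists_log_sub_log hZ ht
    refine ⟨c, fun p => c * u p, contMDiff_const.mul hu, fun p hp => ?_, fun h => absurd h hs⟩
    change f p = ((c * Real.log |t p| + c * u p : ℝ) : OnePoint ℝ)
    rw [hf p hp, huZ p hp, ← mul_add, add_sub_cancel]

end Extension

/-! ### Elementary linear changes of an integrable system. -/

section Change

/-- The index which `π` sends to `j` returns `v j` up to a nonzero factor; the other `v i` are then
recovered by subtraction. -/
lemma span_range_eq_of_elementary {ι V : Type*} [AddCommGroup V] [Module ℝ V] {v w : ι → V}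
    {π : Equiv.Perm ι} {j : ι} {α β : ι → ℝ} (hj : ∀ k, π k = j → α k = 0 ∧ β k ≠ 0)
    (hα : ∀ k, π k ≠ j → α k ≠ 0) (hw : ∀ k, w k = α k • v (π k) + β k • v j) :
    Submodule.span ℝ (Set.range w) = Submodule.span ℝ (Set.range v) := by
  have hv : ∀ i, v i ∈ Submodule.span ℝ (Set.range v) := fun i => Submodule.subset_span ⟨i, rfl⟩
  have hw' : ∀ i, w i ∈ Submodule.span ℝ (Set.range w) := fun i => Submodule.subset_span ⟨i, rfl⟩
  refine le_antisymm (Submodule.span_le.2 ?_) (Submodule.span_le.2 ?_)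
  · rintro _ ⟨k, rfl⟩
    rw [hw]
    exact Submodule.add_mem _ (Submodule.smul_mem _ _ (hv _)) (Submodule.smul_mem _ _ (hv _))
  · have h1 : v j ∈ Submodule.span ℝ (Set.range w) := by
      obtain ⟨h1, h2⟩ := hj (π.symm j) (π.apply_symm_apply j)
      have h3 : v j = (β (π.symm j))⁻¹ • w (π.symm j) := by
        rw [hw, h1, zero_smul, zero_add, smul_smul, inv_mul_cancel₀ h2, one_smul]
      rw [h3]
      exact Submodule.smul_mem _ _ (hw' _)
    rintro _ ⟨i, rfl⟩
    by_cases hi : i = j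
    · rw [hi]; exact h1
    · have h2 := hα (π.symm i) (by rwa [π.apply_symm_apply])
      have h3 : v i = (α (π.symm i))⁻¹ • (w (π.symm i) - β (π.symm i) • v j) := by
        rw [hw, add_sub_cancel_right, smul_smul, inv_mul_cancel₀ h2, one_smul,
          π.apply_symm_apply]
      rw [h3]
      exact Submodule.smul_mem _ _
        (Submodule.sub_mem _ (hw' _) (Submodule.smul_mem _ _ h1))

/-- Independence of a finite family depends only on the dimension of its span. -/
lemma linearIndependent_iff_of_elementary {ι V : Type*} [Fintype ι] [AddCommGroup V] [Module ℝ V]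
    {v w : ι → V} {π : Equiv.Perm ι} {j : ι} {α β : ι → ℝ}
    (hj : ∀ k, π k = j → α k = 0 ∧ β k ≠ 0) (hα : ∀ k, π k ≠ j → α k ≠ 0)
    (hw : ∀ k, w k = α k • v (π k) + β k • v j) :
    LinearIndependent ℝ w ↔ LinearIndependent ℝ v := by
  rw [linearIndependent_iff_card_eq_finrank_span, linearIndependent_iff_card_eq_finrank_span,
    Set.finrank, Set.finrank, span_range_eq_of_elementary hj hα hw]

variable {d : ℕ} {M : Type*} [TopologicalSpace M] [ChartedSpace (E d) M]
  {Z : Set M} {r s : ℕ} {F F' : Fin s → M → OnePoint ℝ} {π : Equiv.Perm (Fin s)} {j : Fin s}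
  {α β : Fin s → ℝ}

variable (d Z r) in
/-- `F'` arises from `F` by adding multiples of the singular function `F j` to the others,
rescaling and permuting the first `r` functions. -/
structure IsElementaryChange (F F' : Fin s → M → OnePoint ℝ) (π : Equiv.Perm (Fin s))
    (j : Fin s) (α β : Fin s → ℝ) : Prop where
  lt : j.val < r
  perm_lt : ∀ k, (π k).val < r ↔ k.val < r
  coeff_pole : ∀ k, π k = j → α k = 0 ∧ β k ≠ 0
  coeff : ∀ k, π k ≠ j → α k ≠ 0
  tail : ∀ k, r ≤ k.val → π k = k ∧ α k = 1 ∧ β k = 0 ∧ F' k = F k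
  pole : ∀ p ∈ Z, F j p = OnePoint.infty
  isBFunction : ∀ k, k.val < r → IsBFunction d Z (F' k)
  map_eq : ∀ p ∉ Z, ∀ k, F' k p =
    ((α k * finitePart (F (π k)) p + β k * finitePart (F j) p : ℝ) : OnePoint ℝ)

namespace IsElementaryChange

variable [IsManifold (𝓡 d) ∞ M] {Ω : BSymplecticForm d Z}
  (h : IsElementaryChange d Z r F F' π j α β) (hF : IsIntegrableSystem Ω r F)
  (hZ : IsHypersurface d Z)

include h hF hZ

lemma bDifferential_eq (k : Fin s) (p : M) :
    bDifferential d Z (F' k) p =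
      α k • bDifferential d Z (F (π k)) p + β k • bDifferential d Z (F j) p :=
  hZ.bDifferential_eq (hZ.isBDifferentialAt_combination
    (fun q hq => finitePart_eq (h.map_eq q hq k)) (hF.contMDiffOn_finitePart _)
    (hF.contMDiffOn_finitePart _) (hF.isBDifferentialAt hZ _ p) (hF.isBDifferentialAt hZ _ p))

lemma hamiltonianVF_eq {k : Fin s} (hk : k.val < r) :
    hamiltonianVF Ω (F' k) =
      α k • hamiltonianVF Ω (F (π k)) + β k • hamiltonianVF Ω (F j) := by
  refine BSymplecticForm.hamiltonianVF_eq hZ fun p => ?_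
  have h1 := hZ.isBDifferentialAt_combination (fun q hq => finitePart_eq (h.map_eq q hq k))
    (hF.contMDiffOn_finitePart _) (hF.contMDiffOn_finitePart _)
    (hF.isHamiltonianVectorField ((h.perm_lt k).2 hk) p) (hF.isHamiltonianVectorField h.lt p)
  convert h1 using 1
  rw [map_add, map_smul, map_smul, map_add, map_smul, map_smul, smul_neg, smul_neg, neg_add]

lemma independentSet_eq : independentSet d Z F' = independentSet d Z F := by
  ext p
  exact linearIndependent_iff_of_elementary h.coeff_pole h.coeff
    (fun k => h.bDifferential_eq hF hZ k p)

lemma hamiltonianVF_apply {k : Fin s} (hk : k.val < r) (p : M) :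
    (hamiltonianVF Ω (F' k)).1 p =
      α k • (hamiltonianVF Ω (F (π k))).1 p + β k • (hamiltonianVF Ω (F j)).1 p := by
  rw [h.hamiltonianVF_eq hF hZ hk]
  rfl

lemma hamiltonianIndependentSet_eq :
    hamiltonianIndependentSet Ω r F' = hamiltonianIndependentSet Ω r F := by
  ext p
  refine linearIndependent_iff_of_elementary (π := π.subtypePerm fun k => h.perm_lt k)
    (j := ⟨j, h.lt⟩) (α := fun k => α k) (β := fun k => β k)
    (fun k hk => h.coeff_pole k (congrArg Subtype.val hk))
    (fun k hk => h.coeff k fun h0 => hk (Subtype.ext h0))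
    (fun k => h.hamiltonianVF_apply hF hZ k.2 p)

lemma distribution_eq (p : M) : distribution Ω r F' p = distribution Ω r F p :=
  span_range_eq_of_elementary (π := π.subtypePerm fun k => h.perm_lt k)
    (j := ⟨j, h.lt⟩) (α := fun k => α k) (β := fun k => β k)
    (fun k hk => h.coeff_pole k (congrArg Subtype.val hk))
    (fun k hk => h.coeff k fun h0 => hk (Subtype.ext h0))
    (fun k => h.hamiltonianVF_apply hF hZ k.2 p)

lemma regularSet_eq : regularSet Ω r F' = regularSet Ω r F := by
  rw [regularSet, regularSet, h.independentSet_eq hF hZ, h.hamiltonianIndependentSet_eq hF hZ]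

lemma leaf_eq (p : M) : leaf Ω r F' p = leaf Ω r F p := by
  have h1 : JoinedByTangentCurve Ω r F' = JoinedByTangentCurve Ω r F := by
    funext p q
    simp only [JoinedByTangentCurve, h.regularSet_eq hF hZ, h.distribution_eq hF hZ]
  rw [leaf, leaf, h1]

lemma isIntegrableSystem : IsIntegrableSystem Ω r F' where
  rank_le := hF.rank_le
  bFunction := h.isBFunction
  smoothFun i hi := by
    rw [(h.tail i hi).2.2.2]
    exact hF.smoothFun i hi
  independent := by
    rw [h.independentSet_eq hF hZ]
    exact hF.independent
  independent_on := by
    rw [h.independentSet_eq hF hZ]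
    exact hF.independent_on
  involution i l hi p := by
    have h1 : ∀ k : Fin s, k.val < r → ∀ l : Fin s,
        bDifferential d Z (F l) p (bValue p (hamiltonianVF Ω (F k))) = 0 := fun k hk l =>
      hF.involution k l hk p
    rw [poissonBracket, h.bDifferential_eq hF hZ, h.hamiltonianVF_eq hF hZ hi]
    simp only [map_add, map_smul, LinearMap.add_apply, LinearMap.smul_apply, h1 j h.lt,
      h1 (π i) ((h.perm_lt i).2 hi), smul_zero, add_zero]
  dim_eq := hF.dim_eq
  hamiltonian_independent := by
    rw [h.hamiltonianIndependentSet_eq hF hZ]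
    exact hF.hamiltonian_independent

lemma exists_isLinearEquivalence :
    ∃ A : (Fin s → ℝ) ≃ₗ[ℝ] (Fin s → ℝ), IsLinearEquivalence Ω F F' A := by
  let L : (Fin s → ℝ) →ₗ[ℝ] (Fin s → ℝ) := LinearMap.pi fun k =>
    α k • LinearMap.proj (π k) + β k • LinearMap.proj j
  have hL : ∀ x k, L x k = α k * x (π k) + β k * x j := fun x k => rfl
  have hinj : Function.Injective L := by
    rw [injective_iff_map_eq_zero]
    intro x hx
    have h1 : ∀ k, α k * x (π k) + β k * x j = 0 := fun k => congrFun hx k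
    have hxj : x j = 0 := by
      obtain ⟨h2, h3⟩ := h.coeff_pole (π.symm j) (π.apply_symm_apply j)
      have h4 := h1 (π.symm j)
      rw [h2, zero_mul, zero_add] at h4
      exact (mul_eq_zero.1 h4).resolve_left h3
    funext i
    by_cases hi : i = j
    · rw [hi, hxj]; rfl
    · have h4 := h1 (π.symm i)
      rw [hxj, mul_zero, add_zero, π.apply_symm_apply] at h4
      exact (mul_eq_zero.1 h4).resolve_left
        (h.coeff (π.symm i) (by rwa [π.apply_symm_apply]))
  refine ⟨LinearEquiv.ofInjectiveEndo L hinj, ⟨?_, ?_⟩⟩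
  · intro p x hx k
    -- At points of `Z` the function `F j` is infinite.
    have hp : p ∉ Z := by
      intro hp
      have h1 := (h.pole p hp).symm.trans (hx j)
      exact OnePoint.infty_ne_coe _ h1
    rw [h.map_eq p hp k, finitePart_eq (hx _), finitePart_eq (hx _)]
    rfl
  · intro p _ k l
    change _ = ∑ i, ∑ i', L (Pi.single i 1) k * L (Pi.single i' 1) l * _
    simp only [hL]
    -- For `k < r` both sides vanish: row `k` of the matrix involves only indices below `r`, and
    -- those functions are in involution with all.
    rcases lt_or_ge k.val r with hk | hk
    · rw [(h.isIntegrableSystem hF hZ).involution k l hk p]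
      refine (Finset.sum_eq_zero fun i _ => Finset.sum_eq_zero fun i' _ => ?_).symm
      rcases lt_or_ge i.val r with hi | hi
      · rw [hF.involution i i' hi p, mul_zero]
      · have h1 : π k ≠ i := fun h0 => hi.not_gt (h0 ▸ (h.perm_lt k).2 hk)
        have h2 : j ≠ i := fun h0 => hi.not_gt (h0 ▸ h.lt)
        rw [Pi.single_eq_of_ne h1, Pi.single_eq_of_ne h2, mul_zero, mul_zero, add_zero, zero_mul,
          zero_mul]
    -- For `k ≥ r` row `k` is that of the identity and `F' k = F k` exactly. So the Hamiltonian
    -- field on the left is the same object, and only linearity of the `b`-differential in the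
    -- second entry is needed.
    · obtain ⟨h1, h2, h3, h4⟩ := h.tail k hk
      rw [Finset.sum_eq_single k]
      · rw [h1, h2, h3, Pi.single_eq_same, zero_mul, add_zero, mul_one]
        simp only [one_mul, add_mul, Finset.sum_add_distrib, Pi.single_apply, mul_ite, mul_one,
          mul_zero, ite_mul, zero_mul, Finset.sum_ite_eq, Finset.mem_univ, if_true]
        rw [poissonBracket, h.bDifferential_eq hF hZ, h4]
        rfl
      · intro i _ hi
        refine Finset.sum_eq_zero fun i' _ => ?_
        rw [h1, h3, Pi.single_eq_of_ne hi.symm]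
        simp
      · intro h0
        exact absurd (Finset.mem_univ k) h0

end IsElementaryChange

end Change

/-! ### Logarithmic normal form and the tubular neighbourhood. -/

section NormalForm

variable {d : ℕ} {M : Type*} [TopologicalSpace M] [ChartedSpace (E d) M]
  [IsManifold (𝓡 d) ∞ M] {Z : Set M} {Ω : BSymplecticForm d Z} {r s : ℕ}
  {F : Fin s → M → OnePoint ℝ}

lemma logAbs_of_ne_zero {x : ℝ} (hx : x ≠ 0) : logAbs x = ((Real.log |x| : ℝ) : OnePoint ℝ) :=
  if_neg hx

lemma logAbs_zero : logAbs 0 = OnePoint.infty := if_pos rfl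

omit [IsManifold (𝓡 d) ∞ M] in
lemma IsDefiningFunction.isBFunction_logAbs {t : M → ℝ} (ht : IsDefiningFunction d Z t) :
    IsBFunction d Z fun p => logAbs (t p) := by
  refine Or.inr ⟨1, t, fun _ => 0, one_ne_zero, ht, contMDiff_const, fun p hp => ?_,
    fun p hp => ?_⟩
  · change logAbs (t p) = OnePoint.infty
    rw [(ht.zero_iff p trivial).2 hp, logAbs_zero]
  · change logAbs (t p) = ((1 * Real.log |t p| + 0 : ℝ) : OnePoint ℝ)
    rw [logAbs_of_ne_zero fun h0 => hp ((ht.zero_iff p trivial).1 h0), one_mul, add_zero]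

namespace IsIntegrableSystem

variable (hF : IsIntegrableSystem Ω r F) (hZ : IsHypersurface d Z)
include hF hZ

/-- An integrable system can be brought into logarithmic normal form. -/
lemma exists_isElementaryChange {m : M} (hmZ : m ∈ Z) (hm : m ∈ regularSet Ω r F) :
    ∃ (F' : Fin s → M → OnePoint ℝ) (π : Equiv.Perm (Fin s)) (j : Fin s) (α β : Fin s → ℝ),
      IsElementaryChange d Z r F F' π j α β ∧ IsLogNormalForm d Z F' := by
  obtain ⟨j, hj, hns⟩ := hF.exists_not_isSmoothFun hZ hmZ hm
  obtain ⟨c, t, hc, ht, hpole, hjt⟩ := (hF.isBFunction j).exists_eq_mul_log hns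
  choose e g hg hfg hsm using fun i => (hF.isBFunction i).exists_eq_mul_log_add hZ ht
  let i₀ : Fin s := ⟨0, j.pos⟩
  let π : Equiv.Perm (Fin s) := Equiv.swap i₀ j
  have hi₀ : i₀.val < r := j.val.zero_le.trans_lt hj
  have hπ : ∀ k, π k = j ↔ k = i₀ := fun k => by
    rw [← Equiv.eq_symm_apply, Equiv.symm_swap, Equiv.swap_apply_right]
  have hperm : ∀ k, (π k).val < r ↔ k.val < r := by
    intro k
    simp only [π, Equiv.swap_apply_def]
    split_ifs with h1 h2
    · rw [h1]; exact iff_of_true hj hi₀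
    · rw [h2]; exact iff_of_true hi₀ hj
    · rfl
  -- Off `Z` one has `F j = c log|t|` and `F i = e i * log|t| + g i`; these coefficients solve for
  -- `log|t|` and `g i`.
  let α : Fin s → ℝ := fun k => if π k = j then 0 else 1
  let β : Fin s → ℝ := fun k => if π k = j then c⁻¹ else -(e (π k) / c)
  let F' : Fin s → M → OnePoint ℝ := fun k =>
    if π k = j then fun p => logAbs (t p) else fun p => (g (π k) p : OnePoint ℝ)
  have hF'0 : ∀ k, π k = j → F' k = fun p => logAbs (t p) := fun k hk => if_pos hk
  have hF'1 : ∀ k, π k ≠ j → F' k = fun p => (g (π k) p : OnePoint ℝ) := fun k hk => if_neg hk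
  have hsmooth : ∀ k, π k ≠ j → IsSmoothFun d (F' k) := fun k hk => by
    rw [hF'1 k hk]
    exact ⟨g (π k), hg _, fun p => rfl⟩
  refine ⟨F', π, j, α, β, ⟨hj, hperm, ?_, ?_, ?_, hpole, ?_, ?_⟩, t, ht, fun i => ⟨?_, ?_⟩⟩
  · intro k hk
    exact ⟨if_pos hk, by simp only [β, if_pos hk]; exact inv_ne_zero hc⟩
  · intro k hk
    simp only [α, if_neg hk]
    exact one_ne_zero
  · intro k hk
    have h1 : π k = k := by
      refine Equiv.swap_apply_of_ne_of_ne ?_ ?_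
      · rintro rfl; exact hk.not_gt hi₀
      · rintro rfl; exact hk.not_gt hj
    have h2 : π k ≠ j := by
      rw [h1]; rintro rfl; exact hk.not_gt hj
    obtain ⟨h3, h4⟩ := hsm k (hF.smoothFun k hk)
    refine ⟨h1, if_neg h2, ?_, ?_⟩
    · simp only [β, if_neg h2, h1, h3, zero_div, neg_zero]
    · rw [hF'1 k h2, h1]
      exact (funext h4).symm
  · intro k _
    by_cases hk : π k = j
    · rw [hF'0 k hk]
      exact ht.isBFunction_logAbs
    · exact Or.inl (hsmooth k hk)
  · intro p hp k
    rw [finitePart_eq (hjt p hp)]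
    by_cases hk : π k = j
    · simp only [hF'0 k hk, α, β, if_pos hk]
      rw [logAbs_of_ne_zero fun h0 => hp ((ht.zero_iff p trivial).1 h0), zero_mul, zero_add,
        inv_mul_cancel_left₀ hc]
    · simp only [hF'1 k hk, α, β, if_neg hk]
      rw [finitePart_eq (hfg (π k) p hp)]
      congr 1
      field_simp
      ring
  · intro hi
    rw [hF'0 i ((hπ i).2 (Fin.ext hi))]
    exact fun p => rfl
  · intro hi
    exact hsmooth i fun h0 => hi (congrArg Fin.val ((hπ i).1 h0))

omit hZ in
lemma range_castLE {V : Type*} (v : Fin s → V) :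
    (Set.range fun i : {i : Fin s // i.val < r} => v i) =
      Set.range fun i => v (Fin.castLE hF.rank_le i) :=
  ((Fin.castLEquiv hF.rank_le).surjective.range_comp
    fun i : {i : Fin s // i.val < r} => v i).symm

omit hZ in
lemma leaf_eq_tangentLeaf (p : M) : leaf Ω r F p =
    tangentLeaf (fun i q => (hamiltonianVF Ω (F (Fin.castLE hF.rank_le i))).1 q)
      (regularSet Ω r F) p := by
  have h1 : JoinedByTangentCurve Ω r F =
      TangentJoined (fun i q => (hamiltonianVF Ω (F (Fin.castLE hF.rank_le i))).1 q)
        (regularSet Ω r F) := by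
    funext p q
    simp only [JoinedByTangentCurve, TangentJoined, distribution]
    have h2 : ∀ p : M, (Set.range fun i : {i : Fin s // i.val < r} =>
        ((hamiltonianVF Ω (F i)).1 p : TangentSpace (𝓡 d) p)) =
        Set.range fun i => (hamiltonianVF Ω (F (Fin.castLE hF.rank_le i))).1 p := fun p =>
      hF.range_castLE fun i => (hamiltonianVF Ω (F i)).1 p
    simp only [h2]
  rw [leaf, tangentLeaf, h1]

/-- The identity `dt = t d log|t|` holds off `Z`, and both sides have limits at `Z`. So `dt`
vanishes on `Z` as a `b`-covector, although the ordinary differential does not. -/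
lemma lieDeriv_eq_mul_of_eq_logAbs {t : M → ℝ} (ht : IsDefiningFunction d Z t) {i : Fin s}
    (hi : ∀ p, F i p = logAbs (t p)) (p : M) (Y : BVectorField d Z) :
    lieDeriv Y t p = t p * bDifferential d Z (F i) p (bValue p Y) := by
  have hts := contMDiffOn_univ.1 ht.smooth
  have := hZ.neBot_nhdsWithin p
  have h1 := (contMDiffOn_univ.1 (contMDiffOn_lieDeriv isOpen_univ ht.smooth
    Y)).continuous.tendsto p
  have h2 := (hts.continuous.tendsto p).mono_left (nhdsWithin_le_nhds (s := Zᶜ))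
  refine tendsto_nhds_unique (h1.mono_left (nhdsWithin_le_nhds (s := Zᶜ)))
    ((h2.mul (hF.isBDifferentialAt hZ i p Y)).congr' ?_)
  have ht0 : ∀ q ∉ Z, t q ≠ 0 := fun q hq h0 => hq ((ht.zero_iff q trivial).1 h0)
  filter_upwards [self_mem_nhdsWithin] with q hq
  have h3 : finitePart (F i) =ᶠ[𝓝 q] Real.log ∘ t := by
    filter_upwards [hZ.isOpen_compl.mem_nhds hq] with q' hq'
    refine finitePart_eq ?_
    rw [hi, Function.comp_apply, ← Real.log_abs]
    exact logAbs_of_ne_zero (ht0 q' hq')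
  have h5 := mfderiv_comp q (Real.differentiableAt_log (ht0 q hq)).mdifferentiableAt
    ((hts q).mdifferentiableAt (by simp))
  rw [mfderiv_eq_fderiv] at h5
  let L : E d →L[ℝ] ℝ := mfderiv (𝓡 d) 𝓘(ℝ, ℝ) t q
  have h6 : lieDeriv Y (Real.log ∘ t) q = fderiv ℝ Real.log (t q) (L (Y.1 q)) :=
    congrArg (fun L : E d →L[ℝ] ℝ => L (Y.1 q)) h5
  have h7 : fderiv ℝ Real.log (t q) (L (Y.1 q)) = L (Y.1 q) * (t q)⁻¹ := by
    rw [fderiv_eq_smul_deriv, Real.deriv_log, smul_eq_mul]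
  rw [lieDeriv_congr h3, h6, h7, mul_left_comm, mul_inv_cancel₀ (ht0 q hq), mul_one]
  rfl

omit hF hZ in
/-- If the derivatives of the functions `u i` along `b`-vector fields are multiples of the values
of independent `b`-covectors, and the derivative of the function whose multiple vanishes is not
zero, then the ordinary differentials of the `u i` are independent. -/
lemma _root_.BSymp.linearIndependent_of_lieDeriv_eq_mul {p : M} {η : Fin s → BCotangent d Z p}
    (hη : LinearIndependent ℝ η) {τ : Fin s → ℝ} {ξ : Fin s → Module.Dual ℝ (E d)}
    (h : ∀ i (Y : BVectorField d Z), ξ i (Y.1 p) = τ i * η i (bValue p Y))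
    (hτ : ∀ i, i.val ≠ 0 → τ i ≠ 0) (hξ : ∀ i, τ i = 0 → ξ i ≠ 0) : LinearIndependent ℝ ξ := by
  refine Fintype.linearIndependent_iff.2 fun a ha => ?_
  have h0 : ∀ v : E d, ∑ i, a i * ξ i v = 0 := fun v => by
    have := congrArg (fun L : E d →ₗ[ℝ] ℝ => L v) ha
    simpa using this
  have h1 : ∑ i, (a i * τ i) • η i = 0 := by
    ext Y
    have h2 : ∑ i, a i * τ i * η i (bValue p Y) = 0 := by
      simp only [mul_assoc, ← h]
      exact h0 (Y.1 p)
    refine Eq.trans ?_ h2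
    rw [LinearMap.comp_apply, LinearMap.sum_apply]
    rfl
  have h2 := Fintype.linearIndependent_iff.1 hη _ h1
  have h3 : ∀ i, τ i ≠ 0 → a i = 0 := fun i hi => (mul_eq_zero.1 (h2 i)).resolve_right hi
  intro i
  -- Only index `0` can have `τ i = 0`; all other coefficients vanish by `h3`, and then `ξ i ≠ 0`
  -- removes the last one.
  by_cases hi : τ i = 0
  · have hi0 : i.val = 0 := by_contra fun hi' => hτ i hi' hi
    rw [Finset.sum_eq_single i (fun k _ hk => by
      rw [h3 k (hτ k fun hk0 => hk (Fin.ext (hk0.trans hi0.symm))), zero_smul])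
      fun h => absurd (Finset.mem_univ i) h] at ha
    exact (smul_eq_zero.1 ha).resolve_right (hξ i hi)
  · exact h3 i hi

omit hF hZ [IsManifold (𝓡 d) ∞ M] in
lemma _root_.BSymp.contMDiff_toLp {u : Fin s → M → ℝ}
    (hu : ∀ i, ContMDiff (𝓡 d) 𝓘(ℝ, ℝ) ∞ (u i)) :
    ContMDiff (𝓡 d) 𝓘(ℝ, E s) ∞ fun q => (WithLp.toLp 2 fun i => u i q : E s) :=
  (EuclideanSpace.equiv (Fin s) ℝ).symm.contDiff.contMDiff.comp (contMDiff_pi_space.2 hu)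

omit hF hZ [IsManifold (𝓡 d) ∞ M] in
lemma _root_.BSymp.mfderiv_apply_coord {f : M → E s} {p : M}
    (hf : MDifferentiableAt (𝓡 d) 𝓘(ℝ, E s) f p) (v : TangentSpace (𝓡 d) p) (i : Fin s) :
    (EuclideanSpace.proj i : E s →L[ℝ] ℝ) (mfderiv (𝓡 d) 𝓘(ℝ, E s) f p v) =
      mfderiv (𝓡 d) 𝓘(ℝ, ℝ) (fun q => f q i) p v := by
  have h1 := mfderiv_comp p (I := 𝓡 d) (I' := 𝓘(ℝ, E s)) (I'' := 𝓘(ℝ, ℝ)) (f := f)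
    (EuclideanSpace.proj i : E s →L[ℝ] ℝ).differentiableAt.mdifferentiableAt hf
  rw [mfderiv_eq_fderiv, ContinuousLinearMap.fderiv] at h1
  exact (congrArg (fun L : E d →L[ℝ] ℝ => L v) h1).symm

/-- For a system in logarithmic normal form, the functions `t, f_2, …, f_s` are smooth, constant
along the Hamiltonian vector fields, and independent on the regular set. -/
lemma exists_smooth_components (hln : IsLogNormalForm d Z F) :
    ∃ u : Fin s → M → ℝ, (∀ i, ContMDiff (𝓡 d) 𝓘(ℝ, ℝ) ∞ (u i)) ∧
      (∀ i p, F i p = if i.val = 0 then logAbs (u i p) else (u i p : OnePoint ℝ)) ∧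
      (∀ i k, k.val < r → ∀ p, lieDeriv (hamiltonianVF Ω (F k)) (u i) p = 0) ∧
      ∀ p ∈ regularSet Ω r F, LinearIndependent ℝ fun i =>
        ContinuousLinearMap.toLinearMap (M := E d) (M₂ := ℝ) (mfderiv (𝓡 d) 𝓘(ℝ, ℝ) (u i) p) := by
  obtain ⟨t, ht, hFt⟩ := hln
  have hu : ∀ i, ∃ u : M → ℝ, ContMDiff (𝓡 d) 𝓘(ℝ, ℝ) ∞ u ∧
      (∀ p, F i p = if i.val = 0 then logAbs (u p) else (u p : OnePoint ℝ)) ∧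
      (i.val = 0 → u = t) := by
    intro i
    by_cases hi : i.val = 0
    · simp only [if_pos hi]
      exact ⟨t, contMDiffOn_univ.1 ht.smooth, (hFt i).1 hi, fun _ => rfl⟩
    · obtain ⟨g, hg, hfg⟩ := (hFt i).2 hi
      simp only [if_neg hi]
      exact ⟨g, hg, hfg, fun h => absurd h hi⟩
  choose u hu hFu hut using hu
  let τ : Fin s → M → ℝ := fun i p => if i.val = 0 then t p else 1
  have hτ : ∀ i p (Y : BVectorField d Z),
      lieDeriv Y (u i) p = τ i p * bDifferential d Z (F i) p (bValue p Y) := by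
    intro i p Y
    by_cases hi : i.val = 0
    · simp only [τ, if_pos hi, hut i hi]
      exact hF.lieDeriv_eq_mul_of_eq_logAbs hZ ht ((hFt i).1 hi) p Y
    · simp only [τ, if_neg hi, one_mul]
      refine (hF.bDifferential_apply_smooth hZ (hu i) (fun p _ => ?_) p Y).symm
      rw [hFu, if_neg hi]
  refine ⟨u, hu, hFu, fun i k hk p => ?_, fun p hp => ?_⟩
  · have h1 : bDifferential d Z (F i) p (bValue p (hamiltonianVF Ω (F k))) = 0 :=
      hF.involution k i hk p
    rw [hτ, h1, mul_zero]
  · refine linearIndependent_of_lieDeriv_eq_mul (p := p) hp.1 (τ := fun i => τ i p)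
      (fun i Y => hτ i p Y) (fun i hi => ?_) fun i hi h0 => ?_
    · simp only [τ, if_neg hi]
      exact one_ne_zero
    · have hi0 : i.val = 0 := by
        by_contra h1
        simp only [τ, if_neg h1] at hi
        exact one_ne_zero hi
      have htp : t p = 0 := by simpa only [τ, if_pos hi0] using hi
      refine ht.mfderiv_ne p ⟨trivial, (ht.zero_iff p trivial).1 htp⟩
        (ContinuousLinearMap.ext fun v => ?_)
      rw [← hut i hi0]
      exact congrArg (fun L : Module.Dual ℝ (E d) => L v) h0

omit hZ in
lemma linearIndependent_hamiltonianVF {p : M} (hp : p ∈ regularSet Ω r F) :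
    LinearIndependent ℝ fun i : Fin r =>
      ((hamiltonianVF Ω (F (Fin.castLE hF.rank_le i))).1 p : TangentSpace (𝓡 d) p) := by
  have h : LinearIndependent ℝ fun i : {i : Fin s // i.val < r} =>
    ((hamiltonianVF Ω (F i)).1 p : TangentSpace (𝓡 d) p) := hp.2
  exact h.comp (fun i : Fin r => ⟨Fin.castLE hF.rank_le i, i.2⟩) fun i k hik =>
    Fin.castLE_injective hF.rank_le (congrArg Subtype.val hik)

lemma mlieBracket_hamiltonianVF {i k : Fin s} (hi : i.val < r) (hk : k.val < r) (p : M) :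
    VectorField.mlieBracket (𝓡 d) (fun q => (hamiltonianVF Ω (F i)).1 q)
      (fun q => (hamiltonianVF Ω (F k)).1 q) p = 0 :=
  hF.bBracket_eq_zero hZ hi hk p

/-- For a system in logarithmic normal form, the functions `t, f_2, …, f_s` have flow boxes on
the regular set. -/
lemma exists_hasFlowBoxes (hln : IsLogNormalForm d Z F) :
    ∃ f : M → E s, HasFlowBoxes f
        (fun i q => (hamiltonianVF Ω (F (Fin.castLE hF.rank_le i))).1 q) (regularSet Ω r F) ∧
      ∀ q i, F i q = standardIntegrals (f q) i := by
  obtain ⟨u, hu, hFu, htan, hli⟩ := hF.exists_smooth_components hZ hln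
  have hf := contMDiff_toLp hu
  have hfd := fun q => (hf q).mdifferentiableAt (by simp)
  refine ⟨fun q => WithLp.toLp 2 fun i => u i q, fun p hp => ?_, fun q i => hFu i q⟩
  obtain ⟨β, h1, h2, h3⟩ := exists_isFlowBox
    (X := fun i q => (hamiltonianVF Ω (F (Fin.castLE hF.rank_le i))).1 q)
    (hF.isOpen_regularSet hZ) hf.contMDiffOn
    (fun i => (hamiltonianVF Ω (F (Fin.castLE hF.rank_le i))).1.contMDiff)
    (fun q _ i k => hF.mlieBracket_hamiltonianVF hZ (i := Fin.castLE hF.rank_le i)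
      (k := Fin.castLE hF.rank_le k) i.2 k.2 q)
    (fun q _ i => PiLp.ext fun k =>
      (mfderiv_apply_coord (hfd q) _ k).trans (htan k (Fin.castLE hF.rank_le i) i.2 q))
    hF.dim_eq hp (hF.linearIndependent_hamiltonianVF hp)
    (fun w => by
      obtain ⟨v, hv⟩ := surjective_pi_of_linearIndependent (hli p hp) fun i =>
        (EuclideanSpace.proj i : E s →L[ℝ] ℝ) w
      exact ⟨v, PiLp.ext fun k => (mfderiv_apply_coord (hfd p) v k).trans (congrFun hv k)⟩)
  exact ⟨β, h3, h1, h2⟩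

/-- The tubular neighbourhood of a compact leaf of a system in logarithmic normal form. -/
theorem exists_trivialization [T2Space M] (hln : IsLogNormalForm d Z F) {m : M}
    (hm : m ∈ regularSet Ω r F) (hc : IsCompact (leaf Ω r F m)) :
    ∃ (b : E s) (ε : ℝ) (φ : OpenPartialHomeomorph M (Torus r × E s)), 0 < ε ∧
      leaf Ω r F m ⊆ φ.source ∧ φ.source ⊆ regularSet Ω r F ∧
      φ.target = Set.univ ×ˢ Metric.ball b ε ∧ (φ m).2 = b ∧
      ContMDiffOn (𝓡 d) (torusModel r s) ∞ φ φ.source ∧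
      ContMDiffOn (torusModel r s) (𝓡 d) ∞ φ.symm φ.target ∧
      (∀ q ∈ φ.source, leaf Ω r F q = {q' ∈ φ.source | (φ q').2 = (φ q).2}) ∧
      ∀ q ∈ φ.source, ∀ i, F i q = standardIntegrals (φ q).2 i := by
  obtain ⟨f, hf, hFf⟩ := hF.exists_hasFlowBoxes hZ hln
  simp only [hF.leaf_eq_tangentLeaf] at hc ⊢
  obtain ⟨ε, φ, h1, h2, h3, h4, h5, h6, h7, h8⟩ := hf.exists_trivialization hm hc
  refine ⟨f m, ε, φ, h1, h2, h3, h4, h5 m (h2 Relation.ReflTransGen.refl), h6, h7,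
    fun q hq => ?_, fun q hq i => ?_⟩
  · rw [h8 q hq]
    ext q'
    refine and_congr_right fun hq' => ?_
    rw [h5 q hq, h5 q' hq']
  · rw [h5 q hq, hFf]

end IsIntegrableSystem

lemma isLinearEquivalence_refl (Ω : BSymplecticForm d Z) (F : Fin s → M → OnePoint ℝ) :
    IsLinearEquivalence Ω F F (LinearEquiv.refl ℝ _) where
  map_eq _ _ hx k := hx k
  poisson p _ k l := by
    simp only [LinearEquiv.refl_apply, Pi.single_apply, ite_mul, mul_ite, one_mul, mul_one,
      zero_mul, mul_zero]
    simp

end NormalForm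

end BSymp

theorem mainTheorem4 {n r s : ℕ} {M : Type*} [TopologicalSpace M]
    [ChartedSpace (EuclideanSpace ℝ (Fin (2 * n))) M] [IsManifold (𝓡 (2 * n)) ∞ M]
    [T2Space M] [SecondCountableTopology M]
    (Z : Set M) (hZ : IsHypersurface (2 * n) Z) (Ω : BSymplecticForm (2 * n) Z)
    (F : Fin s → M → OnePoint ℝ) (hF : IsIntegrableSystem Ω r F)
    (m : M) (hmZ : m ∈ Z) (hm : m ∈ regularSet Ω r F) (hc : IsCompact (leaf Ω r F m)) :
    ∃ F' : Fin s → M → OnePoint ℝ,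
      IsIntegrableSystem Ω r F' ∧ IsLogNormalForm (2 * n) Z F' ∧
      (∃ A : (Fin s → ℝ) ≃ₗ[ℝ] (Fin s → ℝ), IsLinearEquivalence Ω F F' A) ∧
      (IsLogNormalForm (2 * n) Z F → F' = F) ∧
      ∃ (b : EuclideanSpace ℝ (Fin s)) (ε : ℝ)
        (φ : OpenPartialHomeomorph M (Torus r × EuclideanSpace ℝ (Fin s))),
        0 < ε ∧
        leaf Ω r F m ⊆ φ.source ∧
        φ.source ⊆ regularSet Ω r F ∧
        φ.target = Set.univ ×ˢ Metric.ball b ε ∧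
        (φ m).2 = b ∧
        ContMDiffOn (𝓡 (2 * n)) (torusModel r s) ∞ φ φ.source ∧
        ContMDiffOn (torusModel r s) (𝓡 (2 * n)) ∞ φ.symm φ.target ∧
        (∀ q ∈ φ.source, leaf Ω r F q = {q' ∈ φ.source | (φ q').2 = (φ q).2}) ∧
        (∀ q ∈ φ.source, ∀ i, F' i q = standardIntegrals (φ q).2 i) := by
  -- A system already in normal form is kept as it is, which gives the clause `F' = F`.
  by_cases hln : IsLogNormalForm (2 * n) Z F
  · exact ⟨F, hF, hln, ⟨_, isLinearEquivalence_refl Ω F⟩, fun _ => rfl,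
      hF.exists_trivialization hZ hln hm hc⟩
  · obtain ⟨F', π, j, α, β, h, hln'⟩ := hF.exists_isElementaryChange hZ hmZ hm
    have hF' := h.isIntegrableSystem hF hZ
    refine ⟨F', hF', hln', h.exists_isLinearEquivalence hF hZ, fun h' => absurd h' hln, ?_⟩
    -- The change preserves regular points and leaves, so the hypotheses on `m` pass to `F'`.
    simp only [← h.leaf_eq hF hZ, ← h.regularSet_eq hF hZ] at hm hc ⊢
    exact hF'.exists_trivialization hZ hln' hm hc
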